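/- \textbf{Setting.} Let $G$ be a countably infinite set and $(G,E)$ a connected simple graph of bounded degree ($x\sim y$ means $(x,y)\in E$). Write $f\asymp g$ if $C^{-1}f\le g\le Cf$ with a constant $C>0$ independent of the variables. \emph{Tree.} Let $(T,\pi,\phi)$ be a bi-infinite tree with a reference point: $T$ is countable, $\phi\in T$ and $\pi:T\to T$ satisfies: for all $w,v\in T$ there are $n,m\ge0$ with $\pi^n(w)=\pi^m(v)$, and $\pi^n(w)\ne w$ for all $n\ge1$, $w\in T$. The height is $[w]=n-m$ if $\pi^n(w)=\pi^m(\phi)$; $S(A)=\pi^{-1}(A)$, $T_w=\bigcup_{n\ge0}S^n(\{w\})$, and $\Sigma^*$ is the set of $(\omega_n)_{n\in\mathbb Z}$ with $[\omega_n]=n$, $\pi(\omega_{n+1})=\omega_n$. \emph{Partition.} A partition of $(G,E)$ is a map $K$ from $T$ to the finite subsets of $G$ with $K_w=\bigcup_{v\in S(w)}K_v$ for all $w$; for each $\omega\in\Sigma^*$ there are $x\sim y$ and $n_0$ with $K_{\omega_n}=\{x,y\}$ for $n\ge n_0$; and each $(x,y)\in E$ has some $w$ with $K_w=\{x,y\}$.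 Put $\Lambda_e=\{w:\#K_w=2<\#K_{\pi(w)}\}$, $T_e=\{w:T_w\cap\Lambda_e\ne\emptyset\}$. $K$ is minimal if $K_w\neq K_v$ for distinct $w,v\in\Lambda_e$, and connected if each $K_w$ ($w\in T_e$) induces a connected subgraph. \emph{Metric.} Let $d$ be a metric on $G$ with $\mathrm{diam}(G,d)=\infty$, $B_d(x,s)=\{y:d(x,y)<s\}$, $r_x=\inf_{y\ne x}d(x,y)$. It fits to $(G,E)$ if (F1) there is $C>0$ with $d(x,y)\le Cd(x,z)$ whenever $x\sim y$, $z\ne x$; and (F2) for each $\epsilon>0$ there are $s>0$, $n\ge1$ and a path $x_0\sim x_1\sim\dots\sim x_n$ with $x_i\in B_d(x_0,s)$ for $i<n$, $x_n\notin B_d(x_0,s)$ and $d(x_i,x_{i-1})\le\epsilon s$ for $1\le i\le n$. Let $d(w)=\mathrm{diam}(K_w,d)$, $\Lambda_s=\{w\in T_e:d(w)\le s<d(\pi(w))\}$, and join distinct $w,v\in\Lambda_s$ by an edge if $K_w\cap K_v\ne\emptyset$. Let $\Lambda_{s,M}(w)$ be the ball of radius $M$ around $w$ in this graph on $\Lambda_s$,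 $\Lambda_{s,M}(x)=\bigcup\{\Lambda_{s,M}(w):w\in\Lambda_s,\ x\in K_w\}$, and $U_M(x,s)=\bigcup_{w\in\Lambda_{s,M}(x)}K_w$, or $\{x\}$ if $\Lambda_{s,M}(x)=\emptyset$. The metric $d$ satisfies the basic framework with ratio $r\in(0,1)$ if: $\sup_{w\in T_e\setminus\Lambda_e}\#S(w)<\infty$; $\sup_{s>0,\,w\in\Lambda_s}\#\Lambda_{s,1}(w)<\infty$ (uniformly finite); there is $a>0$ such that every $w\in T_e$ has some $x\in K_w$ with $\Lambda_{a d(\pi(w)),1}(x)\subseteq T_w$ (thick); there are $M\ge1$, $a_1,a_2>0$ with $B_d(x,a_1s)\subseteq U_M(x,s)\subseteq B_d(x,a_2s)$ for all $x\in G$, $s>0$ (adapted); and $d(w)\asymp r^{[w]}$ on $T_e$. \emph{Refined tree.} Let $n(m)\in\mathbb N$ satisfy $2^{-n(m)}\le r^m<2^{1-n(m)}$. Let $T_r$ consist of $T_e$ (with parent map $\pi$ and heights as in $T$) and, for each $v\in\Lambda_e$ and $m\ge1$, of $2^{n(m)}$ vertices of height $[v]+m$, which represent the dyadic subintervals of length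 $2^{-n(m)}$ of the edge $K_v$ identified with $[0,1]$. The parent of a subinterval of depth $m\ge2$ is the one of depth $m-1$ containing it, and the parent of one of depth $1$ is $v$. From now on $\pi$, $S$ and $[\cdot]$ refer to $T_r$. Let $\underline K_w=K_w$ for $w\in T_e$, and, for a subinterval $w$ of an edge, let $\underline K_w$ be the set of endpoints of that edge lying in $w$. Let $J$ be the graph on $T_r$ in which distinct $w,u$ of the same height are adjacent iff $\underline K_w\cap\underline K_u\neq\emptyset$ or $w,u$ are consecutive subintervals of the same edge; let $\ell_J$ be its (possibly infinite) graph distance and $\Gamma_n(w)=\{u:\ell_J(w,u)\le n\}$. For $p>0$, $k,N_1,N_2\ge0$ and $N\ge1$ let \[\mathcal E_{p,k,w}(N_1,N_2,N)=\inf_f\frac12\sum_{(u,v):\,[u]=[v]=[w]+k,\ 0<\ell_J(u,v)\le N}|f(u)-f(v)|^p,\] where $f$ runs over the real functions on the vertices of height $[w]+k$ with $f=1$ on $S^k(\Gamma_{N_1}(w))$ and $f=0$ off $S^k(\Gamma_{N_2}(w))$. Define \[\overline{\mathcal N}=\sup_{w\in T_r}\limsup_{k\to\infty}\#\bigl(S^k(\pi^k(w))\bigr)^{1/k},\quad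 \underline{\mathcal N}=\sup_{w\in T_r}\liminf_{k\to\infty}\#\bigl(S^k(\pi^k(w))\bigr)^{1/k},\] \[\underline{\mathcal R}_2(N_1,N_2,N)=\sup_{w\in T_r}\liminf_{k\to\infty}\mathcal E_{2,k,\pi^k(w)}(N_1,N_2,N)^{1/k}.\] \emph{Random walk.} Let $\mu_{xy}=\mu_{yx}>0$ for $(x,y)\in E$ (and $\mu_{xy}=0$ otherwise), $\mu_x=\sum_{y\sim x}\mu_{xy}$, $\mu(A)=\sum_{x\in A}\mu_x$ and $V(x,s)=\mu(B_d(x,s))$. Let $p_n(x,y)$ be the $n$-step transition probabilities of the random walk with one-step probabilities $\mu_{xy}/\mu_x$, and $h_n(x,y)=p_n(x,y)/\mu_y$. Let $R(A,B)=\bigl(\inf\{\frac12\sum_{(x,y)\in E}(f(x)-f(y))^2\mu_{xy}: f|_A=1,\ f|_B=0\}\bigr)^{-1}$ be the effective resistance, where $\inf\emptyset=\infty$. The upper and lower spectral dimensions $\overline d_S(G,\mu)$ and $\underline d_S(G,\mu)$ are the $\limsup$ and the $\liminf$ as $n\to\infty$ of $-2\log p_{2n}(x,x)/\log n$. \textbf{Theorem.}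 Assume that $\mu_{xy}\asymp1$ for $(x,y)\in E$, that $K$ is minimal and connected, that $\mathrm{diam}(G,d)=\infty$, that $d$ fits to $(G,E)$ and satisfies the basic framework with ratio $r$, and that $d(x,y)\asymp1$ for $(x,y)\in E$. Suppose further that for some $\beta>\alpha\ge1$: \begin{itemize} \item (DHK($\beta$)) $h_{2n}(x,x)\asymp 1/V(x,n^{1/\beta})$ for all $x\in G$, $n\ge1$; \item (ARL($\beta$)) there are $\lambda,C>0$ with $R(B_d(x,\lambda s),B_d(x,s)^c)\,V(x,s)\ge Cs^\beta$ for all $x\in G$, $s>r_x$; \item (BRU($\beta$)) there is $C>0$ with $R(\{x\},B_d(x,s)^c)\,V(x,s)\le Cs^\beta$ for all $x\in G$, $s>r_x$; \item (VG($\alpha$)) there is $C>0$ with $V(x,t)\le C(t^\alpha/s^\alpha)V(x,s)$ for all $x\in G$, $t>s>0$. \end{itemize} Then for every $N_1\ge0$, every sufficiently large $N_2$ (depending on $N_1$ but not on $N$) and every $N\ge1$, the quantities $\underline{\mathcal N}$, $\overline{\mathcal N}$, $\underline{\mathcal R}_2(N_1,N_2,N)$ are positive and finite, $\log\underline{\mathcal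 N}-\log\underline{\mathcal R}_2(N_1,N_2,N)>0$, and, for every base vertex $x$ in the definition of the spectral dimensions, \[\underline d_S(G,\mu)=2\,\frac{\log\underline{\mathcal N}}{\log\underline{\mathcal N}-\log\underline{\mathcal R}_2(N_1,N_2,N)},\qquad \overline d_S(G,\mu)=2\,\frac{\log\overline{\mathcal N}}{\log\underline{\mathcal N}-\log\underline{\mathcal R}_2(N_1,N_2,N)}.\] -/

import Mathlib

open Filter Topology
open scoped ENNReal

noncomputable section

namespace GraphPartition

/-! ### Bi-infinite trees -/

section Tree

variable {T : Type*}

/-- `(T, π)` is a bi-infinite tree, `π` being the parent map. -/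
structure IsBiInfiniteTree (π : T → T) : Prop where
  meet : ∀ w v : T, ∃ n m : ℕ, π^[n] w = π^[m] v
  no_cycle : ∀ n : ℕ, 1 ≤ n → ∀ w : T, π^[n] w ≠ w

/-- The height `[w]` of a vertex relative to the reference point `φ`: the integer `n - m`, where
`π^n(w) = π^m(φ)`. See `height_eq`. -/
def height (π : T → T) (φ w : T) : ℤ :=
  Classical.epsilon fun z : ℤ => ∃ n m : ℕ, π^[n] w = π^[m] φ ∧ z = (n : ℤ) - m

/-- The children `S(w)`. -/
def children (π : T → T) (w : T) : Set T := {v | π v = w}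

/-- The subtree `T_w` below `w`. -/
def subtree (π : T → T) (w : T) : Set T := {v | ∃ n : ℕ, π^[n] v = w}

/-- The descending geodesics `Σ^*`. -/
def geodesics (π : T → T) (φ : T) : Set (ℤ → T) :=
  {ω | (∀ n, height π φ (ω n) = n) ∧ ∀ n, π (ω (n + 1)) = ω n}

theorem height_unique {π : T → T} (hπ : IsBiInfiniteTree π) {w v : T} {n m n' m' : ℕ}
    (h : π^[n] w = π^[m] v) (h' : π^[n'] w = π^[m'] v) : (n : ℤ) - m = n' - m' := by
  wlog hle : n ≤ n' generalizing n m n' m'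
  · exact (this h' h (by omega)).symm
  obtain ⟨c, rfl⟩ := Nat.exists_eq_add_of_le' hle
  have h1 : π^[c + m] v = π^[m'] v := by
    rw [Function.iterate_add_apply, ← h, ← Function.iterate_add_apply, h']
  have h2 : c + m = m' := by
    by_contra hne
    rcases Nat.lt_or_gt_of_ne hne with hlt | hlt
    · obtain ⟨e, rfl⟩ := Nat.exists_eq_add_of_le' hlt.le
      exact hπ.no_cycle e (by omega) (π^[c + m] v)
        (by rw [← Function.iterate_add_apply]; exact h1.symm)
    · obtain ⟨e, he⟩ := Nat.exists_eq_add_of_le' hlt.le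
      exact hπ.no_cycle e (by omega) (π^[m'] v)
        (by rw [← Function.iterate_add_apply, ← he]; exact h1)
  push_cast
  omega

theorem height_eq {π : T → T} (hπ : IsBiInfiniteTree π) {φ w : T} {n m : ℕ}
    (h : π^[n] w = π^[m] φ) : height π φ w = (n : ℤ) - m := by
  obtain ⟨n', m', h', e⟩ := Classical.epsilon_spec
    (p := fun z : ℤ => ∃ n m : ℕ, π^[n] w = π^[m] φ ∧ z = (n : ℤ) - m) ⟨_, n, m, h, rfl⟩
  exact e.trans (height_unique hπ h' h)

end Tree

/-! ### Partitions of a graph -/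

section Partition

variable {V T : Type*}

/-- `K` is a partition of the graph `Γ` parametrized by the bi-infinite tree `(T, π, φ)`. -/
structure IsPartition (Γ : SimpleGraph V) (π : T → T) (φ : T) (K : T → Finset V) : Prop where
  union_children : ∀ w, ⋃ v ∈ children π w, (K v : Set V) = K w
  eventually_edge : ∀ ω ∈ geodesics π φ, ∃ (n₀ : ℤ) (x y : V), Γ.Adj x y ∧
    ∀ n, n₀ ≤ n → (K (ω n) : Set V) = {x, y}
  edge_mem : ∀ x y, Γ.Adj x y → ∃ w, (K w : Set V) = {x, y}

/-- `Λ_e`: the cells with two points whose parent cell has more than two points. -/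
def edgeCells (π : T → T) (K : T → Finset V) : Set T :=
  {w | (K w).card = 2 ∧ 2 < (K (π w)).card}

/-- `T_e`: the vertices of the tree having a (weak) descendant in `Λ_e`. -/
def edgeTree (π : T → T) (K : T → Finset V) : Set T :=
  {w | (subtree π w ∩ edgeCells π K).Nonempty}

/-- The partition `K` is minimal. -/
def IsMinimal (π : T → T) (K : T → Finset V) : Prop :=
  ∀ w ∈ edgeCells π K, ∀ v ∈ edgeCells π K, w ≠ v → K w ≠ K v

/-- The partition `K` is connected. -/
def IsConnectedPartition (Γ : SimpleGraph V) (π : T → T) (K : T → Finset V) : Prop :=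
  ∀ w ∈ edgeTree π K, (Γ.induce (K w : Set V)).Preconnected

theorem edgeCells_subset_edgeTree {π : T → T} {K : T → Finset V} {w : T}
    (hw : w ∈ edgeCells π K) : w ∈ edgeTree π K :=
  ⟨w, ⟨0, rfl⟩, hw⟩

theorem parent_mem_edgeTree {π : T → T} {K : T → Finset V} {w : T}
    (hw : w ∈ edgeTree π K) : π w ∈ edgeTree π K := by
  obtain ⟨v, ⟨n, hn⟩, hv⟩ := hw
  exact ⟨v, ⟨n + 1, by rw [Function.iterate_succ_apply', hn]⟩, hv⟩

theorem exists_endpoints {π : T → T} {K : T → Finset V} {w : T} (hw : w ∈ edgeCells π K) :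
    ∃ p : V × V, p.1 ≠ p.2 ∧ (K w : Set V) = {p.1, p.2} := by
  classical
  obtain ⟨x, y, hxy, h⟩ := Finset.card_eq_two.1 hw.1
  exact ⟨(x, y), hxy, by simp [h]⟩

/-- The two points of a cell in `Λ_e`, in an arbitrarily chosen order. -/
def endpoints {π : T → T} {K : T → Finset V} {w : T} (hw : w ∈ edgeCells π K) : V × V :=
  Classical.choose (exists_endpoints hw)

end Partition

/-! ### Metrics on the graph and discrete weight functions -/

section Metrics

variable {V T : Type*}

/-- The metric fits to the graph `Γ`. -/
structure IsFitting (Γ : SimpleGraph V) [MetricSpace V] : Prop where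
  comparable : ∃ C : ℝ, 0 < C ∧ ∀ x y z : V, Γ.Adj x y → x ≠ z → dist x y ≤ C * dist x z
  fine_exit : ∀ ε : ℝ, 0 < ε → ∃ (r : ℝ) (n : ℕ) (x : ℕ → V), 0 < r ∧ 1 ≤ n ∧
    (∀ i < n, x i ∈ Metric.ball (x 0) r) ∧ x n ∉ Metric.ball (x 0) r ∧
    ∀ i < n, dist (x (i + 1)) (x i) ≤ ε * r ∧ Γ.Adj (x (i + 1)) (x i)

/-- `d(w)`, the diameter of the cell `K_w`. -/
def cellDiam [MetricSpace V] (K : T → Finset V) (w : T) : ℝ := Metric.diam (K w : Set V)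

/-- The scale `Λ^g_s` of a function `g` on `T_e`. -/
def scale (π : T → T) (K : T → Finset V) (g : T → ℝ) (s : ℝ) : Set T :=
  {w | w ∈ edgeTree π K ∧ g w ≤ s ∧ s < g (π w)}

/-- The graph `E^g_s` on `Λ^g_s` (the other vertices of the tree are isolated). -/
def scaleGraph (π : T → T) (K : T → Finset V) (g : T → ℝ) (s : ℝ) : SimpleGraph T where
  Adj w v := w ≠ v ∧ w ∈ scale π K g s ∧ v ∈ scale π K g s ∧
    ((K w : Set V) ∩ K v).Nonempty
  symm := ⟨fun _ _ h => ⟨h.1.symm, h.2.2.1, h.2.1, by rw [Set.inter_comm]; exact h.2.2.2⟩⟩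
  loopless := ⟨fun _ h => h.1 rfl⟩

/-- `Λ^g_{s,M}(w)` for a vertex `w` of the tree. -/
def scaleNbhd (π : T → T) (K : T → Finset V) (g : T → ℝ) (s : ℝ) (M : ℕ) (w : T) : Set T :=
  {v | v ∈ scale π K g s ∧ (scaleGraph π K g s).edist w v ≤ M}

/-- `Λ^g_{s,M}(x)` for a point `x` of the graph. -/
def scaleNbhdPt (π : T → T) (K : T → Finset V) (g : T → ℝ) (s : ℝ) (M : ℕ) (x : V) : Set T :=
  ⋃ w ∈ {w | w ∈ scale π K g s ∧ x ∈ K w}, scaleNbhd π K g s M w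

open Classical in
/-- `U^g_M(x, s)`. -/
def cellNbhd (π : T → T) (K : T → Finset V) (g : T → ℝ) (M : ℕ) (x : V) (s : ℝ) : Set V :=
  if scaleNbhdPt π K g s M x = ∅ then {x} else ⋃ w ∈ scaleNbhdPt π K g s M x, (K w : Set V)

def IsUniformlyFinite (π : T → T) (K : T → Finset V) (g : T → ℝ) : Prop :=
  ∃ C : ℕ, ∀ s : ℝ, 0 < s → ∀ w ∈ scale π K g s, (scaleNbhd π K g s 1 w).encard ≤ C

def IsThick (π : T → T) (K : T → Finset V) (g : T → ℝ) : Prop :=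
  ∃ a : ℝ, 0 < a ∧ ∀ w ∈ edgeTree π K, ∃ x ∈ K w,
    scaleNbhdPt π K g (a * g (π w)) 1 x ⊆ subtree π w

def IsAdapted [MetricSpace V] (π : T → T) (K : T → Finset V) : Prop :=
  ∃ M : ℕ, 1 ≤ M ∧ ∃ a₁ a₂ : ℝ, 0 < a₁ ∧ 0 < a₂ ∧ ∀ (x : V) (s : ℝ), 0 < s →
    Metric.ball x (a₁ * s) ⊆ cellNbhd π K (cellDiam K) M x s ∧
    cellNbhd π K (cellDiam K) M x s ⊆ Metric.ball x (a₂ * s)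

/-- The metric satisfies the basic framework with respect to `K`, with scaling ratio `r`. -/
structure BasicFramework [MetricSpace V] (π : T → T) (φ : T) (K : T → Finset V) (r : ℝ) :
    Prop where
  ratio_pos : 0 < r
  ratio_lt_one : r < 1
  bounded_children : ∃ C : ℕ, ∀ w ∈ edgeTree π K \ edgeCells π K, (children π w).encard ≤ C
  uniformly_finite : IsUniformlyFinite π K (cellDiam K)
  thick : IsThick π K (cellDiam K)
  adapted : IsAdapted π K
  diam_asymp : ∃ C : ℝ, 0 < C ∧ ∀ w ∈ edgeTree π K,
    C⁻¹ * r ^ height π φ w ≤ cellDiam K w ∧ cellDiam K w ≤ C * r ^ height π φ w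

end Metrics

/-! ### The tree `T_r`, in which the edges of the graph are subdivided dyadically -/

section Refined

variable {V T : Type*}

/-- The natural number `n(m)` with `2^{-n(m)} ≤ r^m < 2^{1-n(m)}`. See `subdiv_spec`. -/
def subdiv (r : ℝ) (m : ℕ) : ℕ := ⌈(m : ℝ) * Real.logb 2 r⁻¹⌉₊

theorem subdiv_spec {r : ℝ} (h0 : 0 < r) (h1 : r < 1) (m : ℕ) :
    ((2 : ℝ) ^ subdiv r m)⁻¹ ≤ r ^ m ∧ r ^ m < 2 * ((2 : ℝ) ^ subdiv r m)⁻¹ := by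
  set t : ℝ := (m : ℝ) * Real.logb 2 r⁻¹ with ht
  have ht0 : 0 ≤ t :=
    mul_nonneg (Nat.cast_nonneg _) (Real.logb_nonneg one_lt_two ((one_le_inv₀ h0).2 h1.le))
  have hr : r ^ m = (2 : ℝ) ^ (-t) := by
    rw [ht, Real.rpow_neg two_pos.le, mul_comm, Real.rpow_mul two_pos.le,
      Real.rpow_logb two_pos (by norm_num) (inv_pos.2 h0), Real.rpow_natCast, inv_pow, inv_inv]
  have hn : ((2 : ℝ) ^ subdiv r m)⁻¹ = (2 : ℝ) ^ (-(subdiv r m : ℝ)) := by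
    rw [Real.rpow_neg two_pos.le, Real.rpow_natCast]
  have h2 : (2 : ℝ) * (2 : ℝ) ^ (-(subdiv r m : ℝ)) = (2 : ℝ) ^ (1 - (subdiv r m : ℝ)) := by
    rw [sub_eq_add_neg, Real.rpow_add two_pos, Real.rpow_one]
  rw [hr, hn, h2]
  constructor
  · exact Real.rpow_le_rpow_of_exponent_le one_le_two (neg_le_neg (Nat.le_ceil t))
  · refine Real.rpow_lt_rpow_of_exponent_lt one_lt_two ?_
    have := Nat.ceil_lt_add_one ht0
    have h3 : (subdiv r m : ℝ) < t + 1 := this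
    linarith

/-- The tree `T_r`. It consists of `T_e` and, for each `v ∈ Λ_e` and each depth `m + 1 ≥ 1`, of
`2^{n(m+1)}` vertices: `fine v _ m k` stands for the part `[k / 2^{n(m+1)}, (k+1) / 2^{n(m+1)}]` of
the edge `K_v`, which is identified with `[0, 1]` by means of `endpoints`. -/
inductive RefinedTree (π : T → T) (K : T → Finset V) (r : ℝ) : Type _
  | coarse (w : T) (hw : w ∈ edgeTree π K) : RefinedTree π K r
  | fine (v : T) (hv : v ∈ edgeCells π K) (m : ℕ) (k : Fin (2 ^ subdiv r (m + 1))) :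
      RefinedTree π K r

namespace RefinedTree

variable {π : T → T} {K : T → Finset V} {r : ℝ}

/-- The parent map `π'` of `T_r`; the part with index `k` at depth `m + 2` lies in the part with
index `⌊2^{n(m+1)} k / 2^{n(m+2)}⌋` at depth `m + 1`. See `parent_index`. -/
def parent : RefinedTree π K r → RefinedTree π K r
  | coarse w hw => coarse (π w) (parent_mem_edgeTree hw)
  | fine v hv 0 _ => coarse v (edgeCells_subset_edgeTree hv)
  | fine v hv (m + 1) k => fine v hv m
      ⟨k * 2 ^ subdiv r (m + 1) / 2 ^ subdiv r (m + 2), by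
        apply Nat.div_lt_of_lt_mul
        exact Nat.mul_lt_mul_of_pos_right k.2 (by positivity)⟩

/-- The height on `T_r`, extending the one on `T_e`. -/
def level (φ : T) : RefinedTree π K r → ℤ
  | coarse w _ => height π φ w
  | fine v _ m _ => height π φ v + (m + 1)

open Classical in
/-- The sets `K̲_w` for `w ∈ T_r`. -/
def cell : RefinedTree π K r → Set V
  | coarse w _ => K w
  | fine _ hv m k =>
      if (k : ℕ) = 0 then {(endpoints hv).1}
      else if (k : ℕ) + 1 = 2 ^ subdiv r (m + 1) then {(endpoints hv).2}
      else ∅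

/-- `a` and `b` are consecutive parts of the same subdivided edge. -/
def Consecutive (a b : RefinedTree π K r) : Prop :=
  ∃ (v : T) (hv : v ∈ edgeCells π K) (m : ℕ) (i j : Fin (2 ^ subdiv r (m + 1))),
    (i : ℕ) + 1 = j ∧ a = fine v hv m i ∧ b = fine v hv m j

/-- The horizontal graph: its restriction to the vertices of height `m` is `J^h_m`, and vertices of
different heights are not adjacent. -/
def horizontal (φ : T) : SimpleGraph (RefinedTree π K r) where
  Adj a b := a ≠ b ∧ level φ a = level φ b ∧
    ((cell a ∩ cell b).Nonempty ∨ Consecutive a b ∨ Consecutive b a)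
  symm := ⟨fun a b h => ⟨h.1.symm, h.2.1.symm,
    h.2.2.elim (fun h => Or.inl (by rw [Set.inter_comm]; exact h)) (fun h => Or.inr h.symm)⟩⟩
  loopless := ⟨fun _ h => h.1 rfl⟩

/-- `J^h_{N,m}`, a set of ordered pairs of vertices of height `m`. -/
def nearPairs (φ : T) (N : ℕ) (m : ℤ) : Set (RefinedTree π K r × RefinedTree π K r) :=
  {e | level φ e.1 = m ∧ level φ e.2 = m ∧
    0 < (horizontal φ).edist e.1 e.2 ∧ (horizontal φ).edist e.1 e.2 ≤ N}

/-- `Γ_n(w)`. -/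
def hball (φ : T) (n : ℕ) (w : RefinedTree π K r) : Set (RefinedTree π K r) :=
  {v | level φ v = level φ w ∧ (horizontal φ).edist w v ≤ n}

/-- `S^k(A)`. -/
def descendants (k : ℕ) (A : Set (RefinedTree π K r)) : Set (RefinedTree π K r) :=
  {v | parent^[k] v ∈ A}

/-- The functions admissible for `energy`. They are defined on the whole tree, but only their values
at the vertices of height `[w] + k` matter. -/
def IsAdmissible (φ : T) (k : ℕ) (w : RefinedTree π K r) (N₁ N₂ : ℕ)
    (f : RefinedTree π K r → ℝ) : Prop :=
  (∀ v ∈ descendants k (hball φ N₁ w), f v = 1) ∧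
    ∀ v, level φ v = level φ w + k → v ∉ descendants k (hball φ N₂ w) → f v = 0

/-- `ℰ_{p,k,w}(N₁, N₂, N)`. -/
def energy (φ : T) (p : ℝ) (k : ℕ) (w : RefinedTree π K r) (N₁ N₂ N : ℕ) : ℝ≥0∞ :=
  ⨅ (f : RefinedTree π K r → ℝ) (_ : IsAdmissible φ k w N₁ N₂ f),
    (1 / 2) * ∑' e : nearPairs (π := π) (K := K) (r := r) φ N (level φ w + k),
      ENNReal.ofReal (|f e.1.1 - f e.1.2| ^ p)

end RefinedTree

open RefinedTree

/-- The number `#(S^k(π^k(w)))`, computed in `T_r`. -/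
def cousins {π : T → T} {K : T → Finset V} {r : ℝ} (k : ℕ) (w : RefinedTree π K r) : ℝ≥0∞ :=
  ((descendants k {parent^[k] w}).encard : ℝ≥0∞)

/-- The upper growth rate `𝒩̄`. -/
def upperGrowth (π : T → T) (K : T → Finset V) (r : ℝ) : ℝ≥0∞ :=
  ⨆ w : RefinedTree π K r, limsup (fun k : ℕ => cousins k w ^ (1 / (k : ℝ))) atTop

/-- The lower growth rate `𝒩̲`. -/
def lowerGrowth (π : T → T) (K : T → Finset V) (r : ℝ) : ℝ≥0∞ :=
  ⨆ w : RefinedTree π K r, liminf (fun k : ℕ => cousins k w ^ (1 / (k : ℝ))) atTop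

/-- The rate `ℛ̲_p(N₁, N₂, N)`. -/
def lowerEnergyRate (π : T → T) (φ : T) (K : T → Finset V) (r p : ℝ) (N₁ N₂ N : ℕ) : ℝ≥0∞ :=
  ⨆ w : RefinedTree π K r,
    liminf (fun k : ℕ => energy φ p k (parent^[k] w) N₁ N₂ N ^ (1 / (k : ℝ))) atTop

theorem subdiv_mono {r : ℝ} (h0 : 0 < r) (h1 : r < 1) {m m' : ℕ} (h : m ≤ m') :
    subdiv r m ≤ subdiv r m' :=
  Nat.ceil_mono (mul_le_mul_of_nonneg_right (Nat.cast_le.2 h)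
    (Real.logb_nonneg one_lt_two ((one_le_inv₀ h0).2 h1.le)))

/-- With `a = n(m+1) ≤ b = n(m+2)`, the index `l = ⌊2^a k / 2^b⌋` used in `RefinedTree.parent`
satisfies `[k / 2^b, (k+1) / 2^b] ⊆ [l / 2^a, (l+1) / 2^a]`. -/
theorem parent_index {a b k : ℕ} (hab : a ≤ b) :
    k * 2 ^ a / 2 ^ b * 2 ^ b ≤ k * 2 ^ a ∧
      (k + 1) * 2 ^ a ≤ (k * 2 ^ a / 2 ^ b + 1) * 2 ^ b := by
  refine ⟨Nat.div_mul_le_self _ _, ?_⟩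
  obtain ⟨c, rfl⟩ := Nat.exists_eq_add_of_le hab
  have e : k * 2 ^ a / 2 ^ (a + c) = k / 2 ^ c := by
    rw [pow_add, mul_comm k, Nat.mul_div_mul_left _ _ (by positivity)]
  rw [e, pow_add, mul_comm (2 ^ a), ← mul_assoc]
  apply Nat.mul_le_mul_right
  exact Nat.succ_le_of_lt (Nat.lt_mul_of_div_lt (Nat.lt_succ_self _) (by positivity))

end Refined

/-! ### Weighted graphs -/

section Weighted

variable {V : Type*}

/-- `μ` is a conductance on `Γ`: a positive symmetric function on the edges, extended by zero. -/
structure IsConductance (Γ : SimpleGraph V) (μ : V → V → ℝ) : Prop where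
  symm : ∀ x y, μ x y = μ y x
  pos : ∀ x y, Γ.Adj x y → 0 < μ x y
  zero : ∀ x y, ¬ Γ.Adj x y → μ x y = 0

variable (Γ : SimpleGraph V) [Γ.LocallyFinite] (μ : V → V → ℝ)

/-- `μ_x`. -/
def vertexWeight (x : V) : ℝ := ∑ y ∈ Γ.neighborFinset x, μ x y

/-- The transition probabilities `p_n(x, y)` of the random walk with one-step transition
probabilities `p(x, y) = μ_{xy} / μ_x`. -/
def transition : ℕ → V → V → ℝ
  | 0, x, y => open Classical in if x = y then 1 else 0
  | n + 1, x, y => ∑ z ∈ Γ.neighborFinset y, transition n x z * (μ z y / vertexWeight Γ μ z)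

/-- The heat kernel `h_n(x, y)`. -/
def heatKernel (n : ℕ) (x y : V) : ℝ := transition Γ μ n x y / vertexWeight Γ μ y

/-- `V_d(x, s) = μ(B_d(x, s))`. -/
def vol [MetricSpace V] (x : V) (s : ℝ) : ℝ≥0∞ :=
  ∑' y : Metric.ball x s, ENNReal.ofReal (vertexWeight Γ μ y)

/-- The energy of a function on the vertices; non-edges do not contribute to the sum, as `μ`
vanishes there. -/
def dirichletEnergy (μ : V → V → ℝ) (f : V → ℝ) : ℝ≥0∞ :=
  (1 / 2) * ∑' e : V × V, ENNReal.ofReal ((f e.1 - f e.2) ^ 2 * μ e.1 e.2)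

/-- The effective resistance `R(A, B)`. -/
def resistance (μ : V → V → ℝ) (A B : Set V) : ℝ≥0∞ :=
  (⨅ (f : V → ℝ) (_ : (∀ x ∈ A, f x = 1) ∧ ∀ x ∈ B, f x = 0), dirichletEnergy μ f)⁻¹

/-- The upper spectral dimension of the random walk, computed at the vertex `x`. -/
def upperSpectralDim (x : V) : EReal :=
  2 * limsup (fun n : ℕ =>
    ((-Real.log (transition Γ μ (2 * n) x x) / Real.log n : ℝ) : EReal)) atTop

/-- The lower spectral dimension of the random walk, computed at the vertex `x`. -/
def lowerSpectralDim (x : V) : EReal :=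
  2 * liminf (fun n : ℕ =>
    ((-Real.log (transition Γ μ (2 * n) x x) / Real.log n : ℝ) : EReal)) atTop

variable [MetricSpace V]

/-- Condition DHK(β). -/
def DHK (β : ℝ) : Prop :=
  ∃ C : ℝ, 0 < C ∧ ∀ (x : V) (n : ℕ), 1 ≤ n →
    ENNReal.ofReal C⁻¹ / vol Γ μ x ((n : ℝ) ^ (1 / β)) ≤
        ENNReal.ofReal (heatKernel Γ μ (2 * n) x x) ∧
      ENNReal.ofReal (heatKernel Γ μ (2 * n) x x) ≤
        ENNReal.ofReal C / vol Γ μ x ((n : ℝ) ^ (1 / β))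

/-- Condition ARL(β); the infimal distance `r_x` from `x` to the other points is
`Metric.infDist x {x}ᶜ`. -/
def ARL (β : ℝ) : Prop :=
  ∃ l C : ℝ, 0 < l ∧ 0 < C ∧ ∀ (x : V) (s : ℝ), Metric.infDist x {x}ᶜ < s →
    ENNReal.ofReal (C * s ^ β) ≤
      resistance μ (Metric.ball x (l * s)) (Metric.ball x s)ᶜ * vol Γ μ x s

/-- Condition BRU(β). -/
def BRU (β : ℝ) : Prop :=
  ∃ C : ℝ, 0 < C ∧ ∀ (x : V) (s : ℝ), Metric.infDist x {x}ᶜ < s →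
    resistance μ {x} (Metric.ball x s)ᶜ * vol Γ μ x s ≤ ENNReal.ofReal (C * s ^ β)

/-- Condition VG(α). -/
def VG (α : ℝ) : Prop :=
  ∃ C : ℝ, 0 < C ∧ ∀ (x : V) (s t : ℝ), 0 < s → s < t →
    vol Γ μ x t ≤ ENNReal.ofReal (C * (t ^ α / s ^ α)) * vol Γ μ x s

end Weighted

end GraphPartition

end

open GraphPartition

noncomputable section

namespace GraphPartition

/-! ### Counting and summation -/

section Counting

variable {A B : Type*}

/-! Put `ρ = r⁻¹`. Every quantity in the theorem is compared with the volumes `V(x₀, ρ^k)`, up to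
constants that may depend on the vertex `w` of the tree but not on `k`. Such constants disappear
under `k`-th roots, so the suprema over `w` are harmless: the upper bounds agree for all `w`, and
one vertex of low height attains them.

The comparison is possible because `π^k(w)` climbs `k` levels and `S^k` descends again: the sets and
energies always live on the fixed level `h = [w]`. On a fixed level, a carrier cell has boundedly
many points (`exists_card_carrier_le`) and a point lies in boundedly many carriers
(`exists_encard_carrier_fiber_le`). Functions on `G` therefore transfer to the level with controlled
energy. Conversely, functions on the level transfer to `G` if `h ≤ h₀`, where `h₀` bounds the
heights of all edge cells from below; up to height `h₀` the refined tree consists of cells of `T_e`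
only.

Counting: `#S^k(π^k(w))` is comparable to the number of points of the cell of `π^k(w)`. This cell
has diameter of order `ρ^k` and contains a ball of that order, so the count is comparable to the
volume (`exists_cousins_le`, `exists_vol_le_cousins`).

Energy: transferring test functions from `G` to the level turns the lower resistance bound ARL into
an upper bound on the energy (`exists_energy_mul_le`). Transferring from the level to `G` turns the
upper bound BRU into a lower one (`exists_vol_le_energy_mul`). Together the energy is of order
`V(x₀, ρ^k) / ρ^(kβ)`.

Let `l` and `L` be the lower and upper limits of `log V(x₀, ρ^k) / k`, and `c = β log ρ`. The two
growth rates are then `exp l` and `exp L`, the energy rate is `exp (l - c)`, and the denominator in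
the theorem equals `c`. Finally DHK gives `-log p_{2n}(x, x) = log V(x₀, n^(1/β)) + O(1)`. Sampling
at `k = ⌊log n / c⌋`, where `ρ^k` and `n^(1/β)` differ by at most a factor `ρ`, yields the limits `l
/ c` and `L / c` (`liminf_limsup_eq_growth`). -/

theorem encard_biUnion_le {s : Set A} {t : A → Set B} {C : ℕ} (h : ∀ a ∈ s, (t a).encard ≤ C) :
    (⋃ a ∈ s, t a).encard ≤ C * s.encard := by
  by_cases hs : s.Finite
  · induction s, hs using Set.Finite.induction_on with
    | empty => simp
    | @insert a s ha hs ih =>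
      rw [Set.biUnion_insert, Set.encard_insert_of_notMem ha, mul_add, mul_one, add_comm]
      exact (Set.encard_union_le _ _).trans
        (add_le_add (h a (Set.mem_insert _ _)) (ih fun b hb => h b (Set.mem_insert_of_mem _ hb)))
  · rw [Set.encard_eq_top_iff.2 hs]
    -- For `C = 0` the right side is `0 * ⊤ = 0`, so the union has to be empty.
    rcases Nat.eq_zero_or_pos C with rfl | hC
    · have : (⋃ a ∈ s, t a) = ∅ := by
        simp only [Set.iUnion_eq_empty]
        intro a ha
        simpa using h a ha
      simp [this]
    · rw [ENat.mul_top (by exact_mod_cast hC.ne')]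
      exact le_top

theorem tsum_comp_le_mul_tsum {φ : A → B} {C : ℕ} (hφ : ∀ b, (φ ⁻¹' {b}).encard ≤ C)
    (g : B → ℝ≥0∞) : ∑' a, g (φ a) ≤ C * ∑' b, g b := by
  rw [← ENNReal.tsum_fiberwise (fun a => g (φ a)) φ, ← ENNReal.tsum_mul_left]
  refine ENNReal.tsum_le_tsum fun b => ?_
  have : ∀ a : φ ⁻¹' {b}, g (φ a) = g b := fun a => by rw [show φ a = b from a.2]
  rw [tsum_congr this, ENNReal.tsum_set_const]
  gcongr
  have := hφ b
  calc (((φ ⁻¹' {b}).encard : ℕ∞) : ℝ≥0∞) ≤ ((C : ℕ∞) : ℝ≥0∞) := by exact_mod_cast this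
    _ = C := by simp

/-- The sum of the squared differences of `f` over a set of pairs. -/
def pairEnergy (P : Set (A × A)) (f : A → ℝ) : ℝ≥0∞ :=
  ∑' e : P, ENNReal.ofReal ((f e.1.1 - f e.1.2) ^ 2)

/-- Diagonal pairs contribute nothing, so the inclusion is needed off the diagonal only. -/
theorem pairEnergy_mono {P Q : Set (A × A)} (h : ∀ e ∈ P, e.1 ≠ e.2 → e ∈ Q) (f : A → ℝ) :
    pairEnergy P f ≤ pairEnergy Q f := by
  unfold pairEnergy
  rw [tsum_subtype P (fun e : A × A => ENNReal.ofReal ((f e.1 - f e.2) ^ 2)),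
    tsum_subtype Q (fun e : A × A => ENNReal.ofReal ((f e.1 - f e.2) ^ 2))]
  refine ENNReal.tsum_le_tsum fun e => ?_
  by_cases he : e ∈ P
  · by_cases hne : e.1 = e.2
    · simp [Set.indicator, hne]
    · rw [Set.indicator_of_mem he, Set.indicator_of_mem (h e he hne)]
  · rw [Set.indicator_of_notMem he]
    exact zero_le

/-- Both entries of a pair in `P` lie in `L`, so at most `C * C` pairs of `P` have the same image in
`Q`. This is the tool for transferring functions between the graph and a level of the tree. -/
theorem pairEnergy_comp_le {P : Set (A × A)} {Q : Set (B × B)} {L : Set A} {ψ : A → B} {C : ℕ}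
    (hPL : ∀ e ∈ P, e.1 ∈ L ∧ e.2 ∈ L) (hPQ : ∀ e ∈ P, (ψ e.1, ψ e.2) ∈ Q)
    (hfib : ∀ b, {a | a ∈ L ∧ ψ a = b}.encard ≤ C) (f : B → ℝ) :
    pairEnergy P (fun a => f (ψ a)) ≤ (C * C : ℕ) * pairEnergy Q f := by
  refine tsum_comp_le_mul_tsum (φ := fun e : P => (⟨(ψ e.1.1, ψ e.1.2), hPQ _ e.2⟩ : Q)) ?_
    (fun e : Q => ENNReal.ofReal ((f e.1.1 - f e.1.2) ^ 2))
  rintro ⟨⟨b, b'⟩, hb⟩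
  calc _ = (Subtype.val '' ((fun e : P => (⟨(ψ e.1.1, ψ e.1.2), hPQ _ e.2⟩ : Q)) ⁻¹'
        {⟨(b, b'), hb⟩})).encard := (Subtype.val_injective.encard_image _).symm
    _ ≤ ({a | a ∈ L ∧ ψ a = b} ×ˢ {a | a ∈ L ∧ ψ a = b'}).encard := by
        refine Set.encard_le_encard ?_
        rintro _ ⟨⟨e, he⟩, h, rfl⟩
        simp only [Set.mem_preimage, Set.mem_singleton_iff, Subtype.mk.injEq, Prod.mk.injEq] at h
        exact ⟨⟨(hPL e he).1, h.1⟩, ⟨(hPL e he).2, h.2⟩⟩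
    _ ≤ _ := by
        rw [Set.encard_prod]
        push_cast
        exact mul_le_mul' (hfib b) (hfib b')

theorem ofReal_sq_sub_le (a b c : ℝ) : ENNReal.ofReal ((a - c) ^ 2) ≤
    2 * (ENNReal.ofReal ((a - b) ^ 2) + ENNReal.ofReal ((b - c) ^ 2)) := by
  rw [← ENNReal.ofReal_add (sq_nonneg _) (sq_nonneg _), ← ENNReal.ofReal_ofNat,
    ← ENNReal.ofReal_mul zero_le_two]
  refine ENNReal.ofReal_le_ofReal ?_
  nlinarith [sq_nonneg ((a - b) - (b - c))]

/-- Insert an intermediate point and use `(a - c)² ≤ 2((a - b)² + (b - c)²)`. The degree bounds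
limit how often a pair of `P` or of `Q` gets used. -/
theorem pairEnergy_trans_le {P Q R : Set (A × A)} {C : ℕ}
    (hR : ∀ e ∈ R, ∃ y, (e.1, y) ∈ P ∧ (y, e.2) ∈ Q)
    (hP : ∀ y, {x | (x, y) ∈ P}.encard ≤ C) (hQ : ∀ y, {z | (y, z) ∈ Q}.encard ≤ C)
    (f : A → ℝ) :
    pairEnergy R f ≤ (2 * C : ℕ) * (pairEnergy P f + pairEnergy Q f) := by
  choose y hyP hyQ using fun e : R => hR e.1 e.2
  have h1 : ∑' e : R, ENNReal.ofReal ((f e.1.1 - f (y e)) ^ 2) ≤ C * pairEnergy P f := by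
    refine tsum_comp_le_mul_tsum (φ := fun e : R => (⟨(e.1.1, y e), hyP e⟩ : P)) ?_
      (fun e : P => ENNReal.ofReal ((f e.1.1 - f e.1.2) ^ 2))
    rintro ⟨⟨b, b'⟩, hb⟩
    refine le_trans ?_ (hQ b')
    refine Set.encard_le_encard_of_injOn (f := fun e : R => e.1.2) ?_ ?_
    · intro e he
      simp only [Set.mem_preimage, Set.mem_singleton_iff, Subtype.mk.injEq, Prod.mk.injEq] at he
      have := hyQ e
      rw [he.2] at this
      exact this
    · intro e he e' he' h
      simp only [Set.mem_preimage, Set.mem_singleton_iff, Subtype.mk.injEq, Prod.mk.injEq] at he he'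
      exact Subtype.ext (Prod.ext (he.1.trans he'.1.symm) h)
  have h2 : ∑' e : R, ENNReal.ofReal ((f (y e) - f e.1.2) ^ 2) ≤ C * pairEnergy Q f := by
    refine tsum_comp_le_mul_tsum (φ := fun e : R => (⟨(y e, e.1.2), hyQ e⟩ : Q)) ?_
      (fun e : Q => ENNReal.ofReal ((f e.1.1 - f e.1.2) ^ 2))
    rintro ⟨⟨b, b'⟩, hb⟩
    refine le_trans ?_ (hP b)
    refine Set.encard_le_encard_of_injOn (f := fun e : R => e.1.1) ?_ ?_
    · intro e he
      simp only [Set.mem_preimage, Set.mem_singleton_iff, Subtype.mk.injEq, Prod.mk.injEq] at he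
      have := hyP e
      rw [he.1] at this
      exact this
    · intro e he e' he' h
      simp only [Set.mem_preimage, Set.mem_singleton_iff, Subtype.mk.injEq, Prod.mk.injEq] at he he'
      exact Subtype.ext (Prod.ext h (he.2.trans he'.2.symm))
  calc pairEnergy R f ≤ ∑' e : R, 2 * (ENNReal.ofReal ((f e.1.1 - f (y e)) ^ 2) +
        ENNReal.ofReal ((f (y e) - f e.1.2) ^ 2)) :=
        ENNReal.tsum_le_tsum fun e => ofReal_sq_sub_le _ _ _
    _ ≤ 2 * (C * pairEnergy P f + C * pairEnergy Q f) := by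
        rw [ENNReal.tsum_mul_left, ENNReal.tsum_add]
        gcongr
    _ = _ := by push_cast; ring

end Counting

/-! ### Balls in graphs -/

section GraphBalls

variable {A : Type*} {G : SimpleGraph A}

theorem exists_edist_le_of_edist_le_succ {a b : A} {n : ℕ} (h : G.edist a b ≤ (n + 1 : ℕ)) :
    ∃ c, G.edist a c ≤ n ∧ G.edist c b ≤ 1 := by
  obtain ⟨p, hp⟩ := SimpleGraph.exists_walk_of_edist_ne_top
    (ne_top_of_le_ne_top (ENat.natCast_ne_top _) h)
  rw [← hp] at h
  have hlen : p.length ≤ n + 1 := by exact_mod_cast h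
  clear h hp
  revert hlen
  induction n generalizing a with
  | zero =>
    intro hlen
    exact ⟨a, by simp, (SimpleGraph.edist_le p).trans (by exact_mod_cast hlen)⟩
  | succ n ih =>
    intro hlen
    cases p with
    | nil => exact ⟨b, by simp, by simp⟩
    | @cons _ c _ hac q =>
      obtain ⟨d, hd, hdb⟩ := ih q (by simpa using hlen)
      refine ⟨d, ?_, hdb⟩
      calc G.edist a d ≤ G.edist a c + G.edist c d := SimpleGraph.edist_triangle
        _ ≤ 1 + n := add_le_add (SimpleGraph.edist_le_one_iff_adj_or_eq.2 (Or.inl hac)) hd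
        _ = _ := by push_cast; ring

/-- The pairs at graph distance at most `n`, the first point lying in `L`. -/
def stepPairs (G : SimpleGraph A) (L : Set A) (n : ℕ) : Set (A × A) :=
  {e | e.1 ∈ L ∧ G.edist e.1 e.2 ≤ n}

theorem encard_edist_le {L : Set A} (hL : ∀ a b, G.Adj a b → a ∈ L → b ∈ L) {D : ℕ}
    (hD : ∀ a ∈ L, (G.neighborSet a).encard ≤ D) (n : ℕ) {a : A} (ha : a ∈ L) :
    {b | G.edist a b ≤ n}.encard ≤ ((D + 1) ^ n : ℕ) ∧ {b | G.edist a b ≤ n} ⊆ L := by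
  induction n with
  | zero => simp [SimpleGraph.edist_eq_zero_iff, ha]
  | succ n ih =>
    have key : {b | G.edist a b ≤ (n + 1 : ℕ)} ⊆
        ⋃ c ∈ {c | G.edist a c ≤ n}, {b | G.edist c b ≤ 1} := by
      intro b hb
      obtain ⟨c, hc, hcb⟩ := exists_edist_le_of_edist_le_succ hb
      exact Set.mem_biUnion hc hcb
    constructor
    · refine (Set.encard_le_encard key).trans ?_
      refine (encard_biUnion_le (C := D + 1) ?_).trans ?_
      · intro c hc
        have : {b | G.edist c b ≤ 1} = insert c (G.neighborSet c) := by
          ext b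
          simp [SimpleGraph.edist_le_one_iff_adj_or_eq, or_comm, eq_comm]
        rw [this]
        refine (Set.encard_insert_le _ _).trans ?_
        push_cast
        gcongr
        exact hD c (ih.2 hc)
      · calc ((D + 1 : ℕ) : ℕ∞) * _ ≤ (D + 1 : ℕ) * ((D + 1) ^ n : ℕ) := by gcongr; exact ih.1
          _ = _ := by push_cast; ring
    · intro b hb
      obtain ⟨c, hc, hcb⟩ := exists_edist_le_of_edist_le_succ hb
      rcases SimpleGraph.edist_le_one_iff_adj_or_eq.1 hcb with h | rfl
      · exact hL _ _ h (ih.2 hc)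
      · exact ih.2 hc

/-- With bounded degrees, differences over distance `n` are controlled by differences along edges:
split off the last step of a path and induct. The set `L` is closed under adjacency, so degrees need
to be bounded only there. -/
theorem pairEnergy_stepPairs_le {L : Set A} (hL : ∀ a b, G.Adj a b → a ∈ L → b ∈ L) {D : ℕ}
    (hD : ∀ a ∈ L, (G.neighborSet a).encard ≤ D) (n : ℕ) :
    ∃ C : ℕ, 0 < C ∧ ∀ f : A → ℝ,
      pairEnergy (stepPairs G L n) f ≤ C * pairEnergy {e | e.1 ∈ L ∧ G.Adj e.1 e.2} f := by
  induction n with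
  | zero =>
    refine ⟨1, one_pos, fun f => ?_⟩
    rw [Nat.cast_one, one_mul]
    refine pairEnergy_mono ?_ f
    intro e he hne
    exact absurd (SimpleGraph.edist_eq_zero_iff.1 (le_antisymm he.2 zero_le)) hne
  | succ n ih =>
    obtain ⟨C, hC, ih⟩ := ih
    set M := (D + 1) ^ n + (D + 1) with hM
    refine ⟨2 * M * (C + 1), by positivity, fun f => ?_⟩
    have h1 : pairEnergy (stepPairs G L 1) f ≤ pairEnergy {e | e.1 ∈ L ∧ G.Adj e.1 e.2} f := by
      refine pairEnergy_mono ?_ f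
      intro e he hne
      have := SimpleGraph.edist_le_one_iff_adj_or_eq.1 (by exact_mod_cast he.2)
      exact ⟨he.1, this.resolve_right hne⟩
    have hpre : ∀ c a, a ∈ L → G.edist a c ≤ n → c ∈ L :=
      fun c a ha h => (encard_edist_le hL hD n ha).2 h
    have h2 : pairEnergy (stepPairs G L (n + 1)) f ≤
        (2 * M : ℕ) * (pairEnergy (stepPairs G L n) f + pairEnergy (stepPairs G L 1) f) := by
      refine pairEnergy_trans_le ?_ ?_ ?_ f
      · intro e he
        obtain ⟨c, hc, hcb⟩ := exists_edist_le_of_edist_le_succ he.2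
        exact ⟨c, ⟨he.1, hc⟩, hpre _ _ he.1 hc, by exact_mod_cast hcb⟩
      · intro y
        by_cases hy : y ∈ L
        · refine (Set.encard_le_encard ?_).trans
            ((encard_edist_le hL hD n hy).1.trans (Nat.cast_le.2 (Nat.le_add_right _ _)))
          intro x hx
          rw [Set.mem_ofPred_eq, SimpleGraph.edist_comm]
          exact hx.2
        · have : {x | (x, y) ∈ stepPairs G L n} = ∅ := by
            ext x
            simp only [Set.mem_ofPred_eq, Set.mem_empty_iff_false, iff_false]
            exact fun hx => hy (hpre _ _ hx.1 hx.2)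
          simp [this]
      · intro y
        by_cases hy : y ∈ L
        · refine (Set.encard_le_encard ?_).trans
            ((encard_edist_le hL hD 1 hy).1.trans (Nat.cast_le.2 ?_))
          · intro x hx
            exact hx.2
          · rw [pow_one]; exact Nat.le_add_left _ _
        · have : {z | (y, z) ∈ stepPairs G L 1} = ∅ := by
            ext x
            simp only [Set.mem_ofPred_eq, Set.mem_empty_iff_false, iff_false]
            exact fun hx => hy hx.1
          simp [this]
    calc _ ≤ _ := h2
      _ ≤ (2 * M : ℕ) * (C * pairEnergy {e | e.1 ∈ L ∧ G.Adj e.1 e.2} f +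
          pairEnergy {e | e.1 ∈ L ∧ G.Adj e.1 e.2} f) := by
          gcongr
          exact ih f
      _ = _ := by push_cast; ring

/-- If all vertices of a walk lie in a set with at most `n` elements, then its ends are at distance
less than `n`. -/
theorem edist_le_of_walk {F : Set A} {n : ℕ} (hF : F.encard ≤ n) {a b : A} (p : G.Walk a b)
    (hp : ∀ c ∈ p.support, c ∈ F) : G.edist a b ≤ n := by
  classical
  have hfin : F.Finite := Set.finite_of_encard_le_coe hF
  have h1 : p.bypass.support.toFinset ⊆ hfin.toFinset := by
    intro c hc
    rw [hfin.mem_toFinset]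
    exact hp c (p.support_bypass_subset_support (List.mem_toFinset.1 hc))
  have h2 := Finset.card_le_card h1
  rw [List.toFinset_card_of_nodup p.bypass_isPath.support_nodup,
    SimpleGraph.Walk.length_support] at h2
  rw [hfin.encard_eq_coe_toFinset_card] at hF
  have hF' : hfin.toFinset.card ≤ n := by exact_mod_cast hF
  refine (SimpleGraph.edist_le p.bypass).trans ?_
  exact_mod_cast (Nat.le_succ _).trans (h2.trans hF')

end GraphBalls

/-! ### Heights -/

section Heights

variable {T : Type*} {π : T → T} {φ : T}

theorem exists_height_eq (hπ : IsBiInfiniteTree π) (φ w : T) :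
    ∃ n m : ℕ, π^[n] w = π^[m] φ ∧ height π φ w = (n : ℤ) - m := by
  obtain ⟨n, m, h⟩ := hπ.meet w φ
  exact ⟨n, m, h, height_eq hπ h⟩

theorem height_parent (hπ : IsBiInfiniteTree π) (φ w : T) :
    height π φ (π w) = height π φ w - 1 := by
  obtain ⟨n, m, h, e⟩ := exists_height_eq hπ φ w
  have h' : π^[n] (π w) = π^[m + 1] φ := by
    rw [← Function.iterate_succ_apply, Function.iterate_succ_apply', h,
      Function.iterate_succ_apply']
  rw [e, height_eq hπ h']
  push_cast
  ring

theorem height_iterate (hπ : IsBiInfiniteTree π) (φ w : T) (n : ℕ) :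
    height π φ (π^[n] w) = height π φ w - n := by
  induction n with
  | zero => simp
  | succ n ih =>
    rw [Function.iterate_succ_apply', height_parent hπ, ih]
    push_cast
    ring

theorem iterate_mem_edgeTree {V : Type*} {K : T → Finset V} {w : T} (hw : w ∈ edgeTree π K)
    (n : ℕ) : π^[n] w ∈ edgeTree π K := by
  induction n with
  | zero => exact hw
  | succ n ih => rw [Function.iterate_succ_apply']; exact parent_mem_edgeTree ih

end Heights

section RefinedHeights

open RefinedTree

variable {V T : Type*} {π : T → T} {φ : T} {K : T → Finset V} {r : ℝ}

theorem level_parent (hπ : IsBiInfiniteTree π) (u : RefinedTree π K r) :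
    level φ (parent u) = level φ u - 1 := by
  match u with
  | coarse w hw => exact height_parent hπ φ w
  | fine v hv 0 k => simp [parent, level]
  | fine v hv (m + 1) k => simp [parent, level]; ring

theorem level_iterate (hπ : IsBiInfiniteTree π) (u : RefinedTree π K r) (n : ℕ) :
    level φ (parent^[n] u) = level φ u - n := by
  induction n with
  | zero => simp
  | succ n ih =>
    rw [Function.iterate_succ_apply', level_parent hπ, ih]
    push_cast
    ring

theorem parent_iterate_coarse (w : T) (hw : w ∈ edgeTree π K) (n : ℕ) :
    parent^[n] (coarse w hw : RefinedTree π K r) = coarse (π^[n] w) (iterate_mem_edgeTree hw n) := by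
  induction n with
  | zero => rfl
  | succ n ih =>
    rw [Function.iterate_succ_apply', ih]
    simp only [parent, Function.iterate_succ_apply']

end RefinedHeights

end GraphPartition

end

noncomputable section

namespace GraphPartition

/-! ### Edge cells -/

section EdgeCells

variable {V T : Type*} {Γ : SimpleGraph V} {π : T → T} {φ : T} {K : T → Finset V}

theorem IsPartition.cell_subset_parent (hK : IsPartition Γ π φ K) (w : T) : K w ⊆ K (π w) := by
  intro x hx
  have h := hK.union_children (π w)
  have : x ∈ (⋃ v ∈ children π (π w), (K v : Set V)) := Set.mem_biUnion (x := w) rfl hx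
  rw [h] at this
  exact this

theorem IsPartition.cell_subset_iterate (hK : IsPartition Γ π φ K) (w : T) (n : ℕ) :
    K w ⊆ K (π^[n] w) := by
  induction n with
  | zero => exact subset_rfl
  | succ n ih =>
    rw [Function.iterate_succ_apply']
    exact ih.trans (hK.cell_subset_parent _)

theorem IsPartition.two_lt_card_iterate (hK : IsPartition Γ π φ K) {v : T}
    (hv : v ∈ edgeCells π K) (n : ℕ) : 2 < (K (π^[n + 1] v)).card := by
  rw [Function.iterate_succ_apply]
  exact hv.2.trans_le (Finset.card_le_card (hK.cell_subset_iterate _ n))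

theorem IsPartition.two_lt_card_parent (hK : IsPartition Γ π φ K) {w : T}
    (hw : w ∈ edgeTree π K) : 2 < (K (π w)).card := by
  obtain ⟨v, ⟨n, rfl⟩, hv⟩ := hw
  rw [← Function.iterate_succ_apply' π]
  exact hK.two_lt_card_iterate hv n

theorem IsPartition.two_lt_card (hK : IsPartition Γ π φ K) {w : T}
    (hw : w ∈ edgeTree π K) (hw' : w ∉ edgeCells π K) : 2 < (K w).card := by
  obtain ⟨v, ⟨n, rfl⟩, hv⟩ := hw
  cases n with
  | zero => exact absurd hv hw'
  | succ n => exact hK.two_lt_card_iterate hv n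

theorem IsPartition.parent_mem_diff (hK : IsPartition Γ π φ K) {w : T}
    (hw : w ∈ edgeTree π K) : π w ∈ edgeTree π K \ edgeCells π K :=
  ⟨parent_mem_edgeTree hw, fun h => absurd h.1 (hK.two_lt_card_parent hw).ne'⟩

theorem IsPartition.two_le_card (hK : IsPartition Γ π φ K) {w : T}
    (hw : w ∈ edgeTree π K) : 2 ≤ (K w).card := by
  by_cases h : w ∈ edgeCells π K
  · exact h.1.ge
  · exact (hK.two_lt_card hw h).le

theorem IsPartition.cell_nonempty (hK : IsPartition Γ π φ K) {w : T}
    (hw : w ∈ edgeTree π K) : (K w).Nonempty :=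
  Finset.card_pos.1 (two_pos.trans_le (hK.two_le_card hw))

/-- A vertex with at most two points which has an ancestor with more than two points is below an
edge cell. -/
theorem exists_iterate_card {w : T} (h2 : (K w).card ≤ 2) {n : ℕ}
    (hn : 2 < (K (π^[n] w)).card) :
    ∃ m, (K (π^[m] w)).card ≤ 2 ∧ 2 < (K (π^[m + 1] w)).card := by
  by_contra! h
  have : ∀ m, (K (π^[m] w)).card ≤ 2 := by
    intro m
    induction m with
    | zero => exact h2
    | succ m ih => exact h m ih
  exact absurd (this n) hn.not_ge

theorem exists_adj [Infinite V] (hconn : Γ.Connected) (x : V) : ∃ y, Γ.Adj x y := by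
  obtain ⟨z, hz⟩ := exists_ne x
  obtain ⟨p⟩ := hconn.preconnected x z
  cases p with
  | nil => exact absurd rfl hz
  | cons h _ => exact ⟨_, h⟩

theorem IsPartition.exists_edgeCell [Infinite V] (hK : IsPartition Γ π φ K)
    (hπ : IsBiInfiniteTree π) (hconn : Γ.Connected) {x y : V} (hxy : Γ.Adj x y) :
    ∃ v ∈ edgeCells π K, (K v : Set V) = {x, y} := by
  classical
  obtain ⟨w, hw⟩ := hK.edge_mem x y hxy
  obtain ⟨z, hz⟩ := Infinite.exists_notMem_finset ({x, y} : Finset V)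
  obtain ⟨t, ht⟩ := exists_adj hconn z
  obtain ⟨w', hw'⟩ := hK.edge_mem z t ht
  obtain ⟨n, m, hnm⟩ := hπ.meet w w'
  have hw2 : K w = {x, y} := by
    rw [← Finset.coe_inj, hw]; simp
  have hcard : (K w).card = 2 := by rw [hw2, Finset.card_pair hxy.ne]
  -- A common ancestor with a cell containing a third point `z` has more than two points. Hence
  -- somewhere between `w` and it the cardinality jumps above two.
  have hsub : insert z (K w) ⊆ K (π^[n] w) := by
    refine Finset.insert_subset ?_ (hK.cell_subset_iterate _ _)
    rw [hnm]
    apply hK.cell_subset_iterate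
    rw [← Finset.mem_coe, hw']
    simp
  have hlt : 2 < (K (π^[n] w)).card := by
    have := Finset.card_le_card hsub
    rw [Finset.card_insert_of_notMem (by rw [hw2]; exact hz), hcard] at this
    exact this
  obtain ⟨j, hj1, hj2⟩ := exists_iterate_card hcard.le hlt
  have heq : K w = K (π^[j] w) :=
    Finset.eq_of_subset_of_card_le (hK.cell_subset_iterate _ _) (by rw [hcard]; exact hj1)
  refine ⟨π^[j] w, ⟨by rw [← heq, hcard], ?_⟩, by rw [← heq, hw]⟩
  rw [← Function.iterate_succ_apply' π]
  exact hj2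

theorem endpoints_spec {v : T} (hv : v ∈ edgeCells π K) :
    (endpoints hv).1 ≠ (endpoints hv).2 ∧
      (K v : Set V) = {(endpoints hv).1, (endpoints hv).2} :=
  Classical.choose_spec (exists_endpoints hv)

/-- Two points of a cell are joined by a walk inside the cell. -/
theorem IsConnectedPartition.exists_walk (hKc : IsConnectedPartition Γ π K) {w : T}
    (hw : w ∈ edgeTree π K) {x y : V} (hx : x ∈ K w) (hy : y ∈ K w) :
    ∃ p : Γ.Walk x y, ∀ z ∈ p.support, z ∈ K w := by
  obtain ⟨p⟩ := hKc w hw ⟨x, hx⟩ ⟨y, hy⟩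
  refine ⟨p.map (SimpleGraph.Embedding.induce (K w : Set V)).toHom, fun z hz => ?_⟩
  replace hz : z ∈ (p.map (SimpleGraph.Embedding.induce (K w : Set V)).toHom).support := hz
  rw [SimpleGraph.Walk.support_map, List.mem_map] at hz
  obtain ⟨⟨z', hz'⟩, -, rfl⟩ := hz
  exact hz'

theorem IsConnectedPartition.edist_le_card (hKc : IsConnectedPartition Γ π K) {w : T}
    (hw : w ∈ edgeTree π K) {x y : V} (hx : x ∈ K w) (hy : y ∈ K w) :
    Γ.edist x y ≤ (K w).card := by
  obtain ⟨p, hp⟩ := hKc.exists_walk hw hx hy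
  exact edist_le_of_walk (F := (K w : Set V)) (by rw [Set.encard_coe_eq_coe_finsetCard]) p hp

/-- The first step of a walk inside a two-point cell must go to the other point. -/
theorem IsConnectedPartition.adj_endpoints (hKc : IsConnectedPartition Γ π K) {v : T}
    (hv : v ∈ edgeCells π K) : Γ.Adj (endpoints hv).1 (endpoints hv).2 := by
  obtain ⟨hne, he⟩ := endpoints_spec hv
  have h1 : (endpoints hv).1 ∈ K v := by rw [← Finset.mem_coe, he]; simp
  have h2 : (endpoints hv).2 ∈ K v := by rw [← Finset.mem_coe, he]; simp
  obtain ⟨p, hp⟩ := hKc.exists_walk (edgeCells_subset_edgeTree hv) h1 h2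
  generalize hx : (endpoints hv).1 = x at *
  generalize hy : (endpoints hv).2 = y at *
  cases p with
  | nil => exact absurd rfl hne
  | @cons _ c _ h q =>
    have hc : c ∈ K v := hp c (by simp)
    rw [← Finset.mem_coe, he] at hc
    rcases hc with rfl | rfl
    · exact absurd rfl h.ne
    · exact h

theorem IsPartition.exists_mem_edgeTree_of_adj [Infinite V] (hK : IsPartition Γ π φ K)
    (hπ : IsBiInfiniteTree π) (hconn : Γ.Connected) {h₀ : ℤ}
    (h₀le : ∀ v ∈ edgeCells π K, h₀ ≤ height π φ v) {h : ℤ} (hh : h ≤ h₀) {x y : V}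
    (hxy : Γ.Adj x y) : ∃ e ∈ edgeTree π K, height π φ e = h ∧ x ∈ K e ∧ y ∈ K e := by
  obtain ⟨v, hv, hKv⟩ := hK.exists_edgeCell hπ hconn hxy
  have h1 := h₀le v hv
  refine ⟨π^[(height π φ v - h).toNat] v, iterate_mem_edgeTree (edgeCells_subset_edgeTree hv) _,
    ?_, ?_, ?_⟩
  · rw [height_iterate hπ]; omega
  · apply hK.cell_subset_iterate
    rw [← Finset.mem_coe, hKv]; simp
  · apply hK.cell_subset_iterate
    rw [← Finset.mem_coe, hKv]; simp

/-- Every point of a cell lies in a descendant cell of prescribed height in `T_e`. -/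
theorem IsPartition.exists_descendant (hK : IsPartition Γ π φ K) (hπ : IsBiInfiniteTree π) {h₀ : ℤ}
    (h₀le : ∀ v ∈ edgeCells π K, h₀ ≤ height π φ v) {u : T} (hu : u ∈ edgeTree π K) {y : V}
    (hy : y ∈ K u) {k : ℕ} (hk : height π φ u + k ≤ h₀) :
    ∃ v ∈ edgeTree π K, π^[k] v = u ∧ y ∈ K v := by
  classical
  -- An edge cell has height at least `h₀`, which leaves no room to descend.
  by_cases hue : u ∈ edgeCells π K
  · have := h₀le u hue
    obtain rfl : k = 0 := by omega
    exact ⟨u, hu, rfl, hy⟩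
  have hch : ∀ w : {w // y ∈ K w}, ∃ v : {w // y ∈ K w}, π v.1 = w.1 := by
    rintro ⟨w, hw⟩
    rw [← Finset.mem_coe, ← hK.union_children w] at hw
    obtain ⟨v, hv, hyv⟩ := Set.mem_iUnion₂.1 hw
    exact ⟨⟨v, hyv⟩, hv⟩
  choose g hg using hch
  set σ : ℕ → {w // y ∈ K w} := fun n => g^[n] ⟨u, hy⟩ with hσ
  have hσs : ∀ n, π (σ (n + 1)).1 = (σ n).1 := by
    intro n
    simp only [hσ, Function.iterate_succ_apply']
    exact hg _
  have hσi : ∀ n i, π^[n] (σ (i + n)).1 = (σ i).1 := by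
    intro n
    induction n with
    | zero => intro i; rfl
    | succ n ih =>
      intro i
      rw [Function.iterate_succ_apply, ← add_assoc, hσs, ih]
  have hσ0 : (σ 0).1 = u := rfl
  set a := height π φ u with ha
  have hσh : ∀ n, height π φ (σ n).1 = a + n := by
    intro n
    have h1 := height_iterate hπ φ (σ (0 + n)).1 n
    rw [hσi n 0, hσ0, zero_add] at h1
    omega
  set ω : ℤ → T := fun n => if a ≤ n then (σ (n - a).toNat).1 else π^[(a - n).toNat] u with hω
  have hωg : ω ∈ geodesics π φ := by
    constructor
    · intro n
      by_cases hn : a ≤ n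
      · simp only [hω, if_pos hn, hσh]; omega
      · simp only [hω, if_neg hn, height_iterate hπ]; omega
    · intro n
      by_cases hn : a ≤ n
      · have e : (n + 1 - a).toNat = (n - a).toNat + 1 := by omega
        simp only [hω, if_pos hn, if_pos (show a ≤ n + 1 by omega), e, hσs]
      · by_cases hn' : a ≤ n + 1
        · have e : (n + 1 - a).toNat = 0 := by omega
          have e' : (a - n).toNat = 1 := by omega
          simp only [hω, if_neg hn, if_pos hn', e, e']
          rfl
        · have e' : (a - n).toNat = (a - (n + 1)).toNat + 1 := by omega
          simp only [hω, if_neg hn, if_neg hn', e', Function.iterate_succ_apply']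
  obtain ⟨n₀, x₁, x₂, hadj, hn₀⟩ := hK.eventually_edge ω hωg
  have h2 : ∃ n : ℕ, (K (σ n).1).card = 2 := by
    refine ⟨((max n₀ a) - a).toNat, ?_⟩
    have h3 := hn₀ (max n₀ a) (le_max_left _ _)
    simp only [hω, if_pos (le_max_right n₀ a)] at h3
    have h4 : K (σ ((max n₀ a) - a).toNat).1 = {x₁, x₂} := by
      rw [← Finset.coe_inj, h3]; simp
    rw [h4, Finset.card_pair hadj.ne]
  obtain ⟨n, hn⟩ := h2
  have hup : 2 < (K (π^[n] (σ n).1)).card := by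
    have := hσi n 0
    rw [zero_add] at this
    rw [this]
    exact hK.two_lt_card hu hue
  obtain ⟨m, hm1, hm2⟩ := exists_iterate_card hn.le hup
  have hcell : π^[m] (σ n).1 ∈ edgeCells π K := by
    refine ⟨le_antisymm hm1 ?_, by rw [← Function.iterate_succ_apply' π]; exact hm2⟩
    rw [← hn]
    exact Finset.card_le_card (hK.cell_subset_iterate _ _)
  have hmn : m ≤ n := by
    by_contra hlt
    push Not at hlt
    have h5 : (K (π^[n] (σ n).1)).card ≤ (K (π^[m] (σ n).1)).card := by
      obtain ⟨c, rfl⟩ := Nat.exists_eq_add_of_le' hlt.le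
      rw [Function.iterate_add_apply]
      exact Finset.card_le_card (hK.cell_subset_iterate _ _)
    omega
  obtain ⟨c, rfl⟩ := Nat.exists_eq_add_of_le hmn
  rw [add_comm m c, hσi] at hcell
  -- The edge cell lies `c` levels below `u` and has height at least `h₀`, so the member of the
  -- sequence `k` levels below `u` is an ancestor of it and belongs to `T_e`.
  have hkc : k ≤ c := by
    have := h₀le _ hcell
    rw [hσh] at this
    omega
  obtain ⟨e, rfl⟩ := Nat.exists_eq_add_of_le hkc
  refine ⟨(σ k).1, ?_, by have := hσi k 0; rw [zero_add] at this; exact this, (σ k).2⟩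
  rw [← hσi e k]
  exact iterate_mem_edgeTree (edgeCells_subset_edgeTree hcell) _

end EdgeCells

/-! ### Diameters of cells -/

section Diameters

variable {V T : Type*} [MetricSpace V] {Γ : SimpleGraph V} {π : T → T} {φ : T}
  {K : T → Finset V} {r : ℝ}

theorem dist_le_cellDiam {w : T} {x y : V} (hx : x ∈ K w) (hy : y ∈ K w) :
    dist x y ≤ cellDiam K w :=
  Metric.dist_le_diam_of_mem (K w).finite_toSet.isBounded hx hy

/-- The diameters of the cells are comparable to powers of `r`. -/
def DiamBounds (π : T → T) (φ : T) (K : T → Finset V) (r C : ℝ) : Prop :=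
  ∀ w ∈ edgeTree π K, C⁻¹ * r ^ height π φ w ≤ cellDiam K w ∧
    cellDiam K w ≤ C * r ^ height π φ w

/-- The diameter of an edge cell is the length of an edge, hence bounded, while diameters grow like
`r ^ height` as the height tends to `-∞`. -/
theorem exists_le_height_of_edgeCells (hr0 : 0 < r) (hr1 : r < 1) {C : ℝ} (hC : 0 < C)
    (hd : DiamBounds π φ K r C) (hKc : IsConnectedPartition Γ π K)
    (hedge : ∃ C : ℝ, 0 < C ∧ ∀ x y, Γ.Adj x y → C⁻¹ ≤ dist x y ∧ dist x y ≤ C) :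
    ∃ h₀ : ℤ, ∀ v ∈ edgeCells π K, h₀ ≤ height π φ v := by
  obtain ⟨D, hD, hedge⟩ := hedge
  obtain ⟨n, hn⟩ := pow_unbounded_of_one_lt (C * D) ((one_lt_inv₀ hr0).2 hr1)
  refine ⟨-n, fun v hv => ?_⟩
  by_contra! hlt
  have h1 := (hd v (edgeCells_subset_edgeTree hv)).1
  have h2 : cellDiam K v ≤ D := by
    rw [cellDiam, (endpoints_spec hv).2, Metric.diam_pair]
    exact (hedge _ _ (hKc.adj_endpoints hv)).2
  have h3 : r ^ (-n : ℤ) ≤ r ^ height π φ v := zpow_le_zpow_right_of_le_one₀ hr0 hr1.le hlt.le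
  rw [zpow_neg, zpow_natCast, ← inv_pow] at h3
  have h4 : r ^ height π φ v ≤ C * D := by
    rw [inv_mul_le_iff₀ hC] at h1
    exact h1.trans (by gcongr)
  linarith

/-- Diameters are unbounded along the ancestors, so climbing from a cell of diameter at most `s`
must cross the scale `s`. -/
theorem exists_iterate_mem_scale (hπ : IsBiInfiniteTree π) (hr0 : 0 < r) (hr1 : r < 1) {C : ℝ}
    (hC : 0 < C) (hd : DiamBounds π φ K r C) {w : T} (hw : w ∈ edgeTree π K) {s : ℝ}
    (hs : cellDiam K w ≤ s) : ∃ n, π^[n] w ∈ scale π K (cellDiam K) s := by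
  by_contra! hcon
  have hall : ∀ n, cellDiam K (π^[n] w) ≤ s := by
    intro n
    induction n with
    | zero => exact hs
    | succ n ih =>
      rw [Function.iterate_succ_apply']
      by_contra! hlt
      exact hcon n ⟨iterate_mem_edgeTree hw n, ih, hlt⟩
  obtain ⟨n, hn⟩ := pow_unbounded_of_one_lt (C * s * (r ^ height π φ w)⁻¹)
    ((one_lt_inv₀ hr0).2 hr1)
  have h1 := ((hd _ (iterate_mem_edgeTree hw n)).1).trans (hall n)
  rw [height_iterate hπ, inv_mul_le_iff₀ hC, zpow_sub₀ hr0.ne', zpow_natCast, div_eq_mul_inv,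
    ← inv_pow] at h1
  have hpos : 0 < r ^ height π φ w := zpow_pos hr0 _
  rw [← div_eq_mul_inv, div_lt_iff₀ hpos] at hn
  linarith

end Diameters

end GraphPartition

end

noncomputable section

namespace GraphPartition

/-! ### Neighborhoods in the scales -/

section Scales

variable {V T : Type*} {Γ : SimpleGraph V} {π : T → T} {φ : T} {K : T → Finset V} {g : T → ℝ}

theorem scaleGraph_edist_le_one {s : ℝ} {u v : T} (hu : u ∈ scale π K g s)
    (hv : v ∈ scale π K g s) {z : V} (hzu : z ∈ K u) (hzv : z ∈ K v) :
    (scaleGraph π K g s).edist u v ≤ 1 := by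
  rw [SimpleGraph.edist_le_one_iff_adj_or_eq]
  by_cases h : u = v
  · exact Or.inr h
  · exact Or.inl ⟨h, hu, hv, z, hzu, hzv⟩

theorem IsUniformlyFinite.encard_le (hg : IsUniformlyFinite π K g) :
    ∃ D : ℕ, ∀ s : ℝ, 0 < s → ∀ w ∈ scale π K g s, ∀ M : ℕ,
      (scaleNbhd π K g s M w).encard ≤ ((D + 1) ^ M : ℕ) := by
  obtain ⟨D, hD⟩ := hg
  refine ⟨D, fun s hs w hw M => ?_⟩
  refine (Set.encard_le_encard fun v hv => hv.2).trans
    (encard_edist_le (L := scale π K g s) (fun a b (h : (scaleGraph π K g s).Adj a b) _ => h.2.2.1) (D := D) ?_ M hw).1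
  intro a ha
  refine (Set.encard_le_encard fun b hb => ?_).trans (hD s hs a ha)
  exact ⟨(show (scaleGraph π K g s).Adj a b from hb).2.2.1,
    SimpleGraph.edist_le_one_iff_adj_or_eq.2 (Or.inl hb)⟩

theorem IsUniformlyFinite.encard_pt_le (hg : IsUniformlyFinite π K g) (M : ℕ) :
    ∃ N : ℕ, ∀ s : ℝ, 0 < s → ∀ x, (scaleNbhdPt π K g s M x).encard ≤ N := by
  obtain ⟨D, hD⟩ := hg.encard_le
  -- All cells of the scale containing `x` are within distance one of a single one of them, whence
  -- the exponent `M + 1`.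
  refine ⟨(D + 1) ^ (M + 1), fun s hs x => ?_⟩
  by_cases h : ∃ w ∈ scale π K g s, x ∈ K w
  · obtain ⟨w, hw, hxw⟩ := h
    refine (Set.encard_le_encard ?_).trans (hD s hs w hw (M + 1))
    intro v hv
    obtain ⟨w', ⟨hw', hxw'⟩, hv⟩ := Set.mem_iUnion₂.1 hv
    refine ⟨hv.1, (SimpleGraph.edist_triangle (v := w')).trans ?_⟩
    push_cast
    rw [add_comm (M : ℕ∞)]
    exact add_le_add (scaleGraph_edist_le_one hw hw' hxw hxw') hv.2
  · have : scaleNbhdPt π K g s M x = ∅ := by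
      simp only [scaleNbhdPt, Set.iUnion_eq_empty]
      intro w hw
      exact absurd ⟨w, hw.1, hw.2⟩ h
    simp [this]

theorem mem_scaleNbhdPt_self {s : ℝ} {M : ℕ} {u : T} (hu : u ∈ scale π K g s) {x : V}
    (hx : x ∈ K u) : u ∈ scaleNbhdPt π K g s M x :=
  Set.mem_biUnion (x := u) ⟨hu, hx⟩ ⟨hu, by simp⟩

theorem mem_scaleNbhdPt_succ {s : ℝ} {M : ℕ} {u v : T} {x y : V}
    (hv : v ∈ scaleNbhdPt π K g s M x) (hu : u ∈ scale π K g s) (hyv : y ∈ K v) (hyu : y ∈ K u) :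
    u ∈ scaleNbhdPt π K g s (M + 1) x := by
  obtain ⟨w, hw, hv⟩ := Set.mem_iUnion₂.1 hv
  refine Set.mem_biUnion (x := w) hw ⟨hu, (SimpleGraph.edist_triangle (v := v)).trans ?_⟩
  push_cast
  exact add_le_add hv.2 (scaleGraph_edist_le_one hv.1 hu hyv hyu)

theorem mem_cellNbhd {s : ℝ} {M : ℕ} {x y : V} :
    y ∈ cellNbhd π K g M x s ↔ (scaleNbhdPt π K g s M x = ∅ ∧ y = x) ∨
      ∃ v ∈ scaleNbhdPt π K g s M x, y ∈ K v := by
  unfold cellNbhd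
  split_ifs with h
  · simp [h]
  · simp [h]

/-- A vertex of the scale meeting `U_M(x, s)` lies in `Λ_{s, M+1}(x)`. -/
theorem mem_scaleNbhdPt_of_mem_cellNbhd {s : ℝ} {M : ℕ} {u : T} {x y : V}
    (hy : y ∈ cellNbhd π K g M x s) (hu : u ∈ scale π K g s) (hyu : y ∈ K u) :
    u ∈ scaleNbhdPt π K g s (M + 1) x := by
  rcases mem_cellNbhd.1 hy with ⟨-, rfl⟩ | ⟨v, hv, hyv⟩
  · exact mem_scaleNbhdPt_self hu hyu
  · exact mem_scaleNbhdPt_succ hv hu hyv hyu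

/-- A chain of intersecting connected cells is connected, so `U_M(x, s)` is connected within the
graph. This turns closeness in the metric into chains of cells. -/
theorem exists_walk_cellNbhd (hKc : IsConnectedPartition Γ π K) {s : ℝ} {M : ℕ} {x y : V}
    (hy : y ∈ cellNbhd π K g M x s) :
    ∃ p : Γ.Walk x y, ∀ z ∈ p.support, z ∈ cellNbhd π K g M x s := by
  rcases mem_cellNbhd.1 hy with ⟨-, rfl⟩ | ⟨v, hv, hyv⟩
  · refine ⟨SimpleGraph.Walk.nil, fun z hz => ?_⟩
    rw [SimpleGraph.Walk.mem_support_nil_iff] at hz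
    rwa [hz]
  · obtain ⟨w, ⟨hw, hxw⟩, hv⟩ := Set.mem_iUnion₂.1 hv
    have key : ∀ n : ℕ, n ≤ M → ∀ v ∈ scaleNbhd π K g s n w, ∀ y ∈ K v,
        ∃ p : Γ.Walk x y, ∀ z ∈ p.support, z ∈ cellNbhd π K g M x s := by
      intro n hn
      have hin : ∀ v ∈ scaleNbhd π K g s n w, ∀ y ∈ K v, y ∈ cellNbhd π K g M x s := by
        intro v hv y hyv
        refine mem_cellNbhd.2 (Or.inr ⟨v, Set.mem_biUnion (x := w) ⟨hw, hxw⟩ ⟨hv.1, hv.2.trans ?_⟩,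
          hyv⟩)
        exact_mod_cast hn
      induction n with
      | zero =>
        intro v hv y hyv
        obtain rfl : w = v := SimpleGraph.edist_eq_zero_iff.1 (le_antisymm hv.2 zero_le)
        obtain ⟨p, hp⟩ := hKc.exists_walk hw.1 hxw hyv
        exact ⟨p, fun z hz => hin w hv z (hp z hz)⟩
      | succ n ih =>
        intro v hv y hyv
        obtain ⟨c, hc, hcv⟩ := exists_edist_le_of_edist_le_succ hv.2
        rcases SimpleGraph.edist_le_one_iff_adj_or_eq.1 hcv with h | rfl
        · obtain ⟨-, hcs, -, z, hzc, hzv⟩ := h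
          obtain ⟨p, hp⟩ := ih (by omega) (fun v hv => hin v ⟨hv.1, hv.2.trans (by
            exact_mod_cast Nat.le_succ n)⟩) c ⟨hcs, hc⟩ z hzc
          obtain ⟨q, hq⟩ := hKc.exists_walk hv.1.1 hzv hyv
          refine ⟨p.append q, fun t ht => ?_⟩
          rcases (SimpleGraph.Walk.mem_support_append_iff _ _).1 ht with h | h
          · exact hp t h
          · exact hin v hv t (hq t h)
        · exact ih (by omega) (fun v hv => hin v ⟨hv.1, hv.2.trans (by
            exact_mod_cast Nat.le_succ n)⟩) c ⟨hv.1, hc⟩ y hyv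
    exact key M le_rfl v hv y hyv

end Scales

/-! ### Counting cells -/

section CountCells

variable {V T : Type*} [MetricSpace V] {Γ : SimpleGraph V} {π : T → T} {φ : T}
  {K : T → Finset V} {r : ℝ}

theorem BasicFramework.exists_diamBounds (hF : BasicFramework π φ K r) :
    ∃ C : ℝ, 0 < C ∧ DiamBounds π φ K r C := hF.diam_asymp

omit [MetricSpace V] in
theorem encard_iterate_preimage_le (hK : IsPartition Γ π φ K) {B : ℕ}
    (hB : ∀ w ∈ edgeTree π K \ edgeCells π K, (children π w).encard ≤ B) (A : Set T) (i : ℕ) :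
    {u | u ∈ edgeTree π K ∧ π^[i] u ∈ A}.encard ≤ (B ^ i : ℕ) * A.encard := by
  induction i with
  | zero =>
    simp only [Function.iterate_zero, id, pow_zero, Nat.cast_one, one_mul]
    exact Set.encard_le_encard fun u hu => hu.2
  | succ i ih =>
    have hsub : {u | u ∈ edgeTree π K ∧ π^[i + 1] u ∈ A} ⊆
        ⋃ w ∈ {u | u ∈ edgeTree π K ∧ π^[i] u ∈ A}, {u | u ∈ edgeTree π K ∧ π u = w} :=
      fun u hu => Set.mem_biUnion (x := π u)
        ⟨parent_mem_edgeTree hu.1, by rw [← Function.iterate_succ_apply]; exact hu.2⟩ ⟨hu.1, rfl⟩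
    refine (Set.encard_le_encard hsub).trans ((encard_biUnion_le (C := B) ?_).trans ?_)
    · intro w _
      by_cases h : ∃ u ∈ edgeTree π K, π u = w
      · obtain ⟨u, hu, rfl⟩ := h
        exact (Set.encard_le_encard fun v hv => hv.2).trans (hB _ (hK.parent_mem_diff hu))
      · have : {u | u ∈ edgeTree π K ∧ π u = w} = ∅ := by
          ext u
          simp only [Set.mem_ofPred_eq, Set.mem_empty_iff_false, iff_false]
          exact fun hu => h ⟨u, hu⟩
        simp [this]
    · calc (B : ℕ∞) * _ ≤ B * ((B ^ i : ℕ) * A.encard) := by gcongr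
        _ = _ := by push_cast; ring

/-- The number of cells of height `h` meeting a ball of radius `A r^h` is bounded. -/
theorem exists_encard_cells_le (hπ : IsBiInfiniteTree π) (hK : IsPartition Γ π φ K)
    (hF : BasicFramework π φ K r) (A : ℝ) :
    ∃ N : ℕ, ∀ (h : ℤ) (x : V), {u | u ∈ edgeTree π K ∧ height π φ u = h ∧
      ∃ y ∈ K u, dist x y < A * r ^ h}.encard ≤ N := by
  have hr0 := hF.ratio_pos
  have hr1 := hF.ratio_lt_one
  obtain ⟨C, hC, hd⟩ := hF.exists_diamBounds
  obtain ⟨M, -, a₁, a₂, ha₁, -, had⟩ := hF.adapted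
  obtain ⟨B, hB⟩ := hF.bounded_children
  obtain ⟨N₀, hN₀⟩ := hF.uniformly_finite.encard_pt_le (M + 1)
  -- At scale `s = b r^h` two things hold: the ball of radius `A r^h` lies in `B(x, a₁ s)`, and
  -- cells of height `h` have diameter at most `s`.
  set b := max (A / a₁) C with hb
  have hbpos : 0 < b := hC.trans_le (le_max_right _ _)
  -- An ancestor `i` levels up has diameter at least `C⁻¹ r^(h-i)`. If it still belongs to the scale
  -- `b r^h`, then `r^(-i) ≤ C b`, so `i < I`.
  obtain ⟨I, hI⟩ := pow_unbounded_of_one_lt (C * b) ((one_lt_inv₀ hr0).2 hr1)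
  refine ⟨(B + 1) ^ I * N₀ * I, fun h x => ?_⟩
  have hpos : 0 < r ^ h := zpow_pos hr0 _
  have hspos : 0 < b * r ^ h := mul_pos hbpos hpos
  -- Each counted cell is a descendant, by fewer than `I` generations, of a cell in `Λ_{s,M+1}(x)`.
  -- There are boundedly many of the latter, and each has boundedly many such descendants.
  have hsub : {u | u ∈ edgeTree π K ∧ height π φ u = h ∧ ∃ y ∈ K u, dist x y < A * r ^ h} ⊆
      ⋃ i ∈ (Finset.range I : Set ℕ), {u | u ∈ edgeTree π K ∧
        π^[i] u ∈ scaleNbhdPt π K (cellDiam K) (b * r ^ h) (M + 1) x} := by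
    rintro u ⟨hu, rfl, y, hy, hxy⟩
    obtain ⟨i, hi⟩ := exists_iterate_mem_scale hπ hr0 hr1 hC hd hu (s := b * r ^ height π φ u)
      ((hd u hu).2.trans (by gcongr; exact le_max_right _ _))
    refine Set.mem_biUnion (x := i) ?_ ⟨hu, ?_⟩
    · simp only [Finset.coe_range, Set.mem_Iio]
      by_contra! hIi
      have h1 := (hd _ hi.1).1.trans hi.2.1
      rw [height_iterate hπ, zpow_sub₀ hr0.ne', zpow_natCast, inv_mul_le_iff₀ hC, div_eq_mul_inv,
        ← inv_pow] at h1
      have h2 : (r⁻¹) ^ I ≤ (r⁻¹) ^ i := pow_le_pow_right₀ ((one_lt_inv₀ hr0).2 hr1).le hIi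
      have h3 : r ^ height π φ u * (r⁻¹) ^ i ≤ r ^ height π φ u * (C * b) := by linarith
      have := le_of_mul_le_mul_left h3 hpos
      linarith
    · refine mem_scaleNbhdPt_of_mem_cellNbhd ((had x _ hspos).1 ?_) hi
        (hK.cell_subset_iterate _ _ hy)
      rw [Metric.mem_ball, dist_comm]
      refine hxy.trans_le ?_
      rw [← mul_assoc]
      gcongr
      rw [mul_comm, ← div_le_iff₀ ha₁]
      exact le_max_left _ _
  refine (Set.encard_le_encard hsub).trans ((encard_biUnion_le
    (C := (B + 1) ^ I * N₀) ?_).trans ?_)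
  · intro i hi
    refine (encard_iterate_preimage_le hK hB _ i).trans ?_
    simp only [Finset.coe_range, Set.mem_Iio] at hi
    rw [Nat.cast_mul]
    refine mul_le_mul' ?_ (hN₀ _ hspos x)
    rw [Nat.cast_le]
    exact (Nat.pow_le_pow_left (Nat.le_succ B) i).trans (Nat.pow_le_pow_right (Nat.succ_pos B) hi.le)
  · rw [Set.encard_coe_eq_coe_finsetCard, Finset.card_range]
    push_cast
    exact le_rfl

/-- Two points lie in a common cell of the scale `s`. -/
def ShareCell (π : T → T) (K : T → Finset V) (s : ℝ) (x y : V) : Prop :=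
  ∃ u ∈ scale π K (cellDiam K) s, x ∈ K u ∧ y ∈ K u

theorem ShareCell.mono (hπ : IsBiInfiniteTree π) (hK : IsPartition Γ π φ K) (hr0 : 0 < r)
    (hr1 : r < 1) {C : ℝ} (hC : 0 < C) (hd : DiamBounds π φ K r C) {s s' : ℝ} (hs : s ≤ s')
    {x y : V} (h : ShareCell π K s x y) : ShareCell π K s' x y := by
  obtain ⟨u, hu, hx, hy⟩ := h
  obtain ⟨n, hn⟩ := exists_iterate_mem_scale hπ hr0 hr1 hC hd hu.1 (hu.2.1.trans hs)
  exact ⟨_, hn, hK.cell_subset_iterate _ _ hx, hK.cell_subset_iterate _ _ hy⟩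

omit [MetricSpace V] in
theorem mem_of_subtree (hK : IsPartition Γ π φ K) {u w : T} (hu : u ∈ subtree π w) {x : V}
    (hx : x ∈ K u) : x ∈ K w := by
  obtain ⟨n, rfl⟩ := hu
  exact hK.cell_subset_iterate _ _ hx

/-- The points `x` and `y` are joined by a chain of `n` cells of the scale `s`. -/
def ChainCell (π : T → T) (K : T → Finset V) (s : ℝ) : ℕ → V → V → Prop
  | 0, x, y => x = y
  | n + 1, x, y => ∃ z, ChainCell π K s n x z ∧ ShareCell π K s z y

theorem ChainCell.eq_of_forall_not {s : ℝ} {x : V} (h : ∀ z, ¬ ShareCell π K s x z) {n : ℕ} {y : V}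
    (hy : ChainCell π K s n x y) : y = x := by
  induction n generalizing y with
  | zero => exact Eq.symm hy
  | succ n ih =>
    obtain ⟨z, hz, hzy⟩ := hy
    obtain rfl := ih hz
    exact absurd hzy (h y)

theorem chainCell_of_mem_scaleNbhd {s : ℝ} {w v : T} (hw : w ∈ scale π K (cellDiam K) s) {x y : V}
    (hx : x ∈ K w) {n : ℕ} (hv : v ∈ scaleNbhd π K (cellDiam K) s n w) (hy : y ∈ K v) :
    ChainCell π K s (n + 1) x y := by
  induction n generalizing v y with
  | zero =>
    obtain rfl : w = v := SimpleGraph.edist_eq_zero_iff.1 (le_antisymm hv.2 zero_le)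
    exact ⟨x, rfl, w, hw, hx, hy⟩
  | succ n ih =>
    obtain ⟨c, hc, hcv⟩ := exists_edist_le_of_edist_le_succ hv.2
    rcases SimpleGraph.edist_le_one_iff_adj_or_eq.1 hcv with h | rfl
    · obtain ⟨-, hcs, -, z, hzc, hzv⟩ := h
      exact ⟨z, ih ⟨hcs, hc⟩ hzc, v, hv.1, hzv, hy⟩
    · exact ⟨y, ih ⟨hv.1, hc⟩ hy, c, hv.1, hy, hy⟩

theorem chainCell_of_mem_cellNbhd {s : ℝ} {M : ℕ} {x y : V}
    (hy : y ∈ cellNbhd π K (cellDiam K) M x s) : y = x ∨ ChainCell π K s (M + 1) x y := by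
  rcases mem_cellNbhd.1 hy with ⟨-, rfl⟩ | ⟨v, hv, hyv⟩
  · exact Or.inl rfl
  · obtain ⟨w, ⟨hw, hxw⟩, hv⟩ := Set.mem_iUnion₂.1 hv
    exact Or.inr (chainCell_of_mem_scaleNbhd hw hxw hv hyv)

/-- Thickness protects only the immediate neighbours of the cells containing a point, whereas
adaptedness involves chains of length `M`. Iterating bridges the gap: thickness of `w` yields a cell
`u` all of whose neighbours lie below `w`. A point of `u` is then chosen whose shorter chains stay
in `u`; the last link of a chain leads at most to such a neighbour. -/
theorem exists_chain_subset (hπ : IsBiInfiniteTree π) (hK : IsPartition Γ π φ K)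
    (hF : BasicFramework π φ K r) (n : ℕ) :
    ∃ c : ℝ, 0 < c ∧ ∀ w ∈ edgeTree π K, ∃ x ∈ K w, ∀ s ≤ c * r ^ height π φ w, ∀ y,
      ChainCell π K s n x y → y ∈ K w := by
  have hr0 := hF.ratio_pos
  have hr1 := hF.ratio_lt_one
  obtain ⟨C, hC, hd⟩ := hF.exists_diamBounds
  obtain ⟨a, ha, hthick⟩ := hF.thick
  induction n with
  | zero =>
    refine ⟨1, one_pos, fun w hw => ?_⟩
    obtain ⟨x, hx⟩ := hK.cell_nonempty hw
    refine ⟨x, hx, fun s _ y hy => ?_⟩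
    obtain rfl : x = y := hy
    exact hx
  | succ n ih =>
    obtain ⟨c, hc, ih⟩ := ih
    have hmin : 0 < min 1 (c * C⁻¹ * r) := lt_min one_pos (by positivity)
    -- The factor `a * C⁻¹` gives a scale below `t = a d(π w)`, and the minimum with `1` keeps it
    -- there. The factor `c * C⁻¹ * r` then brings it below `c r ^ height u`, because `t < d(π u) ≤
    -- C r^(height u - 1)`.
    refine ⟨min 1 (c * C⁻¹ * r) * (a * C⁻¹), by positivity, fun w hw => ?_⟩
    obtain ⟨x, hx, hsub⟩ := hthick w hw
    set t := a * cellDiam K (π w) with ht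
    have htw : ∀ s ≤ min 1 (c * C⁻¹ * r) * (a * C⁻¹) * r ^ height π φ w, s ≤ min 1 (c * C⁻¹ * r) * t := by
      intro s hs
      refine hs.trans ?_
      rw [mul_assoc]
      rw [ht, mul_assoc a]
      refine mul_le_mul_of_nonneg_left (mul_le_mul_of_nonneg_left ?_ ha.le) hmin.le
      refine le_trans ?_ (hd _ (parent_mem_edgeTree hw)).1
      rw [height_parent hπ]
      refine mul_le_mul_of_nonneg_left ?_ (inv_pos.2 hC).le
      rw [zpow_sub_one₀ hr0.ne']
      exact le_mul_of_one_le_right (zpow_pos hr0 _).le ((one_le_inv₀ hr0).2 hr1.le)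
    have htpos : 0 < t := mul_pos ha
      (lt_of_lt_of_le (mul_pos (inv_pos.2 hC) (zpow_pos hr0 _)) (hd _ (parent_mem_edgeTree hw)).1)
    by_cases hex : ∃ u ∈ scale π K (cellDiam K) t, x ∈ K u
    · obtain ⟨u, hu, hxu⟩ := hex
      have huw : ∀ z ∈ K u, ∀ y, ShareCell π K t z y → y ∈ K w := by
        rintro z hz y ⟨v, hv, hzv, hyv⟩
        exact mem_of_subtree hK (hsub (mem_scaleNbhdPt_succ (M := 0)
          (mem_scaleNbhdPt_self hu hxu) hv hz hzv)) hyv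
      obtain ⟨x', hx', hch⟩ := ih u hu.1
      refine ⟨x', huw x' hx' x' ⟨u, hu, hx', hx'⟩, fun s hs y hy => ?_⟩
      obtain ⟨z, hz, hzy⟩ := hy
      have h1 := htw s hs
      refine huw z (hch s ?_ z hz) y (hzy.mono hπ hK hr0 hr1 hC hd (h1.trans ?_))
      · have h2 : t ≤ C * r ^ height π φ u * r⁻¹ := by
          have := (hd _ (parent_mem_edgeTree hu.1)).2
          rw [height_parent hπ, zpow_sub_one₀ hr0.ne', ← mul_assoc] at this
          exact hu.2.2.le.trans this
        calc s ≤ c * C⁻¹ * r * t := h1.trans (by gcongr; exact min_le_right _ _)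
          _ ≤ c * C⁻¹ * r * (C * r ^ height π φ u * r⁻¹) := by gcongr
          _ = c * r ^ height π φ u := by field_simp
      · exact mul_le_of_le_one_left htpos.le (min_le_left _ _)
    -- If no cell of scale `t` contains `x`, then none of a smaller scale does either, and only
    -- constant chains start at `x`.
    · refine ⟨x, hx, fun s hs y hy => ?_⟩
      rw [hy.eq_of_forall_not fun z hz => ?_]
      · exact hx
      · obtain ⟨u, hu, hxu, -⟩ := hz.mono hπ hK hr0 hr1 hC hd
          ((htw s hs).trans (mul_le_of_le_one_left htpos.le (min_le_left _ _)))
        exact hex ⟨u, hu, hxu⟩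

/-- Every cell contains a ball of comparable size. -/
theorem exists_ball_subset_cell (hπ : IsBiInfiniteTree π) (hK : IsPartition Γ π φ K)
    (hF : BasicFramework π φ K r) :
    ∃ c : ℝ, 0 < c ∧ ∀ w ∈ edgeTree π K, ∃ x ∈ K w,
      Metric.ball x (c * r ^ height π φ w) ⊆ K w := by
  obtain ⟨M, -, a₁, a₂, ha₁, -, had⟩ := hF.adapted
  -- A path of length `M` in the scale graph visits `M + 1` cells.
  obtain ⟨c, hc, h⟩ := exists_chain_subset hπ hK hF (M + 1)
  refine ⟨a₁ * c, by positivity, fun w hw => ?_⟩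
  obtain ⟨x, hx, hx'⟩ := h w hw
  refine ⟨x, hx, fun y hy => ?_⟩
  have hpos : 0 < r ^ height π φ w := zpow_pos hF.ratio_pos _
  rw [mul_assoc] at hy
  rcases chainCell_of_mem_cellNbhd ((had x _ (by positivity)).1 hy) with rfl | hy
  · exact hx
  · exact hx' _ le_rfl y hy

end CountCells

end GraphPartition

end

noncomputable section

namespace GraphPartition

/-! ### Volumes -/

section Volumes

variable {V : Type*} {Γ : SimpleGraph V} [Γ.LocallyFinite] {μ : V → V → ℝ}

theorem exists_vertexWeight_bounds [Infinite V] (hconn : Γ.Connected)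
    (hdeg : ∃ D : ℕ, ∀ x, Γ.degree x ≤ D) (hμ : IsConductance Γ μ)
    (hμ_asymp : ∃ C : ℝ, 0 < C ∧ ∀ x y, Γ.Adj x y → C⁻¹ ≤ μ x y ∧ μ x y ≤ C) :
    ∃ m M : ℝ, 0 < m ∧ 0 < M ∧ ∀ x, m ≤ vertexWeight Γ μ x ∧ vertexWeight Γ μ x ≤ M := by
  obtain ⟨D, hD⟩ := hdeg
  obtain ⟨C, hC, h⟩ := hμ_asymp
  refine ⟨C⁻¹, (D + 1) * C, by positivity, by positivity, fun x => ⟨?_, ?_⟩⟩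
  · obtain ⟨y, hy⟩ := exists_adj hconn x
    refine (h x y hy).1.trans ?_
    exact Finset.single_le_sum (f := fun y => μ x y)
      (fun z hz => (hμ.pos x z ((Γ.mem_neighborFinset _ _).1 hz)).le)
      ((Γ.mem_neighborFinset _ _).2 hy)
  · calc vertexWeight Γ μ x ≤ ∑ y ∈ Γ.neighborFinset x, C :=
          Finset.sum_le_sum fun z hz => (h x z ((Γ.mem_neighborFinset _ _).1 hz)).2
      _ = Γ.degree x * C := by rw [Finset.sum_const, nsmul_eq_mul]; rfl
      _ ≤ (D + 1) * C := by
          gcongr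
          exact (Nat.cast_le.2 (hD x)).trans (by linarith)

variable [MetricSpace V]

theorem vol_mono {x y : V} {s t : ℝ} (h : Metric.ball x s ⊆ Metric.ball y t) :
    vol Γ μ x s ≤ vol Γ μ y t :=
  ENNReal.tsum_mono_subtype (fun y => ENNReal.ofReal (vertexWeight Γ μ y)) h

theorem vol_le_encard {M : ℝ} (hM : ∀ x, vertexWeight Γ μ x ≤ M) {x : V} {s : ℝ} {S : Set V}
    (h : Metric.ball x s ⊆ S) : vol Γ μ x s ≤ S.encard * ENNReal.ofReal M := by
  refine (ENNReal.tsum_mono_subtype (fun y => ENNReal.ofReal (vertexWeight Γ μ y)) h).trans ?_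
  rw [← ENNReal.tsum_set_const]
  exact ENNReal.tsum_le_tsum fun y => ENNReal.ofReal_le_ofReal (hM y)

theorem encard_le_vol {m : ℝ} (hm : ∀ x, m ≤ vertexWeight Γ μ x) {x : V} {s : ℝ} {S : Set V}
    (h : S ⊆ Metric.ball x s) : S.encard * ENNReal.ofReal m ≤ vol Γ μ x s := by
  refine le_trans ?_ (ENNReal.tsum_mono_subtype (fun y => ENNReal.ofReal (vertexWeight Γ μ y)) h)
  rw [← ENNReal.tsum_set_const]
  exact ENNReal.tsum_le_tsum fun y => ENNReal.ofReal_le_ofReal (hm y)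

theorem vol_pos {m : ℝ} (hm0 : 0 < m) (hm : ∀ x, m ≤ vertexWeight Γ μ x) {x : V} {s : ℝ}
    (hs : 0 < s) : ENNReal.ofReal m ≤ vol Γ μ x s ∧ vol Γ μ x s ≠ 0 := by
  have h1 : ENNReal.ofReal m ≤ vol Γ μ x s := by
    have := encard_le_vol hm (x := x) (s := s) (S := {x}) (by simpa using hs)
    simpa using this
  exact ⟨h1, ((ENNReal.ofReal_pos.2 hm0).trans_le h1).ne'⟩

omit [Γ.LocallyFinite] in
-- By (F1) the distance from `x` to any other point is at least a fixed fraction of the length of an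
-- edge at `x`. Edges have length of order one, so the points are uniformly separated.
theorem exists_ball_eq_singleton [Infinite V] (hconn : Γ.Connected) (hfit : IsFitting Γ)
    (hedge : ∃ C : ℝ, 0 < C ∧ ∀ x y, Γ.Adj x y → C⁻¹ ≤ dist x y ∧ dist x y ≤ C) :
    ∃ c : ℝ, 0 < c ∧ ∀ x : V, Metric.ball x c = {x} := by
  obtain ⟨C, hC, h⟩ := hfit.comparable
  obtain ⟨D, hD, hedge⟩ := hedge
  refine ⟨D⁻¹ / C, by positivity, fun x => ?_⟩
  ext z
  rw [Metric.mem_ball, Set.mem_singleton_iff]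
  constructor
  · intro hz
    by_contra hne
    obtain ⟨y, hy⟩ := exists_adj hconn x
    have h1 := (hedge x y hy).1.trans (h x y z hy (Ne.symm hne))
    rw [lt_div_iff₀ hC, dist_comm, mul_comm] at hz
    linarith
  · rintro rfl
    rw [dist_self]
    positivity

theorem VG.exists_vol_mul_le {α : ℝ} (hVG : VG Γ μ α) {A : ℝ} (hA : 0 < A) :
    ∃ C : ℝ≥0∞, C ≠ ⊤ ∧ ∀ (x : V) (s : ℝ), 0 < s → vol Γ μ x (A * s) ≤ C * vol Γ μ x s := by
  obtain ⟨C, hC, h⟩ := hVG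
  rcases le_or_gt A 1 with hA1 | hA1
  · refine ⟨1, ENNReal.one_ne_top, fun x s hs => ?_⟩
    rw [one_mul]
    exact vol_mono (Metric.ball_subset_ball (mul_le_of_le_one_left hs.le hA1))
  · refine ⟨ENNReal.ofReal (C * A ^ α), ENNReal.ofReal_ne_top, fun x s hs => ?_⟩
    refine (h x s (A * s) hs (lt_mul_of_one_lt_left hs hA1)).trans ?_
    rw [Real.mul_rpow hA.le hs.le, mul_div_assoc, div_self (Real.rpow_pos_of_pos hs _).ne', mul_one]

/-- Balls of a small fixed radius are single points of bounded weight; volume growth carries this to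
radius `t`. The maximum with `1` covers nonpositive `t`. -/
theorem exists_vol_le [Infinite V] {α : ℝ} (hVG : VG Γ μ α) (hconn : Γ.Connected)
    (hfit : IsFitting Γ)
    (hedge : ∃ C : ℝ, 0 < C ∧ ∀ x y, Γ.Adj x y → C⁻¹ ≤ dist x y ∧ dist x y ≤ C)
    {M : ℝ} (hM : ∀ x, vertexWeight Γ μ x ≤ M) (t : ℝ) :
    ∃ C : ℝ≥0∞, C ≠ ⊤ ∧ ∀ x : V, vol Γ μ x t ≤ C := by
  obtain ⟨c, hc, hball⟩ := exists_ball_eq_singleton hconn hfit hedge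
  obtain ⟨C, hC, h⟩ := hVG.exists_vol_mul_le (A := (max t 1) / c) (by positivity)
  refine ⟨C * ENNReal.ofReal M, ENNReal.mul_ne_top hC ENNReal.ofReal_ne_top, fun x => ?_⟩
  calc vol Γ μ x t ≤ vol Γ μ x (max t 1 / c * c) :=
        vol_mono (Metric.ball_subset_ball (by
          rw [div_mul_cancel₀ _ hc.ne']; exact le_max_left _ _))
    _ ≤ C * vol Γ μ x c := h x c hc
    _ ≤ _ := by
        gcongr
        have := vol_le_encard hM (x := x) (s := c) (S := {x}) (by rw [hball])
        simpa using this

theorem exists_encard_ball_le [Infinite V] {α : ℝ} (hVG : VG Γ μ α) (hconn : Γ.Connected)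
    (hfit : IsFitting Γ)
    (hedge : ∃ C : ℝ, 0 < C ∧ ∀ x y, Γ.Adj x y → C⁻¹ ≤ dist x y ∧ dist x y ≤ C)
    {m M : ℝ} (hm0 : 0 < m) (hm : ∀ x, m ≤ vertexWeight Γ μ x) (hM : ∀ x, vertexWeight Γ μ x ≤ M)
    (t : ℝ) : ∃ N : ℕ, ∀ x : V, (Metric.ball x t).encard ≤ N := by
  obtain ⟨C, hC, h⟩ := exists_vol_le hVG hconn hfit hedge hM t
  have hm' : ENNReal.ofReal m ≠ 0 := (ENNReal.ofReal_pos.2 hm0).ne'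
  obtain ⟨N, hN⟩ := ENNReal.exists_nat_gt (ENNReal.div_ne_top hC hm')
  refine ⟨N, fun x => ?_⟩
  have h1 := (encard_le_vol hm (x := x) (s := t) subset_rfl).trans (h x)
  rw [← ENNReal.le_div_iff_mul_le (Or.inl hm') (Or.inl ENNReal.ofReal_ne_top)] at h1
  have h2 := h1.trans hN.le
  exact_mod_cast h2

end Volumes

/-! ### The horizontal graphs -/

section Horizontal

open RefinedTree

variable {V T : Type*} {Γ : SimpleGraph V} {π : T → T} {φ : T} {K : T → Finset V} {r : ℝ} {h₀ : ℤ}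

theorem exists_coarse_of_level_le (h₀le : ∀ v ∈ edgeCells π K, h₀ ≤ height π φ v)
    {u : RefinedTree π K r} (hu : level φ u ≤ h₀) : ∃ w hw, u = coarse w hw := by
  match u with
  | coarse w hw => exact ⟨w, hw, rfl⟩
  | fine v hv m k =>
    have := h₀le v hv
    simp only [level] at hu
    omega

theorem level_eq_of_edist_le {a b : RefinedTree π K r} {n : ℕ}
    (h : (horizontal φ).edist a b ≤ n) : level φ a = level φ b := by
  induction n generalizing b with
  | zero =>
    obtain rfl : a = b := SimpleGraph.edist_eq_zero_iff.1 (le_antisymm h zero_le)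
    rfl
  | succ n ih =>
    obtain ⟨c, hc, hcb⟩ := exists_edist_le_of_edist_le_succ h
    rcases SimpleGraph.edist_le_one_iff_adj_or_eq.1 hcb with h | rfl
    · exact (ih hc).trans h.2.1
    · exact ih hc

/-- The vertex `w` itself for `w ∈ T_e`, and the edge cell containing `w` if `w` is a part of an
edge. -/
def carrier : RefinedTree π K r → T
  | coarse w _ => w
  | fine v _ _ _ => v

theorem carrier_mem (u : RefinedTree π K r) : carrier u ∈ edgeTree π K := by
  match u with
  | coarse w hw => exact hw
  | fine v hv m k => exact edgeCells_subset_edgeTree hv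

theorem cell_subset_carrier (u : RefinedTree π K r) : cell u ⊆ (K (carrier u) : Set V) := by
  match u with
  | coarse w hw => exact subset_rfl
  | fine v hv m k =>
    simp only [cell, carrier, (endpoints_spec hv).2]
    split_ifs <;> simp

theorem IsPartition.carrier_subset_parent (hK : IsPartition Γ π φ K) (u : RefinedTree π K r) :
    K (carrier u) ⊆ K (carrier (parent u)) := by
  match u with
  | coarse w hw => exact hK.cell_subset_parent w
  | fine v hv 0 k => exact subset_rfl
  | fine v hv (m + 1) k => exact subset_rfl

theorem IsPartition.carrier_subset_iterate (hK : IsPartition Γ π φ K) (u : RefinedTree π K r)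
    (n : ℕ) : K (carrier u) ⊆ K (carrier (parent^[n] u)) := by
  induction n with
  | zero => exact subset_rfl
  | succ n ih =>
    rw [Function.iterate_succ_apply']
    exact ih.trans (hK.carrier_subset_parent _)

theorem exists_mem_carrier_of_adj {a b : RefinedTree π K r} (h : (horizontal φ).Adj a b) :
    ∃ z, z ∈ K (carrier a) ∧ z ∈ K (carrier b) := by
  obtain ⟨-, -, ⟨z, hza, hzb⟩ | ⟨v, hv, m, i, j, -, rfl, rfl⟩ | ⟨v, hv, m, i, j, -, rfl, rfl⟩⟩ := h
  · exact ⟨z, cell_subset_carrier a hza, cell_subset_carrier b hzb⟩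
  · exact ⟨(endpoints hv).1, by simp [carrier, ← Finset.mem_coe, (endpoints_spec hv).2]⟩
  · exact ⟨(endpoints hv).1, by simp [carrier, ← Finset.mem_coe, (endpoints_spec hv).2]⟩

theorem horizontal_edist_le_one {u v : T} (hu : u ∈ edgeTree π K) (hv : v ∈ edgeTree π K)
    (he : height π φ u = height π φ v) {z : V} (hzu : z ∈ K u) (hzv : z ∈ K v) :
    (horizontal φ).edist (coarse u hu : RefinedTree π K r) (coarse v hv) ≤ 1 := by
  rw [SimpleGraph.edist_le_one_iff_adj_or_eq]
  by_cases h : (coarse u hu : RefinedTree π K r) = coarse v hv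
  · exact Or.inr h
  · exact Or.inl ⟨h, he, Or.inl ⟨z, hzu, hzv⟩⟩

/-- A walk of the graph is shadowed by a walk in the horizontal graph of a low height. -/
theorem exists_horizontal_walk [Infinite V] (hK : IsPartition Γ π φ K)
    (hπ : IsBiInfiniteTree π) (hconn : Γ.Connected)
    (h₀le : ∀ v ∈ edgeCells π K, h₀ ≤ height π φ v) {h : ℤ} (hh : h ≤ h₀) {x y : V}
    (p : Γ.Walk x y) {u v : T} (hu : u ∈ edgeTree π K) (hv : v ∈ edgeTree π K)
    (huh : height π φ u = h) (hvh : height π φ v = h) (hx : x ∈ K u) (hy : y ∈ K v) :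
    ∃ q : (horizontal φ).Walk (coarse u hu : RefinedTree π K r) (coarse v hv),
      ∀ c ∈ q.support, ∃ e he, c = coarse e he ∧ height π φ e = h ∧ ∃ z ∈ p.support, z ∈ K e := by
  -- Prepends a cell to a walk of cells; two cells sharing a point may coincide, in which case no
  -- step is added.
  have step : ∀ {u e : T} (hu : u ∈ edgeTree π K) (he : e ∈ edgeTree π K)
      (_ : height π φ u = h) (_ : height π φ e = h) {x : V} (_ : x ∈ K u) (_ : x ∈ K e)
      (P : RefinedTree π K r → Prop) (_ : P (coarse u hu))
      (q : (horizontal φ).Walk (coarse e he : RefinedTree π K r) (coarse v hv))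
      (_ : ∀ c ∈ q.support, P c),
      ∃ q' : (horizontal φ).Walk (coarse u hu : RefinedTree π K r) (coarse v hv),
        ∀ c ∈ q'.support, P c := by
    intro u e hu he huh heh x hxu hxe P hPu q hq
    rcases SimpleGraph.edist_le_one_iff_adj_or_eq.1
      (horizontal_edist_le_one (r := r) hu he (huh.trans heh.symm) hxu hxe) with ha | ha
    · refine ⟨SimpleGraph.Walk.cons ha q, ?_⟩
      intro c hc
      rw [SimpleGraph.Walk.support_cons, List.mem_cons] at hc
      rcases hc with rfl | hc
      · exact hPu
      · exact hq c hc
    · cases ha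
      exact ⟨q, hq⟩
  induction p generalizing u with
  | @nil x =>
    refine step hu hv huh hvh hx hy _ ⟨u, hu, rfl, huh, x, by simp, hx⟩ SimpleGraph.Walk.nil ?_
    intro c hc
    rw [SimpleGraph.Walk.mem_support_nil_iff] at hc
    exact ⟨v, hv, hc, hvh, x, by simp, hy⟩
  | @cons x x' y hadj p ih =>
    obtain ⟨e, he, heh, hxe, hx'e⟩ := hK.exists_mem_edgeTree_of_adj hπ hconn h₀le hh hadj
    obtain ⟨q, hq⟩ := ih he heh hx'e hy
    refine step hu he huh heh hx hxe _ ⟨u, hu, rfl, huh, x, by simp, hx⟩ q ?_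
    intro c hc
    obtain ⟨e', he', h1, h2, z, hz, h3⟩ := hq c hc
    exact ⟨e', he', h1, h2, z, by simp [hz], h3⟩

variable [MetricSpace V]

/-- Points close in the metric lie in a common connected `U_M(x, s)`. A walk there is shadowed by a
horizontal walk through cells meeting a ball of comparable radius. The number of such cells is
bounded, and it bounds the distance of the ends. The bound is uniform in the height, which makes the
threshold for `N₂` independent of `k`. -/
theorem exists_horizontal_edist_le [Infinite V] (hK : IsPartition Γ π φ K)
    (hπ : IsBiInfiniteTree π) (hconn : Γ.Connected) (hKc : IsConnectedPartition Γ π K)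
    (hF : BasicFramework π φ K r)
    (h₀le : ∀ v ∈ edgeCells π K, h₀ ≤ height π φ v) {A : ℝ} (hA : 0 < A) :
    ∃ N : ℕ, ∀ (u v : T) (hu : u ∈ edgeTree π K) (hv : v ∈ edgeTree π K), height π φ u ≤ h₀ →
      height π φ v = height π φ u → ∀ x ∈ K u, ∀ y ∈ K v, dist x y < A * r ^ height π φ u →
      (horizontal φ).edist (coarse u hu : RefinedTree π K r) (coarse v hv) ≤ N := by
  obtain ⟨M, -, a₁, a₂, ha₁, ha₂, had⟩ := hF.adapted
  obtain ⟨N, hN⟩ := exists_encard_cells_le hπ hK hF (a₂ * (A / a₁))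
  refine ⟨N, fun u v hu hv hh hvh x hx y hy hxy => ?_⟩
  have hpos : 0 < r ^ height π φ u := zpow_pos hF.ratio_pos _
  have hs : 0 < A / a₁ * r ^ height π φ u := by positivity
  have hyU := (had x _ hs).1 (show y ∈ _ by
    rw [Metric.mem_ball, dist_comm, ← mul_assoc, mul_div_cancel₀ _ ha₁.ne']
    exact hxy)
  obtain ⟨p, hp⟩ := exists_walk_cellNbhd hKc hyU
  obtain ⟨q, hq⟩ := exists_horizontal_walk (r := r) hK hπ hconn h₀le hh p hu hv rfl hvh hx hy
  refine edist_le_of_walk (F := {c | ∃ e he, c = coarse e he ∧ height π φ e = height π φ u ∧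
    ∃ z ∈ p.support, z ∈ K e}) ?_ q hq
  refine le_trans ?_ (hN (height π φ u) x)
  refine Set.encard_le_encard_of_injOn (f := carrier) ?_ ?_
  · rintro _ ⟨e, he, rfl, heh, z, hz, hze⟩
    refine ⟨he, heh, z, hze, ?_⟩
    have := (had x _ hs).2 (hp z hz)
    rw [Metric.mem_ball, dist_comm] at this
    rwa [mul_assoc]
  · rintro _ ⟨e, he, rfl, -⟩ _ ⟨e', he', rfl, -⟩ h
    obtain rfl : e = e' := h
    rfl

/-- A horizontal path of length `n` visits `n + 1` cells of equal height, each of diameter at most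
`C r ^ height`. -/
theorem dist_le_of_horizontal_edist_le {C : ℝ} (hd : DiamBounds π φ K r C)
    (h₀le : ∀ v ∈ edgeCells π K, h₀ ≤ height π φ v) {u : T} (hu : u ∈ edgeTree π K)
    (hh : height π φ u ≤ h₀) {n : ℕ} {v : RefinedTree π K r}
    (huv : (horizontal φ).edist (coarse u hu : RefinedTree π K r) v ≤ n) {x y : V} (hx : x ∈ K u)
    (hy : y ∈ K (carrier v)) : dist x y ≤ (n + 1) * (C * r ^ height π φ u) := by
  have hcell : ∀ n : ℕ, ∀ v : RefinedTree π K r,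
      (horizontal φ).edist (coarse u hu : RefinedTree π K r) v ≤ n → ∀ z ∈ K (carrier v),
      ∀ y ∈ K (carrier v), dist z y ≤ C * r ^ height π φ u := by
    intro n v huv z hz y hy
    have hl := level_eq_of_edist_le huv
    obtain ⟨w, hw, rfl⟩ := exists_coarse_of_level_le h₀le (hl ▸ hh : level φ v ≤ h₀)
    have hl' : height π φ u = height π φ w := hl
    rw [hl']
    exact (dist_le_cellDiam hz hy).trans (hd w hw).2
  induction n generalizing v y with
  | zero =>
    obtain rfl : _ = v := SimpleGraph.edist_eq_zero_iff.1 (le_antisymm huv zero_le)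
    simpa using hcell 0 _ huv x hx y hy
  | succ n ih =>
    obtain ⟨c, hc, hcv⟩ := exists_edist_le_of_edist_le_succ huv
    obtain ⟨z, hzc, hzv⟩ : ∃ z, z ∈ K (carrier c) ∧ z ∈ K (carrier v) := by
      rcases SimpleGraph.edist_le_one_iff_adj_or_eq.1 hcv with h | rfl
      · exact exists_mem_carrier_of_adj h
      · exact ⟨y, hy, hy⟩
    have h1 := ih hc hzc
    have h2 := hcell _ v huv z hzv y hy
    calc dist x y ≤ dist x z + dist z y := dist_triangle _ _ _
      _ ≤ (n + 1) * (C * r ^ height π φ u) + C * r ^ height π φ u := add_le_add h1 h2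
      _ = _ := by push_cast; ring

end Horizontal

end GraphPartition

end

noncomputable section

namespace GraphPartition

open RefinedTree

/-! ### Comparison of energies -/

section Comparison

variable {V T : Type*} {Γ : SimpleGraph V} {π : T → T} {φ : T} {K : T → Finset V} {r : ℝ} {h₀ : ℤ}

/-- By minimality an edge cell is determined by its points, and these lie in the closed
neighbourhood of `x`, which has at most `D + 1` elements. -/
theorem encard_edgeCells_le [Γ.LocallyFinite] (hmin : IsMinimal π K)
    (hKc : IsConnectedPartition Γ π K) {D : ℕ} (hD : ∀ x, Γ.degree x ≤ D) (x : V) :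
    {v | v ∈ edgeCells π K ∧ x ∈ K v}.encard ≤ (2 ^ (D + 1) : ℕ) := by
  classical
  calc {v | v ∈ edgeCells π K ∧ x ∈ K v}.encard
      ≤ ((insert x (Γ.neighborFinset x)).powerset : Set (Finset V)).encard := by
        refine Set.encard_le_encard_of_injOn (f := K) ?_ ?_
        · rintro v ⟨hv, hx⟩
          rw [Finset.mem_coe, Finset.mem_powerset]
          intro z hz
          have hadj := hKc.adj_endpoints hv
          rw [← Finset.mem_coe, (endpoints_spec hv).2] at hx hz
          rw [Finset.mem_insert, SimpleGraph.mem_neighborFinset]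
          rcases hx with rfl | rfl <;> rcases hz with rfl | rfl
          · exact Or.inl rfl
          · exact Or.inr hadj
          · exact Or.inr hadj.symm
          · exact Or.inl rfl
        · rintro v ⟨hv, -⟩ w ⟨hw, -⟩ h
          by_contra hne
          exact hmin v hv w hw hne h
    _ ≤ _ := by
        rw [Set.encard_coe_eq_coe_finsetCard, Finset.card_powerset, Nat.cast_le]
        refine Nat.pow_le_pow_right two_pos ((Finset.card_insert_le _ _).trans ?_)
        exact Nat.succ_le_succ (hD x)

/-- Cells of height `h` through `x` are boundedly many by the count of cells near a point. Parts of
edges through `x` are bounded by the number of edge cells at `x` times the number of parts of each.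
-/
theorem exists_encard_carrier_fiber_le [MetricSpace V] [Γ.LocallyFinite]
    (hπ : IsBiInfiniteTree π) (hK : IsPartition Γ π φ K) (hF : BasicFramework π φ K r)
    (hmin : IsMinimal π K) (hKc : IsConnectedPartition Γ π K)
    (hdeg : ∃ D : ℕ, ∀ x, Γ.degree x ≤ D)
    (h₀le : ∀ v ∈ edgeCells π K, h₀ ≤ height π φ v) (h : ℤ) :
    ∃ M : ℕ, ∀ x : V, {u : RefinedTree π K r | level φ u = h ∧ x ∈ K (carrier u)}.encard ≤ M := by
  obtain ⟨D, hD⟩ := hdeg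
  obtain ⟨N, hN⟩ := exists_encard_cells_le hπ hK hF 1
  refine ⟨N + 2 ^ subdiv r (h - h₀).toNat * 2 ^ (D + 1), fun x => ?_⟩
  have hsub : {u : RefinedTree π K r | level φ u = h ∧ x ∈ K (carrier u)} ⊆
      {u | ∃ w hw, u = coarse w hw ∧ height π φ w = h ∧ x ∈ K w} ∪
      ⋃ v ∈ {v | v ∈ edgeCells π K ∧ x ∈ K v},
        {u | ∃ hv m k, u = fine v hv m k ∧ height π φ v + (m + 1) = h} := by
    rintro u ⟨hu, hx⟩
    match u, hu, hx with
    | coarse w hw, hu, hx => exact Or.inl ⟨w, hw, rfl, hu, hx⟩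
    | fine v hv m k, hu, hx =>
      exact Or.inr (Set.mem_biUnion (x := v) ⟨hv, hx⟩ ⟨hv, m, k, rfl, hu⟩)
  refine (Set.encard_le_encard hsub).trans ((Set.encard_union_le _ _).trans ?_)
  rw [Nat.cast_add]
  refine add_le_add ?_ ((encard_biUnion_le (C := 2 ^ subdiv r (h - h₀).toNat) ?_).trans ?_)
  · refine le_trans (Set.encard_le_encard_of_injOn (f := carrier) ?_ ?_) (hN h x)
    · rintro _ ⟨w, hw, rfl, hwh, hx⟩
      refine ⟨hw, hwh, x, hx, ?_⟩
      rw [dist_self, one_mul]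
      exact zpow_pos hF.ratio_pos _
    · rintro _ ⟨w, hw, rfl, -⟩ _ ⟨w', hw', rfl, -⟩ h
      obtain rfl : w = w' := h
      rfl
  · rintro v ⟨hv, -⟩
    -- The depth `m + 1 = h - height v` is at most `h - h₀`, which bounds the number of parts. Only
    -- parts of edges occur in the set, so the value `0` chosen on cells of `T_e` is irrelevant.
    have hle := h₀le v hv
    calc _ ≤ ((Finset.range (2 ^ subdiv r (h - h₀).toNat) : Finset ℕ) : Set ℕ).encard := by
          refine Set.encard_le_encard_of_injOn (f := fun u => match u with
            | coarse _ _ => 0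
            | fine _ _ _ k => (k : ℕ)) ?_ ?_
          · rintro _ ⟨hv, m, k, rfl, hm⟩
            rw [Finset.mem_coe, Finset.mem_range]
            refine k.2.trans_le (Nat.pow_le_pow_right two_pos
              (subdiv_mono hF.ratio_pos hF.ratio_lt_one ?_))
            omega
          · rintro _ ⟨hv, m, k, rfl, hm⟩ _ ⟨hv', m', k', rfl, hm'⟩ h
            obtain rfl : m = m' := by omega
            obtain rfl : k = k' := Fin.ext h
            rfl
      _ = _ := by rw [Set.encard_coe_eq_coe_finsetCard, Finset.card_range]
  · rw [Nat.cast_mul]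
    gcongr
    exact encard_edgeCells_le hmin hKc hD x

theorem exists_card_carrier_le [MetricSpace V] (hF : BasicFramework π φ K r)
    (hK : IsPartition Γ π φ K)
    (hball : ∀ t : ℝ, ∃ N : ℕ, ∀ x : V, (Metric.ball x t).encard ≤ N) (h : ℤ) :
    ∃ P : ℕ, ∀ u : RefinedTree π K r, level φ u = h → (K (carrier u)).card ≤ P := by
  obtain ⟨C, hC, hd⟩ := hF.exists_diamBounds
  obtain ⟨N, hN⟩ := hball (C * r ^ h + 1)
  refine ⟨max N 2, fun u hu => ?_⟩
  match u, hu with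
  | coarse w hw, hu =>
    obtain ⟨x, hx⟩ := hK.cell_nonempty hw
    have h1 : ((K w : Set V)).encard ≤ N := by
      refine (Set.encard_le_encard fun y hy => ?_).trans (hN x)
      rw [Metric.mem_ball]
      have := (dist_le_cellDiam hy hx).trans (hd w hw).2
      rw [show height π φ w = h from hu] at this
      linarith
    rw [Set.encard_coe_eq_coe_finsetCard, Nat.cast_le] at h1
    exact h1.trans (le_max_left _ _)
  | fine v hv m k, _ => exact hv.1.le.trans (le_max_right _ _)

/-- Neighbouring vertices of a level have carriers with a common point, and each carrier is
connected with at most `P` points; a path of `n + 1` carriers is crossed in `(n + 1) * P` steps. -/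
theorem edist_le_of_horizontal_edist_le (hKc : IsConnectedPartition Γ π K) {h : ℤ} {P : ℕ}
    (hP : ∀ u : RefinedTree π K r, level φ u = h → (K (carrier u)).card ≤ P)
    {a b : RefinedTree π K r} (ha : level φ a = h) {n : ℕ} (hab : (horizontal φ).edist a b ≤ n)
    {x y : V} (hx : x ∈ K (carrier a)) (hy : y ∈ K (carrier b)) :
    Γ.edist x y ≤ ((n + 1) * P : ℕ) := by
  have hcell : ∀ b : RefinedTree π K r, level φ b = h → ∀ z ∈ K (carrier b),
      ∀ y ∈ K (carrier b), Γ.edist z y ≤ P := by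
    intro b hb z hz y hy
    exact (hKc.edist_le_card (carrier_mem b) hz hy).trans (Nat.cast_le.2 (hP b hb))
  induction n generalizing b y with
  | zero =>
    obtain rfl : a = b := SimpleGraph.edist_eq_zero_iff.1 (le_antisymm hab zero_le)
    simpa using hcell a ha x hx y hy
  | succ n ih =>
    obtain ⟨c, hc, hcb⟩ := exists_edist_le_of_edist_le_succ hab
    obtain ⟨z, hzc, hzb⟩ : ∃ z, z ∈ K (carrier c) ∧ z ∈ K (carrier b) := by
      rcases SimpleGraph.edist_le_one_iff_adj_or_eq.1 hcb with h | rfl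
      · exact exists_mem_carrier_of_adj h
      · exact ⟨y, hy, hy⟩
    calc Γ.edist x y ≤ Γ.edist x z + Γ.edist z y := SimpleGraph.edist_triangle
      _ ≤ ((n + 1) * P : ℕ) + P := add_le_add (ih hc hzc)
          (hcell b ((level_eq_of_edist_le hab).symm.trans ha) z hzb y hy)
      _ = _ := by push_cast; ring

/-- The energy on a level of the tree of the function induced by a function on the graph. -/
theorem exists_pairEnergy_nearPairs_le [Γ.LocallyFinite] (hKc : IsConnectedPartition Γ π K)
    (hdeg : ∃ D : ℕ, ∀ x, Γ.degree x ≤ D) {h : ℤ} {P M : ℕ}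
    (hP : ∀ u : RefinedTree π K r, level φ u = h → (K (carrier u)).card ≤ P)
    (hM : ∀ x : V, {u : RefinedTree π K r | level φ u = h ∧ x ∈ K (carrier u)}.encard ≤ M)
    {ψ : RefinedTree π K r → V} (hψ : ∀ u, ψ u ∈ K (carrier u)) (N : ℕ) :
    ∃ C : ℕ, ∀ f : V → ℝ, pairEnergy (nearPairs φ N h) (fun u => f (ψ u)) ≤
      C * pairEnergy {e | Γ.Adj e.1 e.2} f := by
  obtain ⟨D, hD⟩ := hdeg
  obtain ⟨C, -, hC⟩ := pairEnergy_stepPairs_le (G := Γ) (L := Set.univ) (fun _ _ _ _ => trivial)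
    (D := D) (fun a _ => by
      rw [← SimpleGraph.coe_neighborFinset, Set.encard_coe_eq_coe_finsetCard, Nat.cast_le]
      exact hD a) ((N + 1) * P)
  refine ⟨M * M * C, fun f => ?_⟩
  have h1 : pairEnergy (nearPairs φ N h) (fun u => f (ψ u)) ≤
      (M * M : ℕ) * pairEnergy (stepPairs Γ Set.univ ((N + 1) * P)) f := by
    refine pairEnergy_comp_le (L := {u | level φ u = h}) (fun e he => ⟨he.1, he.2.1⟩) ?_ ?_ f
    · intro e he
      exact ⟨trivial, edist_le_of_horizontal_edist_le hKc hP he.1 he.2.2.2 (hψ _) (hψ _)⟩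
    · intro x
      refine (Set.encard_le_encard ?_).trans (hM x)
      rintro u ⟨hu, rfl⟩
      exact ⟨hu, hψ u⟩
  refine h1.trans ((mul_le_mul_right (hC f) _).trans ?_)
  simp only [Set.mem_univ, true_and]
  rw [← mul_assoc, ← Nat.cast_mul]

/-- The energy on the graph of the function induced by a function on a level of the tree. -/
theorem exists_pairEnergy_adj_le {h : ℤ} {P M : ℕ}
    (hP : ∀ u : RefinedTree π K r, level φ u = h → (K (carrier u)).card ≤ P)
    (hM : ∀ x : V, {u : RefinedTree π K r | level φ u = h ∧ x ∈ K (carrier u)}.encard ≤ M)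
    (hadj : ∀ x y, Γ.Adj x y → ∃ e : RefinedTree π K r, level φ e = h ∧ x ∈ cell e ∧ y ∈ cell e)
    {χ : V → RefinedTree π K r} (hχ : ∀ x, level φ (χ x) = h ∧ x ∈ cell (χ x))
    {N : ℕ} (hN : 1 ≤ N) :
    ∃ C : ℕ, ∀ F : RefinedTree π K r → ℝ, pairEnergy {e | Γ.Adj e.1 e.2} (fun x => F (χ x)) ≤
      C * pairEnergy (nearPairs φ N h) F := by
  obtain ⟨C, -, hC⟩ := pairEnergy_stepPairs_le (G := horizontal φ)
    (L := {u : RefinedTree π K r | level φ u = h})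
    (fun a b hab ha => hab.2.1.symm.trans ha) (D := M * P) (by
      intro a ha
      have hsub : (horizontal φ).neighborSet a ⊆ ⋃ z ∈ (K (carrier a) : Set V),
          {u | level φ u = h ∧ z ∈ K (carrier u)} := by
        intro b hb
        obtain ⟨z, hza, hzb⟩ := exists_mem_carrier_of_adj hb
        exact Set.mem_biUnion (x := z) hza ⟨hb.2.1.symm.trans ha, hzb⟩
      refine (Set.encard_le_encard hsub).trans ((encard_biUnion_le fun z _ => hM z).trans ?_)
      rw [Set.encard_coe_eq_coe_finsetCard, Nat.cast_mul]
      gcongr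
      exact hP a ha) 2
  have hone : ∀ x, ∀ e, level φ e = h → x ∈ cell e → (horizontal φ).edist (χ x) e ≤ 1 := by
    intro x e he hx
    rw [SimpleGraph.edist_le_one_iff_adj_or_eq]
    by_cases hne : χ x = e
    · exact Or.inr hne
    · exact Or.inl ⟨hne, (hχ x).1.trans he.symm, Or.inl ⟨x, (hχ x).2, hx⟩⟩
  refine ⟨P * P * C, fun F => ?_⟩
  -- Adjacent points share a cell `e` of the level, and the cells chosen for them are each within
  -- distance one of `e`, hence within distance two of one another.
  have h1 : pairEnergy {e | Γ.Adj e.1 e.2} (fun x => F (χ x)) ≤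
      (P * P : ℕ) * pairEnergy (stepPairs (horizontal φ) {u | level φ u = h} 2) F := by
    refine pairEnergy_comp_le (L := Set.univ) (fun _ _ => ⟨trivial, trivial⟩) ?_ ?_ F
    · rintro ⟨x, y⟩ hxy
      obtain ⟨e, he, hx, hy⟩ := hadj x y hxy
      refine ⟨(hχ x).1, (SimpleGraph.edist_triangle (v := e)).trans ?_⟩
      have h2 := hone y e he hy
      rw [SimpleGraph.edist_comm] at h2
      exact (add_le_add (hone x e he hx) h2).trans_eq (by norm_num)
    · intro b
      by_cases hb : level φ b = h
      · refine le_trans (Set.encard_le_encard (t := (K (carrier b) : Set V)) ?_) ?_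
        · rintro x ⟨-, rfl⟩
          exact cell_subset_carrier _ (hχ x).2
        · rw [Set.encard_coe_eq_coe_finsetCard, Nat.cast_le]
          exact hP b hb
      · have : {a | a ∈ Set.univ ∧ χ a = b} = ∅ := by
          ext x
          simp only [Set.mem_univ, true_and, Set.mem_ofPred_eq, Set.mem_empty_iff_false, iff_false]
          rintro rfl
          exact hb (hχ x).1
        rw [this]
        simp
  have h2 : pairEnergy {e | e.1 ∈ {u : RefinedTree π K r | level φ u = h} ∧
      (horizontal φ).Adj e.1 e.2} F ≤ pairEnergy (nearPairs φ N h) F := by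
    refine pairEnergy_mono ?_ F
    rintro ⟨a, b⟩ ⟨ha, hab⟩ hne
    refine ⟨ha, hab.2.1.symm.trans ha, SimpleGraph.edist_pos_of_ne hne, ?_⟩
    exact (SimpleGraph.edist_le_one_iff_adj_or_eq.2 (Or.inl hab)).trans (by exact_mod_cast hN)
  calc _ ≤ _ := h1
    _ ≤ (P * P : ℕ) * (C * pairEnergy (nearPairs φ N h) F) := by
        gcongr
        exact (hC F).trans (by gcongr)
    _ = _ := by rw [← mul_assoc, ← Nat.cast_mul]

theorem energy_two_eq (k : ℕ) (w : RefinedTree π K r) (N₁ N₂ N : ℕ) :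
    energy φ 2 k w N₁ N₂ N = ⨅ (f : RefinedTree π K r → ℝ) (_ : IsAdmissible φ k w N₁ N₂ f),
      (1 / 2) * pairEnergy (nearPairs φ N (level φ w + k)) f := by
  simp only [energy, pairEnergy, Real.rpow_two, sq_abs]

theorem pairEnergy_adj_le_dirichletEnergy {μ : V → V → ℝ} {C : ℝ} (hC : 0 < C)
    (h : ∀ x y, Γ.Adj x y → C⁻¹ ≤ μ x y) (f : V → ℝ) :
    pairEnergy {e | Γ.Adj e.1 e.2} f ≤ ENNReal.ofReal (2 * C) * dirichletEnergy μ f := by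
  unfold dirichletEnergy
  rw [ENNReal.ofReal_mul zero_le_two, ENNReal.ofReal_ofNat, ← mul_assoc,
    mul_right_comm 2, one_div, ENNReal.mul_inv_cancel two_ne_zero ENNReal.ofNat_ne_top, one_mul,
    ← ENNReal.tsum_mul_left, pairEnergy,
    tsum_subtype {e : V × V | Γ.Adj e.1 e.2} (fun e => ENNReal.ofReal ((f e.1 - f e.2) ^ 2))]
  refine ENNReal.tsum_le_tsum fun e => ?_
  by_cases he : Γ.Adj e.1 e.2
  · rw [Set.indicator_of_mem (show e ∈ {e : V × V | Γ.Adj e.1 e.2} from he),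
      ← ENNReal.ofReal_mul hC.le]
    refine ENNReal.ofReal_le_ofReal ?_
    have h1 : 1 ≤ C * μ e.1 e.2 := by
      have := h _ _ he
      rwa [inv_le_iff_one_le_mul₀' hC] at this
    nlinarith [sq_nonneg (f e.1 - f e.2)]
  · rw [Set.indicator_of_notMem (show e ∉ {e : V × V | Γ.Adj e.1 e.2} from he)]
    exact zero_le

theorem dirichletEnergy_le_pairEnergy_adj {μ : V → V → ℝ} (hμ : IsConductance Γ μ) {C : ℝ}
    (h : ∀ x y, Γ.Adj x y → μ x y ≤ C) (f : V → ℝ) :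
    dirichletEnergy μ f ≤ ENNReal.ofReal C * ((1 / 2) * pairEnergy {e | Γ.Adj e.1 e.2} f) := by
  unfold dirichletEnergy
  rw [mul_left_comm]
  refine mul_le_mul_right ?_ _
  rw [pairEnergy,
    tsum_subtype {e : V × V | Γ.Adj e.1 e.2} (fun e => ENNReal.ofReal ((f e.1 - f e.2) ^ 2)),
    ← ENNReal.tsum_mul_left]
  refine ENNReal.tsum_le_tsum fun e => ?_
  by_cases he : Γ.Adj e.1 e.2
  · rw [Set.indicator_of_mem (show e ∈ {e : V × V | Γ.Adj e.1 e.2} from he), mul_comm,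
      ← ENNReal.ofReal_mul' (sq_nonneg _)]
    exact ENNReal.ofReal_le_ofReal (mul_le_mul_of_nonneg_right (h _ _ he) (sq_nonneg _))
  · simp [hμ.zero _ _ he]

end Comparison

end GraphPartition

end

noncomputable section

namespace GraphPartition

open RefinedTree

/-! ### Growth of the tree and of the energies -/

section Rates

variable {V T : Type*} [MetricSpace V] {Γ : SimpleGraph V} [Γ.LocallyFinite] {μ : V → V → ℝ}
  {π : T → T} {φ : T} {K : T → Finset V} {r : ℝ} {h₀ : ℤ}

/-- For `s` larger than `d(x, y)` the change of centre is absorbed in the radius, and volume growth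
absorbs the change of radius. -/
theorem VG.eventually_vol_le {α : ℝ} (hVG : VG Γ μ α) {a b : ℝ} (ha : 0 < a) (hb : 0 < b)
    (x y : V) : ∃ C : ℝ≥0∞, C ≠ ⊤ ∧ ∀ᶠ s in atTop, vol Γ μ x (a * s) ≤ C * vol Γ μ y (b * s) := by
  obtain ⟨C, hC, h⟩ := hVG.exists_vol_mul_le (A := (a + 1) / b) (by positivity)
  refine ⟨C, hC, ?_⟩
  filter_upwards [eventually_gt_atTop (max 0 (dist x y))] with s hs
  have hs0 : 0 < s := (le_max_left _ _).trans_lt hs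
  have hs1 : dist x y < s := (le_max_right _ _).trans_lt hs
  refine le_trans (vol_mono ?_) (h y (b * s) (by positivity))
  rw [← mul_assoc, div_mul_cancel₀ _ hb.ne']
  refine Metric.ball_subset_ball' ?_
  linarith

theorem tendsto_inv_pow_atTop (hr0 : 0 < r) (hr1 : r < 1) :
    Tendsto (fun k : ℕ => (r⁻¹) ^ k) atTop atTop :=
  tendsto_pow_atTop_atTop_of_one_lt ((one_lt_inv₀ hr0).2 hr1)

theorem zpow_level_sub (hr0 : 0 < r) (h : ℤ) (k : ℕ) : r ^ (h - k) = r ^ h * (r⁻¹) ^ k := by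
  rw [zpow_sub₀ hr0.ne', zpow_natCast, div_eq_mul_inv, inv_pow]

omit [MetricSpace V] in
/-- Far up, the ancestors of a vertex lie in `T_e`. -/
theorem eventually_exists_coarse (hπ : IsBiInfiniteTree π)
    (h₀le : ∀ v ∈ edgeCells π K, h₀ ≤ height π φ v) (w : RefinedTree π K r) :
    ∀ᶠ k : ℕ in atTop, ∃ u hu, parent^[k] w = coarse u hu ∧ height π φ u = level φ w - k ∧
      height π φ u ≤ h₀ := by
  filter_upwards [eventually_ge_atTop (level φ w - h₀).toNat] with k hk
  have h1 := level_iterate hπ (φ := φ) w k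
  have h2 : level φ (parent^[k] w) ≤ h₀ := by omega
  obtain ⟨u, hu, he⟩ := exists_coarse_of_level_le h₀le h2
  rw [he] at h1 h2
  exact ⟨u, hu, he, h1, h2⟩

/-- The carriers of all cousins lie in the cell of `π^k(w)`, whose cardinality is at most a multiple
of the volume of a ball containing it. Each point of it belongs to boundedly many carriers of the
level of `w`. -/
theorem exists_cousins_le (hπ : IsBiInfiniteTree π) (hK : IsPartition Γ π φ K)
    (hF : BasicFramework π φ K r) (h₀le : ∀ v ∈ edgeCells π K, h₀ ≤ height π φ v)
    {m : ℝ} (hm0 : 0 < m) (hm : ∀ x, m ≤ vertexWeight Γ μ x)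
    (hfib : ∀ h : ℤ, ∃ M : ℕ, ∀ x : V,
      {u : RefinedTree π K r | level φ u = h ∧ x ∈ K (carrier u)}.encard ≤ M)
    (w : RefinedTree π K r) :
    ∃ (C : ℝ≥0∞) (x : V) (a : ℝ), C ≠ ⊤ ∧ 0 < a ∧
      ∀ᶠ k : ℕ in atTop, cousins k w ≤ C * vol Γ μ x (a * (r⁻¹) ^ k) := by
  have hr0 := hF.ratio_pos
  obtain ⟨C, hC, hd⟩ := hF.exists_diamBounds
  obtain ⟨M, hM⟩ := hfib (level φ w)
  obtain ⟨x, hx⟩ := hK.cell_nonempty (carrier_mem w)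
  have hm' : ENNReal.ofReal m ≠ 0 := (ENNReal.ofReal_pos.2 hm0).ne'
  refine ⟨M / ENNReal.ofReal m, x, 2 * C * r ^ level φ w,
    ENNReal.div_ne_top (ENNReal.natCast_ne_top _) hm', by positivity, ?_⟩
  filter_upwards [eventually_exists_coarse hπ h₀le w] with k ⟨u, hu, hwu, huh, _⟩
  have hxu : x ∈ K u := by
    have := hK.carrier_subset_iterate w k hx
    rwa [hwu] at this
  have hball : (K u : Set V) ⊆ Metric.ball x (2 * C * r ^ level φ w * (r⁻¹) ^ k) := by
    intro y hy
    have := (dist_le_cellDiam hy hxu).trans (hd u hu).2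
    rw [huh, zpow_level_sub hr0] at this
    rw [Metric.mem_ball]
    have hp : 0 < C * (r ^ level φ w * (r⁻¹) ^ k) := by positivity
    linarith
  have hsub : descendants k {parent^[k] w} ⊆ ⋃ z ∈ (K u : Set V),
      {v : RefinedTree π K r | level φ v = level φ w ∧ z ∈ K (carrier v)} := by
    intro v hv
    have hv' : parent^[k] v = parent^[k] w := hv
    obtain ⟨z, hz⟩ := hK.cell_nonempty (carrier_mem v)
    refine Set.mem_biUnion (x := z) ?_ ⟨?_, hz⟩
    · have := hK.carrier_subset_iterate v k hz
      rwa [hv', hwu] at this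
    · have h1 := level_iterate hπ (φ := φ) v k
      have h2 := level_iterate hπ (φ := φ) w k
      rw [hv'] at h1
      omega
  have h1 := (Set.encard_le_encard hsub).trans (encard_biUnion_le fun z _ => hM z)
  have h2 := encard_le_vol hm hball
  calc cousins k w ≤ M * ((K u : Set V).encard : ℝ≥0∞) := by
        unfold cousins
        exact_mod_cast ENat.toENNReal_le.2 h1
    _ ≤ M * (vol Γ μ x (2 * C * r ^ level φ w * (r⁻¹) ^ k) / ENNReal.ofReal m) := by
        gcongr
        rwa [ENNReal.le_div_iff_mul_le (Or.inl hm') (Or.inl ENNReal.ofReal_ne_top)]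
    _ = _ := by rw [mul_div_assoc', ENNReal.mul_div_right_comm]

/-- The cells of the cousins cover the cell of `π^k(w)`, each contributing boundedly many points,
and that cell contains a ball of radius of order `ρ^k`, where `ρ = r⁻¹`. The low height of `w`
provides the covering within `T_e`. -/
theorem exists_vol_le_cousins (hπ : IsBiInfiniteTree π) (hK : IsPartition Γ π φ K)
    (hF : BasicFramework π φ K r) (h₀le : ∀ v ∈ edgeCells π K, h₀ ≤ height π φ v) {α : ℝ}
    (hVG : VG Γ μ α) {M : ℝ} (hM : ∀ x, vertexWeight Γ μ x ≤ M)
    (hcard : ∀ h : ℤ, ∃ P : ℕ, ∀ u : RefinedTree π K r, level φ u = h → (K (carrier u)).card ≤ P)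
    {w : T} (hw : w ∈ edgeTree π K) (hh : height π φ w ≤ h₀) :
    ∃ (C : ℝ≥0∞) (x : V) (a : ℝ), C ≠ ⊤ ∧ 0 < a ∧
      ∀ k : ℕ, vol Γ μ x (a * (r⁻¹) ^ k) ≤ C * cousins k (coarse w hw : RefinedTree π K r) := by
  have hr0 := hF.ratio_pos
  obtain ⟨C, hC, hd⟩ := hF.exists_diamBounds
  obtain ⟨P, hP⟩ := hcard (height π φ w)
  obtain ⟨x, hx⟩ := hK.cell_nonempty hw
  obtain ⟨c, hc, hthick⟩ := exists_ball_subset_cell hπ hK hF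
  obtain ⟨B, hB, hdbl⟩ := hVG.exists_vol_mul_le (A := 2 * C / c) (by positivity)
  refine ⟨B * (P * ENNReal.ofReal M), x, C * r ^ height π φ w,
    ENNReal.mul_ne_top hB (ENNReal.mul_ne_top (ENNReal.natCast_ne_top _) ENNReal.ofReal_ne_top),
    by positivity, fun k => ?_⟩
  set u := π^[k] w with hu
  have hut : u ∈ edgeTree π K := iterate_mem_edgeTree hw k
  have huh : height π φ u = height π φ w - k := height_iterate hπ φ w k
  obtain ⟨y, hy, hball⟩ := hthick u hut
  have hdist : dist x y ≤ C * r ^ height π φ u :=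
    (dist_le_cellDiam (hK.cell_subset_iterate w k hx) hy).trans (hd u hut).2
  have hsub : (K u : Set V) ⊆
      ⋃ v ∈ descendants k {parent^[k] (coarse w hw : RefinedTree π K r)},
        (K (carrier v) : Set V) := by
    intro z hz
    obtain ⟨v, hv, hvu, hzv⟩ := hK.exists_descendant hπ h₀le hut hz (k := k) (by omega)
    refine Set.mem_biUnion (x := coarse v hv) ?_ hzv
    change parent^[k] _ = parent^[k] _
    simp only [parent_iterate_coarse, hvu, hu]
  have hcardu : (K u : Set V).encard ≤
      P * (descendants k {parent^[k] (coarse w hw : RefinedTree π K r)}).encard := by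
    refine (Set.encard_le_encard hsub).trans (encard_biUnion_le fun v hv => ?_)
    rw [Set.encard_coe_eq_coe_finsetCard, Nat.cast_le]
    refine hP v ?_
    have hv' : parent^[k] v = parent^[k] (coarse w hw) := hv
    have h1 := level_iterate hπ (φ := φ) v k
    have h2 := level_iterate hπ (φ := φ) (coarse w hw : RefinedTree π K r) k
    rw [hv'] at h1
    have h3 : level φ (coarse w hw : RefinedTree π K r) = height π φ w := rfl
    omega
  have hpos : 0 < r ^ height π φ u := zpow_pos hr0 _
  calc vol Γ μ x (C * r ^ height π φ w * (r⁻¹) ^ k)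
      ≤ vol Γ μ y (2 * C / c * (c * r ^ height π φ u)) := by
        refine vol_mono (Metric.ball_subset_ball' ?_)
        rw [← mul_assoc, div_mul_cancel₀ _ hc.ne', mul_assoc C, ← zpow_level_sub hr0, ← huh]
        linarith
    _ ≤ B * vol Γ μ y (c * r ^ height π φ u) := hdbl _ _ (by positivity)
    _ ≤ B * (((K u : Set V).encard : ℝ≥0∞) * ENNReal.ofReal M) := by
        gcongr
        exact vol_le_encard hM hball
    _ ≤ B * ((P * cousins k (coarse w hw)) * ENNReal.ofReal M) := by
        gcongr
        unfold cousins
        exact_mod_cast ENat.toENNReal_le.2 hcardu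
    _ = _ := by ring

/-- A test function for the resistance between concentric balls, evaluated at one point of each
carrier, is admissible for the energy. So the energy is bounded by a multiple of the inverse
resistance, which ARL bounds from above. -/
theorem exists_energy_mul_le [Infinite V] (hπ : IsBiInfiniteTree π) (hconn : Γ.Connected)
    (hdeg : ∃ D : ℕ, ∀ x, Γ.degree x ≤ D) (hK : IsPartition Γ π φ K)
    (hKc : IsConnectedPartition Γ π K)
    (hF : BasicFramework π φ K r) (h₀le : ∀ v ∈ edgeCells π K, h₀ ≤ height π φ v)
    (hμ_asymp : ∃ C : ℝ, 0 < C ∧ ∀ x y, Γ.Adj x y → C⁻¹ ≤ μ x y ∧ μ x y ≤ C)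
    (hcard : ∀ h : ℤ, ∃ P : ℕ, ∀ u : RefinedTree π K r, level φ u = h → (K (carrier u)).card ≤ P)
    (hfib : ∀ h : ℤ, ∃ M : ℕ, ∀ x : V,
      {u : RefinedTree π K r | level φ u = h ∧ x ∈ K (carrier u)}.encard ≤ M)
    {β : ℝ} (hARL : ARL Γ μ β) (N₁ : ℕ) :
    ∃ N₂₀ : ℕ, ∀ N₂, N₂₀ ≤ N₂ → ∀ (N : ℕ) (w : RefinedTree π K r),
      ∃ (C : ℝ≥0∞) (x : V) (a : ℝ), C ≠ ⊤ ∧ 0 < a ∧ ∀ᶠ k : ℕ in atTop,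
        energy φ 2 k (parent^[k] w) N₁ N₂ N * ENNReal.ofReal (((r⁻¹) ^ k) ^ β) ≤
          C * vol Γ μ x (a * (r⁻¹) ^ k) := by
  have hr0 := hF.ratio_pos
  have hr1 := hF.ratio_lt_one
  obtain ⟨C, hC, hd⟩ := hF.exists_diamBounds
  obtain ⟨l, c, hl, hc, hARL⟩ := hARL
  obtain ⟨D, hD, hμ_asymp⟩ := hμ_asymp
  -- With `s = A r ^ height u`, the ball of radius `l * s` contains all cells within horizontal
  -- distance `N₁` of `u`; the summand `1` makes the inequality strict. Conversely, cells of the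
  -- same height with a point within `s` of `x` are at horizontal distance at most `N₂₀`.
  set A : ℝ := ((N₁ + 1) * C + 1) / l with hA
  have hA0 : 0 < A := by positivity
  obtain ⟨N₂₀, hN₂₀⟩ := exists_horizontal_edist_le hK hπ hconn hKc hF h₀le hA0
  refine ⟨N₂₀, fun N₂ hN₂ N w => ?_⟩
  have hψ' : ∀ u : RefinedTree π K r, ∃ x, x ∈ K (carrier u) :=
    fun u => hK.cell_nonempty (carrier_mem u)
  choose ψ hψ using hψ'
  obtain ⟨P, hP⟩ := hcard (level φ w)
  obtain ⟨M, hM⟩ := hfib (level φ w)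
  obtain ⟨E, hE⟩ := exists_pairEnergy_nearPairs_le hKc hdeg hP hM hψ N
  set x := ψ w with hx
  set b := A * r ^ level φ w with hb
  have hb0 : 0 < b := by positivity
  have hcb : 0 < c * b ^ β := mul_pos hc (Real.rpow_pos_of_pos hb0 _)
  -- The summand `1` keeps `Q` nonzero, so that one may divide by it.
  set Q : ℝ≥0∞ := (E + 1) * ENNReal.ofReal (2 * D) with hQ
  have hQ0 : Q ≠ 0 := mul_ne_zero (by positivity) (ENNReal.ofReal_pos.2 (by positivity)).ne'
  have hQt : Q ≠ ⊤ := ENNReal.mul_ne_top (by finiteness) ENNReal.ofReal_ne_top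
  refine ⟨Q / ENNReal.ofReal (c * b ^ β), x, b,
    ENNReal.div_ne_top hQt (ENNReal.ofReal_pos.2 hcb).ne', hb0, ?_⟩
  have hbig : ∀ᶠ k : ℕ in atTop, Metric.infDist x {x}ᶜ < b * (r⁻¹) ^ k :=
    ((tendsto_inv_pow_atTop hr0 hr1).const_mul_atTop hb0).eventually_gt_atTop _
  filter_upwards [eventually_exists_coarse hπ h₀le w, hbig] with k ⟨u, hu, hwu, huh, huh₀⟩ hk
  have hpos : 0 < r ^ height π φ u := zpow_pos hr0 _
  set s := b * (r⁻¹) ^ k with hs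
  have hs' : s = A * r ^ height π φ u := by
    rw [hs, hb, mul_assoc, ← zpow_level_sub hr0, huh]
  have hls : l * s = ((N₁ + 1) * C + 1) * r ^ height π φ u := by
    rw [hs', ← mul_assoc, hA, mul_div_cancel₀ _ hl.ne']
  have hxu : x ∈ K u := by
    have := hK.carrier_subset_iterate w k (hψ w)
    rwa [hwu] at this
  have hlevel : level φ (parent^[k] w) + k = level φ w := by
    rw [level_iterate hπ]; ring
  have hpt : ∀ v : RefinedTree π K r, ψ v ∈ K (carrier (parent^[k] v)) :=
    fun v => hK.carrier_subset_iterate v k (hψ v)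
  -- The inverse of the effective resistance. The final estimate uses only `I * I⁻¹ ≤ 1`, which also
  -- holds for `I = 0` and `I = ⊤`.
  set I := ⨅ (f : V → ℝ) (_ : (∀ y ∈ Metric.ball x (l * s), f y = 1) ∧
    ∀ y ∈ (Metric.ball x s)ᶜ, f y = 0), dirichletEnergy μ f with hI
  have hle : energy φ 2 k (parent^[k] w) N₁ N₂ N ≤ Q * I := by
    rw [← ENNReal.div_le_iff' hQ0 hQt]
    refine le_iInf₂ fun f hf => ?_
    rw [ENNReal.div_le_iff' hQ0 hQt, energy_two_eq, hlevel]
    refine (iInf₂_le (fun v => f (ψ v)) ⟨?_, ?_⟩).trans ?_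
    rotate_left
    · intro v hv
      refine hf.1 _ ?_
      have hv' : (horizontal φ).edist (coarse u hu) (parent^[k] v) ≤ N₁ := by
        rw [← hwu]; exact hv.2
      have := dist_le_of_horizontal_edist_le hd h₀le hu huh₀ hv' hxu (hpt v)
      rw [Metric.mem_ball, dist_comm, hls]
      linarith
    · intro v hv hnot
      refine hf.2 _ fun hmem => hnot ?_
      have hlv : level φ (parent^[k] v) = height π φ u := by
        rw [level_iterate hπ, hv, hwu]
        change height π φ u + k - k = _
        ring
      obtain ⟨u', hu', hvu'⟩ := exists_coarse_of_level_le h₀le (hlv.trans_le huh₀)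
      have hpv := hpt v
      rw [hvu'] at hpv hlv
      rw [Metric.mem_ball, dist_comm, hs'] at hmem
      have := hN₂₀ u u' hu hu' huh₀ hlv x hxu _ hpv hmem
      change parent^[k] v ∈ hball φ N₂ (parent^[k] w)
      rw [hvu', hwu]
      exact ⟨hlv, this.trans (by exact_mod_cast hN₂)⟩
    · calc (1 / 2) * pairEnergy (nearPairs φ N (level φ w)) (fun v => f (ψ v))
          ≤ 1 * (E * (ENNReal.ofReal (2 * D) * dirichletEnergy μ f)) := by
            gcongr
            · simp
            · exact (hE f).trans (mul_le_mul_right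
                (pairEnergy_adj_le_dirichletEnergy hD (fun x y h => (hμ_asymp x y h).1) f) _)
        _ ≤ (E + 1) * (ENNReal.ofReal (2 * D) * dirichletEnergy μ f) := by
            rw [one_mul]
            gcongr
            exact le_self_add
        _ = _ := by rw [hQ, mul_assoc]
  have hR := hARL x s hk
  have hsβ : c * s ^ β = c * b ^ β * ((r⁻¹) ^ k) ^ β := by
    rw [hs, Real.mul_rpow hb0.le (by positivity), mul_assoc]
  rw [hsβ, ENNReal.ofReal_mul hcb.le] at hR
  have hR' : ENNReal.ofReal (c * b ^ β) * ENNReal.ofReal (((r⁻¹) ^ k) ^ β) ≤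
      I⁻¹ * vol Γ μ x s := hR
  have hcb' := (ENNReal.ofReal_pos.2 hcb).ne'
  rw [← ENNReal.mul_div_right_comm, ENNReal.le_div_iff_mul_le (Or.inl hcb')
    (Or.inl ENNReal.ofReal_ne_top)]
  calc energy φ 2 k (parent^[k] w) N₁ N₂ N * ENNReal.ofReal (((r⁻¹) ^ k) ^ β) *
        ENNReal.ofReal (c * b ^ β)
      ≤ Q * I * (I⁻¹ * vol Γ μ x s) := by
        rw [mul_assoc, mul_comm (ENNReal.ofReal (((r⁻¹) ^ k) ^ β))]
        gcongr
    _ = Q * ((I * I⁻¹) * vol Γ μ x s) := by ring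
    _ ≤ Q * (1 * vol Γ μ x s) := by
        gcongr
        exact ENNReal.mul_inv_le_one I
    _ = _ := by rw [one_mul]

/-- An admissible function on the level, composed with a choice of a cell around each point, is a
test function for the resistance from `x` to the complement of a ball. BRU then bounds the energy
from below. -/
theorem exists_vol_le_energy_mul [Infinite V] (hπ : IsBiInfiniteTree π) (hconn : Γ.Connected)
    (hK : IsPartition Γ π φ K) (hμ : IsConductance Γ μ)
    (hF : BasicFramework π φ K r) (h₀le : ∀ v ∈ edgeCells π K, h₀ ≤ height π φ v)
    (hμ_asymp : ∃ C : ℝ, 0 < C ∧ ∀ x y, Γ.Adj x y → C⁻¹ ≤ μ x y ∧ μ x y ≤ C)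
    {m : ℝ} (hm0 : 0 < m) (hm : ∀ x, m ≤ vertexWeight Γ μ x)
    (hcard : ∀ h : ℤ, ∃ P : ℕ, ∀ u : RefinedTree π K r, level φ u = h → (K (carrier u)).card ≤ P)
    (hfib : ∀ h : ℤ, ∃ M : ℕ, ∀ x : V,
      {u : RefinedTree π K r | level φ u = h ∧ x ∈ K (carrier u)}.encard ≤ M)
    {β : ℝ} (hBRU : BRU Γ μ β) {w : T} (hw : w ∈ edgeTree π K) (hwh : height π φ w ≤ h₀)
    (N₁ N₂ : ℕ) {N : ℕ} (hN : 1 ≤ N) :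
    ∃ (C : ℝ≥0∞) (x : V) (a : ℝ), C ≠ ⊤ ∧ 0 < a ∧ ∀ᶠ k : ℕ in atTop,
        vol Γ μ x (a * (r⁻¹) ^ k) ≤
          C * (energy φ 2 k (parent^[k] (coarse w hw : RefinedTree π K r)) N₁ N₂ N *
            ENNReal.ofReal (((r⁻¹) ^ k) ^ β)) := by
  classical
  have hr0 := hF.ratio_pos
  have hr1 := hF.ratio_lt_one
  obtain ⟨C, hC, hd⟩ := hF.exists_diamBounds
  obtain ⟨c, hc, hBRU⟩ := hBRU
  obtain ⟨D, hD, hμ_asymp⟩ := hμ_asymp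
  obtain ⟨x, hx⟩ := hK.cell_nonempty hw
  set h := height π φ w with hh
  have hadj : ∀ x y, Γ.Adj x y →
      ∃ e : RefinedTree π K r, level φ e = h ∧ x ∈ cell e ∧ y ∈ cell e := by
    intro x y hxy
    obtain ⟨e, he, heh, hxe, hye⟩ := hK.exists_mem_edgeTree_of_adj hπ hconn h₀le hwh hxy
    exact ⟨coarse e he, heh, hxe, hye⟩
  -- The point `x` is assigned the cell `w` itself, so that the transferred function equals `1` at
  -- `x` for every `k` and `N₁`.
  have hχ' : ∀ y, ∃ e : RefinedTree π K r, (level φ e = h ∧ y ∈ cell e) ∧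
      (y = x → e = coarse w hw) := by
    intro y
    by_cases hyx : y = x
    · exact ⟨coarse w hw, ⟨rfl, hyx ▸ hx⟩, fun _ => rfl⟩
    · obtain ⟨z, hz⟩ := exists_adj hconn y
      obtain ⟨e, he, hy, -⟩ := hadj y z hz
      exact ⟨e, ⟨he, hy⟩, fun h => absurd h hyx⟩
  choose χ hχ hχx using hχ'
  obtain ⟨P, hP⟩ := hcard h
  obtain ⟨M, hM⟩ := hfib h
  obtain ⟨E, hE⟩ := exists_pairEnergy_adj_le hP hM hadj hχ hN
  -- Beyond radius `b ρ^k`, where `ρ = r⁻¹`, points lie in no cell within horizontal distance `N₂`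
  -- of `π^k(w)`, so the transferred function vanishes there.
  set b := ((N₂ + 1) * C + 1) * r ^ h with hb
  have hb0 : 0 < b := by positivity
  have hcb : 0 < c * b ^ β := mul_pos hc (Real.rpow_pos_of_pos hb0 _)
  set Q : ℝ≥0∞ := (E + 1) * ENNReal.ofReal D with hQ
  have hQ0 : Q ≠ 0 := mul_ne_zero (by positivity) (ENNReal.ofReal_pos.2 (by positivity)).ne'
  have hQt : Q ≠ ⊤ := ENNReal.mul_ne_top (by finiteness) ENNReal.ofReal_ne_top
  refine ⟨Q * ENNReal.ofReal (c * b ^ β), x, b, ENNReal.mul_ne_top hQt ENNReal.ofReal_ne_top,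
    hb0, ?_⟩
  have hbig : ∀ᶠ k : ℕ in atTop, Metric.infDist x {x}ᶜ < b * (r⁻¹) ^ k :=
    ((tendsto_inv_pow_atTop hr0 hr1).const_mul_atTop hb0).eventually_gt_atTop _
  filter_upwards [hbig] with k hk
  set u := π^[k] w with hu
  have hut : u ∈ edgeTree π K := iterate_mem_edgeTree hw k
  have hwu : parent^[k] (coarse w hw : RefinedTree π K r) = coarse u hut :=
    parent_iterate_coarse w hw k
  have huh : height π φ u = h - k := height_iterate hπ φ w k
  have hxu : x ∈ K u := hK.cell_subset_iterate w k hx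
  set s := b * (r⁻¹) ^ k with hs
  have hs0 : 0 < s := by positivity
  have hs' : s = ((N₂ + 1) * C + 1) * r ^ height π φ u := by
    rw [hs, hb, mul_assoc, ← zpow_level_sub hr0, huh]
  have hpos : 0 < r ^ height π φ u := zpow_pos hr0 _
  have hlevel : level φ (parent^[k] (coarse w hw : RefinedTree π K r)) + k = h := by
    rw [level_iterate hπ]
    change h - k + k = h
    ring
  set I := ⨅ (f : V → ℝ) (_ : (∀ y ∈ ({x} : Set V), f y = 1) ∧
    ∀ y ∈ (Metric.ball x s)ᶜ, f y = 0), dirichletEnergy μ f with hI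
  have hle : I ≤ Q * energy φ 2 k (parent^[k] (coarse w hw : RefinedTree π K r)) N₁ N₂ N := by
    rw [← ENNReal.div_le_iff' hQ0 hQt, energy_two_eq, hlevel]
    refine le_iInf₂ fun F hF' => ?_
    rw [ENNReal.div_le_iff' hQ0 hQt]
    refine (iInf₂_le (fun y => F (χ y)) ⟨?_, ?_⟩).trans ?_
    rotate_left
    · rintro y rfl
      refine hF'.1 _ ?_
      rw [hχx y rfl]
      exact ⟨rfl, by simp⟩
    · intro y hy
      refine hF'.2 _ ((hχ y).1.trans hlevel.symm) fun hmem => hy ?_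
      have h1 : (horizontal φ).edist (coarse u hut) (parent^[k] (χ y)) ≤ N₂ := by
        rw [← hwu]; exact hmem.2
      have := dist_le_of_horizontal_edist_le hd h₀le hut (by omega) h1 hxu
        (hK.carrier_subset_iterate (χ y) k (cell_subset_carrier _ (hχ y).2))
      rw [Metric.mem_ball, dist_comm, hs']
      linarith
    · calc dirichletEnergy μ (fun y => F (χ y))
          ≤ ENNReal.ofReal D * ((1 / 2) * (E * pairEnergy (nearPairs φ N h) F)) :=
            (dirichletEnergy_le_pairEnergy_adj hμ (fun x y h => (hμ_asymp x y h).2) _).trans (by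
              gcongr
              exact hE F)
        _ ≤ ENNReal.ofReal D * ((1 / 2) * ((E + 1) * pairEnergy (nearPairs φ N h) F)) := by
            gcongr
            exact le_self_add
        _ = _ := by rw [hQ]; ring
  have hR : I⁻¹ * vol Γ μ x s ≤ ENNReal.ofReal (c * s ^ β) := hBRU x s hk
  have hcs : 0 < c * s ^ β := mul_pos hc (Real.rpow_pos_of_pos hs0 _)
  -- For `I = 0` the resistance would be infinite, against BRU and the positivity of the volume; for
  -- `I = ⊤` nothing is to be shown.
  have hvI : vol Γ μ x s ≤ I * ENNReal.ofReal (c * s ^ β) := by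
    by_cases hI0 : I = 0
    · rw [hI0, ENNReal.inv_zero, ENNReal.top_mul (vol_pos hm0 hm hs0).2, top_le_iff] at hR
      exact absurd hR ENNReal.ofReal_ne_top
    by_cases hIt : I = ⊤
    · rw [hIt, ENNReal.top_mul (ENNReal.ofReal_pos.2 hcs).ne']
      exact le_top
    · calc vol Γ μ x s = I * (I⁻¹ * vol Γ μ x s) := by
            rw [← mul_assoc, ENNReal.mul_inv_cancel hI0 hIt, one_mul]
        _ ≤ _ := by gcongr
  have hsβ : c * s ^ β = c * b ^ β * ((r⁻¹) ^ k) ^ β := by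
    rw [hs, Real.mul_rpow hb0.le (by positivity), mul_assoc]
  rw [hsβ, ENNReal.ofReal_mul hcb.le] at hvI
  calc vol Γ μ x s ≤ _ := hvI
    _ ≤ (Q * energy φ 2 k (parent^[k] (coarse w hw : RefinedTree π K r)) N₁ N₂ N) *
        (ENNReal.ofReal (c * b ^ β) * ENNReal.ofReal (((r⁻¹) ^ k) ^ β)) := by gcongr
    _ = _ := by ring

end Rates

end GraphPartition

end

noncomputable section

namespace GraphPartition

/-! ### Upper and lower limits -/

section Limits

/-- Write `u = (u - v) + v`. The first summand has equal and finite lower and upper limits, so the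
two inequalities for the lower limit of a sum close up. -/
theorem liminf_eq_add_of_tendsto_sub {u v : ℕ → ℝ} {c : ℝ}
    (h : Tendsto (fun n => u n - v n) atTop (𝓝 c)) :
    liminf (fun n => (u n : EReal)) atTop = c + liminf (fun n => (v n : EReal)) atTop := by
  have hE : Tendsto (fun n => ((u n - v n : ℝ) : EReal)) atTop (𝓝 (c : EReal)) :=
    (continuous_coe_real_ereal.tendsto _).comp h
  have e : (fun n => (u n : EReal)) =
      (fun n => ((u n - v n : ℝ) : EReal)) + fun n => (v n : EReal) := by
    funext n
    simp only [Pi.add_apply, ← EReal.coe_add, sub_add_cancel]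
  rw [e]
  apply le_antisymm
  · refine (EReal.liminf_add_le ?_ ?_).trans_eq (by rw [hE.limsup_eq])
    · exact Or.inl (by rw [hE.limsup_eq]; exact EReal.coe_ne_bot _)
    · exact Or.inl (by rw [hE.limsup_eq]; exact EReal.coe_ne_top _)
  · exact le_trans (by rw [hE.liminf_eq]) EReal.le_liminf_add

theorem limsup_eq_add_of_tendsto_sub {u v : ℕ → ℝ} {c : ℝ}
    (h : Tendsto (fun n => u n - v n) atTop (𝓝 c)) :
    limsup (fun n => (u n : EReal)) atTop = c + limsup (fun n => (v n : EReal)) atTop := by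
  have h' : Tendsto (fun n => -u n - -v n) atTop (𝓝 (-c)) := by
    refine h.neg.congr fun n => ?_
    ring
  have := liminf_eq_add_of_tendsto_sub h'
  simp only [EReal.coe_neg] at this
  have e : ∀ w : ℕ → ℝ, liminf (fun n => -(w n : EReal)) atTop =
      -limsup (fun n => (w n : EReal)) atTop := fun w => EReal.liminf_neg
  rw [e, e] at this
  have h2 := congrArg Neg.neg this
  rwa [neg_neg, EReal.neg_add (Or.inl (by simp [← EReal.coe_neg]))
    (Or.inl (by simp [← EReal.coe_neg])), neg_neg, sub_eq_add_neg, neg_neg] at h2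

/-- The extended exponential is monotone and continuous, hence commutes with lower and upper limits;
growth rates become lower and upper limits of logarithms. -/
theorem liminf_exp (u : ℕ → EReal) :
    liminf (fun n => EReal.exp (u n)) atTop = EReal.exp (liminf u atTop) :=
  (EReal.exp_monotone.map_liminf_of_continuousAt u ENNReal.continuous_exp.continuousAt).symm

theorem limsup_exp (u : ℕ → EReal) :
    limsup (fun n => EReal.exp (u n)) atTop = EReal.exp (limsup u atTop) :=
  (EReal.exp_monotone.map_limsup_of_continuousAt u ENNReal.continuous_exp.continuousAt).symm

theorem exists_le_ofReal_exp {C : ℝ≥0∞} (hC : C ≠ ⊤) :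
    ∃ b : ℝ, 0 ≤ b ∧ C ≤ ENNReal.ofReal (Real.exp b) := by
  refine ⟨C.toReal, ENNReal.toReal_nonneg, ?_⟩
  rw [ENNReal.le_ofReal_iff_toReal_le hC (Real.exp_pos _).le]
  linarith [Real.add_one_le_exp C.toReal]

theorem ofReal_exp_rpow (b : ℝ) (k : ℕ) :
    ENNReal.ofReal (Real.exp b) ^ (1 / (k : ℝ)) = EReal.exp ((b / k : ℝ) : EReal) := by
  rw [ENNReal.ofReal_rpow_of_pos (Real.exp_pos _), ← Real.exp_mul, EReal.exp_coe, mul_one_div]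

/-- The growth rate of a sequence bounded by a multiple of `exp (y k)`. -/
theorem rate_le {X : ℕ → ℝ≥0∞} {y a : ℕ → ℝ} {c : ℝ} {C : ℝ≥0∞} (hC : C ≠ ⊤)
    (hX : ∀ᶠ k in atTop, X k ≤ C * ENNReal.ofReal (Real.exp (y k)))
    (hy : Tendsto (fun k => y k / k - a k) atTop (𝓝 c)) :
    liminf (fun k : ℕ => X k ^ (1 / (k : ℝ))) atTop ≤
        EReal.exp (c + liminf (fun k => (a k : EReal)) atTop) ∧
      limsup (fun k : ℕ => X k ^ (1 / (k : ℝ))) atTop ≤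
        EReal.exp (c + limsup (fun k => (a k : EReal)) atTop) := by
  obtain ⟨b, -, hb⟩ := exists_le_ofReal_exp hC
  have h0 : Tendsto (fun k : ℕ => (b + y k) / k - a k) atTop (𝓝 c) := by
    have h1 := (tendsto_const_div_atTop_nhds_zero_nat b).add hy
    rw [zero_add] at h1
    refine h1.congr fun k => ?_
    rw [add_div]; ring
  have hle : ∀ᶠ k : ℕ in atTop,
      X k ^ (1 / (k : ℝ)) ≤ EReal.exp (((b + y k) / k : ℝ) : EReal) := by
    filter_upwards [hX] with k hk
    rw [← ofReal_exp_rpow, Real.exp_add, ENNReal.ofReal_mul (Real.exp_pos _).le]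
    refine ENNReal.rpow_le_rpow (hk.trans ?_) (by positivity)
    gcongr
  rw [← liminf_eq_add_of_tendsto_sub h0, ← limsup_eq_add_of_tendsto_sub h0, ← liminf_exp,
    ← limsup_exp]
  exact ⟨liminf_le_liminf hle, limsup_le_limsup hle⟩

theorem le_rate {X : ℕ → ℝ≥0∞} {y a : ℕ → ℝ} {c : ℝ} {C : ℝ≥0∞} (hC : C ≠ ⊤)
    (hX : ∀ᶠ k in atTop, ENNReal.ofReal (Real.exp (y k)) ≤ C * X k)
    (hy : Tendsto (fun k => y k / k - a k) atTop (𝓝 c)) :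
    EReal.exp (c + liminf (fun k => (a k : EReal)) atTop) ≤
        liminf (fun k : ℕ => X k ^ (1 / (k : ℝ))) atTop ∧
      EReal.exp (c + limsup (fun k => (a k : EReal)) atTop) ≤
        limsup (fun k : ℕ => X k ^ (1 / (k : ℝ))) atTop := by
  obtain ⟨b, -, hb⟩ := exists_le_ofReal_exp hC
  have h0 : Tendsto (fun k : ℕ => (y k - b) / k - a k) atTop (𝓝 c) := by
    have h1 := hy.sub (tendsto_const_div_atTop_nhds_zero_nat b)
    rw [sub_zero] at h1
    refine h1.congr fun k => ?_
    rw [sub_div]; ring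
  have hle : ∀ᶠ k : ℕ in atTop,
      EReal.exp (((y k - b) / k : ℝ) : EReal) ≤ X k ^ (1 / (k : ℝ)) := by
    filter_upwards [hX] with k hk
    rw [← ofReal_exp_rpow, Real.exp_sub, ENNReal.ofReal_div_of_pos (Real.exp_pos _)]
    refine ENNReal.rpow_le_rpow ?_ (by positivity)
    refine ENNReal.div_le_of_le_mul' (hk.trans ?_)
    gcongr
  rw [← liminf_eq_add_of_tendsto_sub h0, ← limsup_eq_add_of_tendsto_sub h0, ← liminf_exp,
    ← limsup_exp]
  exact ⟨liminf_le_liminf hle, limsup_le_limsup hle⟩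

theorem liminf_const_mul {c : ℝ} (hc : 0 ≤ c) (a : ℕ → ℝ) :
    liminf (fun k => ((c * a k : ℝ) : EReal)) atTop =
      c * liminf (fun k => (a k : EReal)) atTop := by
  simp only [EReal.coe_mul]
  exact EReal.liminf_const_mul_of_nonneg_of_ne_top (EReal.coe_nonneg.2 hc) (EReal.coe_ne_top _)

theorem limsup_const_mul {c : ℝ} (hc : 0 ≤ c) (a : ℕ → ℝ) :
    limsup (fun k => ((c * a k : ℝ) : EReal)) atTop =
      c * limsup (fun k => (a k : EReal)) atTop := by
  simp only [EReal.coe_mul]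
  exact EReal.limsup_const_mul_of_nonneg_of_ne_top (EReal.coe_nonneg.2 hc) (EReal.coe_ne_top _)

/-- The map is monotone and takes every large value, so lower and upper limits over `k` agree with
those over `n` along `k = ⌊log n / c⌋`. -/
theorem map_floor_log_div_atTop {c : ℝ} (hc : 0 < c) :
    map (fun n : ℕ => ⌊Real.log n / c⌋₊) atTop = atTop := by
  -- The largest `n` mapped to at most `b` is `⌈exp(c(b+1))⌉ - 1`. It is mapped to at least `b` once
  -- `exp(c(b+1)) - 1 ≥ exp(cb)`, for which `c² b ≥ 1` suffices.
  obtain ⟨b', hb'⟩ := exists_nat_gt (1 / (c * c))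
  have hceil : ∀ b : ℕ, 0 < ⌈Real.exp (c * (b + 1))⌉₊ := fun b => Nat.ceil_pos.2 (Real.exp_pos _)
  refine map_atTop_eq_of_gc (fun b : ℕ => ⌈Real.exp (c * (b + 1))⌉₊ - 1) b' ?_ ?_ ?_
  · intro n n' h
    refine Nat.floor_mono (div_le_div_of_nonneg_right ?_ hc.le)
    rcases Nat.eq_zero_or_pos n with rfl | hn
    · simpa using Real.log_natCast_nonneg n'
    · exact Real.log_le_log (by exact_mod_cast hn) (by exact_mod_cast h)
  · intro n b _
    have h1 : ⌊Real.log n / c⌋₊ ≤ b ↔ Real.log n < c * (b + 1) := by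
      rw [← Nat.lt_add_one_iff, Nat.floor_lt (div_nonneg (Real.log_natCast_nonneg _) hc.le),
        div_lt_iff₀ hc, mul_comm]
      push_cast
      rfl
    rw [h1]
    rcases Nat.eq_zero_or_pos n with rfl | hn
    · simp only [Nat.cast_zero, Real.log_zero, Nat.zero_le, iff_true]
      positivity
    · rw [Real.log_lt_iff_lt_exp (by exact_mod_cast hn), ← Nat.lt_ceil]
      have := hceil b
      omega
  · intro b hb
    have hg : Real.exp (c * b) ≤ ((⌈Real.exp (c * (b + 1))⌉₊ - 1 : ℕ) : ℝ) := by
      rw [Nat.cast_sub (hceil b), Nat.cast_one]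
      have h1 := Nat.le_ceil (Real.exp (c * (b + 1)))
      have h2 : Real.exp (c * (b + 1)) = Real.exp (c * b) * Real.exp c := by
        rw [← Real.exp_add]; ring_nf
      have h3 := Real.add_one_le_exp c
      have h4 := Real.add_one_le_exp (c * b)
      have h5 : 1 ≤ c * (c * b) := by
        have h6 : (b' : ℝ) ≤ b := by exact_mod_cast hb
        have h7 := hb'.trans_le h6
        rw [div_lt_iff₀ (by positivity)] at h7
        linarith
      have h8 : Real.exp (c * b) * (c + 1) ≤ Real.exp (c * b) * Real.exp c := by gcongr
      have h9 : c * (c * b) ≤ c * Real.exp (c * b) := by gcongr; linarith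
      linarith
    have hg0 : (0 : ℝ) < ((⌈Real.exp (c * (b + 1))⌉₊ - 1 : ℕ) : ℝ) := (Real.exp_pos _).trans_le hg
    refine Nat.le_floor ?_
    rw [le_div_iff₀ hc, mul_comm, Real.le_log_iff_exp_le hg0]
    exact hg

/-- With `k = ⌊log n / c⌋` one has `ρ^k ≤ n^(1/β) < ρ^(k+1)`, so by monotonicity and doubling `σ n *
log n` is within `D + B` of `G (ρ^k)`. Replacing `log n` by `c k` in the denominator costs at most
`A / log n`, as `G (ρ^k)` grows at most linearly in `k`. -/
theorem tendsto_sub_growth {G : ℝ → ℝ} {σ : ℕ → ℝ} {ρ β A B D : ℝ} (hρ : 1 < ρ) (hβ : 0 < β)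
    (hG : MonotoneOn G (Set.Ioi 0)) (hB : ∀ s, 0 < s → G (ρ * s) ≤ G s + B)
    (hA : ∀ᶠ k : ℕ in atTop, |G (ρ ^ k)| ≤ A * k)
    (hσ : ∀ᶠ n : ℕ in atTop, |σ n * Real.log n - G ((n : ℝ) ^ (1 / β))| ≤ D) :
    Tendsto (fun n : ℕ => σ n - (β * Real.log ρ)⁻¹ *
      (G (ρ ^ ⌊Real.log n / (β * Real.log ρ)⌋₊) / ⌊Real.log n / (β * Real.log ρ)⌋₊))
      atTop (𝓝 0) := by
  have hlρ := Real.log_pos hρ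
  set c := β * Real.log ρ with hc
  have hc0 : 0 < c := by positivity
  have hlog : Tendsto (fun n : ℕ => Real.log n) atTop atTop :=
    Real.tendsto_log_atTop.comp tendsto_natCast_atTop_atTop
  have hk : Tendsto (fun n : ℕ => ⌊Real.log n / c⌋₊) atTop atTop :=
    (map_floor_log_div_atTop hc0).le
  refine squeeze_zero_norm' (a := fun n : ℕ => (D + B + A) / Real.log n) ?_
    (hlog.const_div_atTop _)
  filter_upwards [hk.eventually hA, hσ, hlog.eventually_gt_atTop 0,
    hk.eventually_ge_atTop 1, eventually_ge_atTop 1] with n h1 h2 hl hk1 hn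
  set k := ⌊Real.log n / c⌋₊ with hkdef
  set l := Real.log n with hldef
  have hk0 : (0 : ℝ) < k := by exact_mod_cast hk1
  have hn0 : (0 : ℝ) < n := by exact_mod_cast hn
  have hkl : c * k ≤ l := by
    have := Nat.floor_le (div_nonneg hl.le hc0.le)
    rwa [le_div_iff₀ hc0, mul_comm] at this
  have hlk : l < c * k + c := by
    have := Nat.lt_floor_add_one (l / c)
    rw [div_lt_iff₀ hc0] at this
    linarith
  have hnβ : (n : ℝ) ^ (1 / β) = Real.exp (l / β) := by
    rw [Real.rpow_def_of_pos hn0, mul_one_div]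
  have hρk : ρ ^ k = Real.exp (k * Real.log ρ) := by
    rw [mul_comm, Real.exp_mul, Real.exp_log (by linarith), Real.rpow_natCast]
  have hρ0 : 0 < ρ := by linarith
  have h3 : G (ρ ^ k) ≤ G ((n : ℝ) ^ (1 / β)) := by
    refine hG (Set.mem_Ioi.2 (by positivity)) (Set.mem_Ioi.2 (by positivity)) ?_
    rw [hnβ, hρk, Real.exp_le_exp, le_div_iff₀ hβ]
    linarith
  have h4 : G ((n : ℝ) ^ (1 / β)) ≤ G (ρ ^ k) + B := by
    refine le_trans (hG (Set.mem_Ioi.2 (by positivity)) (Set.mem_Ioi.2 (by positivity)) ?_)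
      (hB _ (by positivity))
    have : ρ * ρ ^ k = Real.exp ((k + 1) * Real.log ρ) := by
      rw [add_mul, one_mul, Real.exp_add, ← hρk, Real.exp_log hρ0, mul_comm]
    rw [hnβ, this, Real.exp_le_exp, div_le_iff₀ hβ]
    linarith
  have h5 : |σ n * l - G (ρ ^ k)| ≤ D + B := by
    rw [abs_le] at h2 ⊢
    constructor <;> linarith [h2.1, h2.2]
  have h6 : |G (ρ ^ k) * (c * k - l)| ≤ A * k * c := by
    rw [abs_mul]
    refine mul_le_mul h1 ?_ (abs_nonneg _) ((abs_nonneg _).trans h1)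
    rw [abs_le]
    constructor <;> linarith
  have e : σ n - c⁻¹ * (G (ρ ^ k) / k) =
      (σ n * l - G (ρ ^ k)) / l + G (ρ ^ k) * (c * k - l) / (l * (c * k)) := by
    field_simp
    ring
  rw [Real.norm_eq_abs, e]
  refine (abs_add_le _ _).trans ?_
  rw [abs_div, abs_div, abs_of_pos hl, abs_of_pos (show 0 < l * (c * k) by positivity), add_div]
  refine add_le_add (by gcongr) ?_
  rw [div_le_div_iff₀ (by positivity) hl]
  calc |G (ρ ^ k) * (c * k - l)| * l ≤ A * k * c * l := by gcongr
    _ = A * (l * (c * k)) := by ring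

theorem liminf_limsup_eq_growth {G : ℝ → ℝ} {σ : ℕ → ℝ} {ρ β A B D : ℝ} (hρ : 1 < ρ) (hβ : 0 < β)
    (hG : MonotoneOn G (Set.Ioi 0)) (hB : ∀ s, 0 < s → G (ρ * s) ≤ G s + B)
    (hA : ∀ᶠ k : ℕ in atTop, |G (ρ ^ k)| ≤ A * k)
    (hσ : ∀ᶠ n : ℕ in atTop, |σ n * Real.log n - G ((n : ℝ) ^ (1 / β))| ≤ D) :
    liminf (fun n => (σ n : EReal)) atTop = ((β * Real.log ρ)⁻¹ : ℝ) *
        liminf (fun k : ℕ => ((G (ρ ^ k) / k : ℝ) : EReal)) atTop ∧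
      limsup (fun n => (σ n : EReal)) atTop = ((β * Real.log ρ)⁻¹ : ℝ) *
        limsup (fun k : ℕ => ((G (ρ ^ k) / k : ℝ) : EReal)) atTop := by
  have hlρ := Real.log_pos hρ
  have hc0 : 0 < β * Real.log ρ := by positivity
  have h := tendsto_sub_growth hρ hβ hG hB hA hσ
  rw [liminf_eq_add_of_tendsto_sub h, limsup_eq_add_of_tendsto_sub h, EReal.coe_zero, zero_add,
    zero_add, ← liminf_const_mul (inv_pos.2 hc0).le, ← limsup_const_mul (inv_pos.2 hc0).le]
  have hmap := map_floor_log_div_atTop hc0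
  constructor
  · conv_rhs => rw [← hmap]
    rfl
  · conv_rhs => rw [← hmap]
    rfl

end Limits

end GraphPartition

end

noncomputable section

namespace GraphPartition

open RefinedTree

/-! ### The logarithm of the volume and the return probabilities -/

section LogVol

theorem exists_liminf_limsup_coe {a : ℕ → ℝ} {A : ℝ} (h : ∀ᶠ k in atTop, |a k| ≤ A) :
    ∃ l L : ℝ, liminf (fun k => (a k : EReal)) atTop = l ∧
      limsup (fun k => (a k : EReal)) atTop = L := by
  have h1 : ((-A : ℝ) : EReal) ≤ liminf (fun k => (a k : EReal)) atTop := by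
    refine le_liminf_of_le (by isBoundedDefault) ?_
    filter_upwards [h] with k hk
    exact EReal.coe_le_coe_iff.2 (abs_le.1 hk).1
  have h2 : limsup (fun k => (a k : EReal)) atTop ≤ (A : EReal) := by
    refine limsup_le_of_le (by isBoundedDefault) ?_
    filter_upwards [h] with k hk
    exact EReal.coe_le_coe_iff.2 (abs_le.1 hk).2
  have h3 : liminf (fun k => (a k : EReal)) atTop ≤ limsup (fun k => (a k : EReal)) atTop :=
    liminf_le_limsup
  exact ⟨_, _, (EReal.coe_toReal (ne_top_of_le_ne_top (EReal.coe_ne_top _) (h3.trans h2))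
      (ne_bot_of_le_ne_bot (EReal.coe_ne_bot _) h1)).symm,
    (EReal.coe_toReal (ne_top_of_le_ne_top (EReal.coe_ne_top _) h2)
      (ne_bot_of_le_ne_bot (EReal.coe_ne_bot _) (h1.trans h3))).symm⟩

variable {V : Type*} [MetricSpace V] {Γ : SimpleGraph V} [Γ.LocallyFinite] {μ : V → V → ℝ}

variable (Γ μ) in
/-- The logarithm of the volume of a ball. -/
def logVol (x : V) (s : ℝ) : ℝ := Real.log (vol Γ μ x s).toReal

theorem ofReal_exp_logVol {x : V} {s : ℝ} (h0 : vol Γ μ x s ≠ 0) (ht : vol Γ μ x s ≠ ⊤) :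
    ENNReal.ofReal (Real.exp (logVol Γ μ x s)) = vol Γ μ x s := by
  rw [logVol, Real.exp_log (ENNReal.toReal_pos h0 ht), ENNReal.ofReal_toReal ht]

theorem logVol_le {x y : V} {s t b : ℝ} (h0 : vol Γ μ x s ≠ 0) (h0' : vol Γ μ y t ≠ 0)
    (ht : vol Γ μ x s ≠ ⊤) (ht' : vol Γ μ y t ≠ ⊤)
    (h : vol Γ μ x s ≤ ENNReal.ofReal (Real.exp b) * vol Γ μ y t) :
    logVol Γ μ x s ≤ b + logVol Γ μ y t := by
  rw [← ofReal_exp_logVol h0 ht, ← ofReal_exp_logVol h0' ht', ← ENNReal.ofReal_mul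
    (Real.exp_pos _).le, ← Real.exp_add, ENNReal.ofReal_le_ofReal_iff (Real.exp_pos _).le,
    Real.exp_le_exp] at h
  exact h

variable {α β : ℝ}

theorem VG.exists_abs_logVol_sub_le (hVG : VG Γ μ α) (hfin : ∀ x s, vol Γ μ x s ≠ ⊤)
    (hpos : ∀ x s, 0 < s → vol Γ μ x s ≠ 0) (x y : V) :
    ∃ B : ℝ, ∀ᶠ s in atTop, |logVol Γ μ x s - logVol Γ μ y s| ≤ B := by
  obtain ⟨C, hC, h⟩ := hVG.eventually_vol_le one_pos one_pos x y
  obtain ⟨C', hC', h'⟩ := hVG.eventually_vol_le one_pos one_pos y x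
  obtain ⟨b, hb, hCb⟩ := exists_le_ofReal_exp hC
  obtain ⟨b', hb', hCb'⟩ := exists_le_ofReal_exp hC'
  refine ⟨b + b', ?_⟩
  filter_upwards [h, h', eventually_gt_atTop 0] with s h1 h2 hs
  rw [one_mul] at h1 h2
  have h3 := logVol_le (hpos x s hs) (hpos y s hs) (hfin _ _) (hfin _ _)
    (h1.trans (mul_le_mul_left hCb _))
  have h4 := logVol_le (hpos y s hs) (hpos x s hs) (hfin _ _) (hfin _ _)
    (h2.trans (mul_le_mul_left hCb' _))
  rw [abs_le]
  constructor <;> linarith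

/-- Take logarithms in DHK; the vertex weight and the constant are bounded terms, and volume growth
allows the volume to be centred at a fixed `y` instead of `x`. -/
theorem DHK.exists_abs_log_transition_le (hDHK : DHK Γ μ β) (hβ : 0 < β) (hVG : VG Γ μ α)
    (hfin : ∀ x s, vol Γ μ x s ≠ ⊤) (hpos : ∀ x s, 0 < s → vol Γ μ x s ≠ 0)
    (hw : ∀ x, 0 < vertexWeight Γ μ x) (x y : V) :
    ∃ D : ℝ, ∀ᶠ n : ℕ in atTop, |-Real.log (transition Γ μ (2 * n) x x) / Real.log n * Real.log n -
      logVol Γ μ y ((n : ℝ) ^ (1 / β))| ≤ D := by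
  obtain ⟨C, hC, h⟩ := hDHK
  obtain ⟨B, hB⟩ := hVG.exists_abs_logVol_sub_le hfin hpos x y
  have htend : Tendsto (fun n : ℕ => (n : ℝ) ^ (1 / β)) atTop atTop :=
    (tendsto_rpow_atTop (one_div_pos.2 hβ)).comp tendsto_natCast_atTop_atTop
  refine ⟨|Real.log (vertexWeight Γ μ x)| + |Real.log C| + B, ?_⟩
  -- From `n = 2` on, `log n` is nonzero and cancels.
  filter_upwards [htend.eventually hB, eventually_ge_atTop 2] with n hn hn2
  have hn0 : (1 : ℝ) < n := by exact_mod_cast hn2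
  rw [div_mul_cancel₀ _ (Real.log_pos hn0).ne']
  set s := (n : ℝ) ^ (1 / β) with hs
  have hs0 : 0 < s := Real.rpow_pos_of_pos (by linarith) _
  obtain ⟨h1, h2⟩ := h x n (by omega)
  set v := (vol Γ μ x s).toReal with hv
  have hv0 : 0 < v := ENNReal.toReal_pos (hpos x s hs0) (hfin x s)
  have hve : vol Γ μ x s = ENNReal.ofReal v := (ENNReal.ofReal_toReal (hfin x s)).symm
  rw [hve, ← ENNReal.ofReal_div_of_pos hv0, ENNReal.ofReal_le_ofReal_iff'] at h1 h2
  have h1' : C⁻¹ / v ≤ heatKernel Γ μ (2 * n) x x :=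
    h1.resolve_right (not_le.2 (by positivity))
  have hh0 : 0 < heatKernel Γ μ (2 * n) x x := lt_of_lt_of_le (by positivity) h1'
  have h2' : heatKernel Γ μ (2 * n) x x ≤ C / v := h2.resolve_right (not_le.2 hh0)
  have hp : transition Γ μ (2 * n) x x = heatKernel Γ μ (2 * n) x x * vertexWeight Γ μ x := by
    rw [heatKernel, div_mul_cancel₀ _ (hw x).ne']
  have h3 := Real.log_le_log (by positivity) h1'
  have h4 := Real.log_le_log hh0 h2'
  rw [Real.log_div (by positivity) hv0.ne', Real.log_inv] at h3
  rw [Real.log_div hC.ne' hv0.ne'] at h4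
  rw [hp, Real.log_mul hh0.ne' (hw x).ne']
  have h5 : logVol Γ μ x s = Real.log v := rfl
  rw [h5] at hn
  have h6 := abs_le.1 hn
  have h7 := le_abs_self (Real.log C)
  have h8 := abs_le.1 (le_refl |Real.log (vertexWeight Γ μ x)|)
  rw [abs_le]
  constructor <;> linarith [h6.1, h6.2, h8.1, h8.2]

end LogVol

end GraphPartition

end

/-! ### The main theorem: all rates in terms of the volume growth -/

open GraphPartition
theorem mainTheorem3 {V T : Type*} [Countable V] [Infinite V] [Countable T] [MetricSpace V]
    (Γ : SimpleGraph V) [Γ.LocallyFinite] (hconn : Γ.Connected)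
    (hdeg : ∃ D : ℕ, ∀ x, Γ.degree x ≤ D)
    (π : T → T) (φ : T) (htree : IsBiInfiniteTree π)
    (K : T → Finset V) (hK : IsPartition Γ π φ K)
    (hmin : IsMinimal π K) (hKconn : IsConnectedPartition Γ π K)
    (μ : V → V → ℝ) (hμ : IsConductance Γ μ)
    (hμ_asymp : ∃ C : ℝ, 0 < C ∧ ∀ x y, Γ.Adj x y → C⁻¹ ≤ μ x y ∧ μ x y ≤ C)
    (hunbdd : ¬ Bornology.IsBounded (Set.univ : Set V))
    (hfit : IsFitting Γ)
    (r : ℝ) (hframe : BasicFramework π φ K r)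
    (hedge : ∃ C : ℝ, 0 < C ∧ ∀ x y, Γ.Adj x y → C⁻¹ ≤ dist x y ∧ dist x y ≤ C)
    (α β : ℝ) (hα : 1 ≤ α) (hαβ : α < β)
    (hDHK : DHK Γ μ β) (hARL : ARL Γ μ β) (hBRU : BRU Γ μ β) (hVG : VG Γ μ α) :
    ∀ N₁ : ℕ, ∃ N₂₀ : ℕ, ∀ N₂ : ℕ, N₂₀ ≤ N₂ → ∀ N : ℕ, 1 ≤ N →
      ∃ Nlow Nup R : ℝ, 0 < Nlow ∧ 0 < Nup ∧ 0 < R ∧ 0 < Real.log Nlow - Real.log R ∧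
        lowerGrowth π K r = ENNReal.ofReal Nlow ∧
        upperGrowth π K r = ENNReal.ofReal Nup ∧
        lowerEnergyRate π φ K r 2 N₁ N₂ N = ENNReal.ofReal R ∧
        ∀ x : V,
          lowerSpectralDim Γ μ x =
            ((2 * (Real.log Nlow / (Real.log Nlow - Real.log R)) : ℝ) : EReal) ∧
          upperSpectralDim Γ μ x =
            ((2 * (Real.log Nup / (Real.log Nlow - Real.log R)) : ℝ) : EReal) := by
  have hr0 := hframe.ratio_pos
  have hr1 := hframe.ratio_lt_one
  have hβ : 0 < β := by linarith
  obtain ⟨m, M, hm0, -, hmM⟩ := exists_vertexWeight_bounds hconn hdeg hμ hμ_asymp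
  have hm : ∀ x, m ≤ vertexWeight Γ μ x := fun x => (hmM x).1
  have hM : ∀ x, vertexWeight Γ μ x ≤ M := fun x => (hmM x).2
  have hball := exists_encard_ball_le hVG hconn hfit hedge hm0 hm hM
  have hfin : ∀ x s, vol Γ μ x s ≠ ⊤ := by
    intro x s
    obtain ⟨C, hC, h⟩ := exists_vol_le hVG hconn hfit hedge hM s
    exact ne_top_of_le_ne_top hC (h x)
  have hpos : ∀ x s, 0 < s → vol Γ μ x s ≠ 0 := fun x s hs => (vol_pos hm0 hm hs).2
  obtain ⟨C, hC, hd⟩ := hframe.exists_diamBounds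
  obtain ⟨h₀, h₀le⟩ := exists_le_height_of_edgeCells hr0 hr1 hC hd hKconn hedge
  have hcard := exists_card_carrier_le hframe hK hball
  have hfib := exists_encard_carrier_fiber_le htree hK hframe hmin hKconn hdeg h₀le
  obtain ⟨x₀⟩ : Nonempty V := inferInstance
  -- A vertex of low height, at which the lower bounds for counts and energies hold; it attains the
  -- suprema.
  obtain ⟨w₀, hw₀, hw₀h⟩ : ∃ w ∈ edgeTree π K, height π φ w = h₀ := by
    obtain ⟨y, hy⟩ := exists_adj hconn x₀
    obtain ⟨w, hw, hwh, -⟩ := hK.exists_mem_edgeTree_of_adj htree hconn h₀le le_rfl hy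
    exact ⟨w, hw, hwh⟩
  set ρ := r⁻¹ with hρdef
  have hρ : 1 < ρ := (one_lt_inv₀ hr0).2 hr1
  have hρ0 : 0 < ρ := by linarith
  have hρt : Tendsto (fun k : ℕ => ρ ^ k) atTop atTop := tendsto_inv_pow_atTop hr0 hr1
  set c := β * Real.log ρ with hc
  have hc0 : 0 < c := mul_pos hβ (Real.log_pos hρ)
  set G := logVol Γ μ x₀ with hG
  have hGe : ∀ k : ℕ, ENNReal.ofReal (Real.exp (G (ρ ^ k))) = vol Γ μ x₀ (ρ ^ k) := fun k =>
    ofReal_exp_logVol (hpos _ _ (by positivity)) (hfin _ _)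
  have hGm : MonotoneOn G (Set.Ioi 0) := by
    intro s hs t ht hst
    exact Real.log_le_log (ENNReal.toReal_pos (hpos _ _ hs) (hfin _ _))
      (ENNReal.toReal_mono (hfin _ _) (vol_mono (Metric.ball_subset_ball hst)))
  obtain ⟨B, hB0, hB⟩ : ∃ B : ℝ, 0 ≤ B ∧ ∀ s, 0 < s → G (ρ * s) ≤ G s + B := by
    obtain ⟨D, hD, h⟩ := hVG.exists_vol_mul_le hρ0
    obtain ⟨b, hb, hDb⟩ := exists_le_ofReal_exp hD
    refine ⟨b, hb, fun s hs => ?_⟩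
    rw [add_comm]
    exact logVol_le (hpos _ _ (by positivity)) (hpos _ _ hs) (hfin _ _) (hfin _ _)
      ((h x₀ s hs).trans (mul_le_mul_left hDb _))
  -- The volume is at least `m` and each factor `ρ` in the radius adds at most `B` to its logarithm,
  -- so `G (ρ^k)` grows at most linearly.
  set A := |Real.log m| + |G 1| + B with hA
  have hGA : ∀ᶠ k : ℕ in atTop, |G (ρ ^ k)| ≤ A * k := by
    have h1 : ∀ k : ℕ, G (ρ ^ k) ≤ G 1 + k * B := by
      intro k
      induction k with
      | zero => simp
      | succ k ih =>
        have := hB (ρ ^ k) (by positivity)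
        rw [pow_succ']
        push_cast
        linarith
    have h2 : ∀ k : ℕ, Real.log m ≤ G (ρ ^ k) := by
      intro k
      refine Real.log_le_log hm0 ?_
      rw [← ENNReal.ofReal_le_iff_le_toReal (hfin _ _)]
      exact (vol_pos hm0 hm (by positivity)).1
    filter_upwards [eventually_ge_atTop 1] with k hk
    have hk1 : (1 : ℝ) ≤ k := by exact_mod_cast hk
    have h3 : |Real.log m| + |G 1| ≤ (|Real.log m| + |G 1|) * k :=
      le_mul_of_one_le_right (by positivity) hk1
    have h4 : 0 ≤ k * B := by positivity
    have h5 := le_abs_self (G 1)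
    have h6 := neg_abs_le (Real.log m)
    have h7 := abs_nonneg (Real.log m)
    have h8 := abs_nonneg (G 1)
    rw [abs_le, hA, add_mul]
    constructor <;> linarith [h1 k, h2 k]
  set a : ℕ → ℝ := fun k => G (ρ ^ k) / k with ha
  obtain ⟨l, L, hl, hL⟩ : ∃ l L : ℝ, liminf (fun k => (a k : EReal)) atTop = l ∧
      limsup (fun k => (a k : EReal)) atTop = L := by
    refine exists_liminf_limsup_coe (A := A) ?_
    filter_upwards [hGA, eventually_ge_atTop 1] with k hk hk1
    have hk0 : (0 : ℝ) < k := by exact_mod_cast hk1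
    rw [ha, abs_div, abs_of_pos hk0, div_le_iff₀ hk0]
    exact hk
  have hvol : ∀ (x : V) (b : ℝ), 0 < b → ∃ D : ℝ≥0∞, D ≠ ⊤ ∧ ∀ᶠ k : ℕ in atTop,
      vol Γ μ x (b * ρ ^ k) ≤ D * ENNReal.ofReal (Real.exp (G (ρ ^ k))) := by
    intro x b hb
    obtain ⟨D, hD, h⟩ := hVG.eventually_vol_le hb one_pos x x₀
    refine ⟨D, hD, ?_⟩
    filter_upwards [hρt.eventually h] with k hk
    rw [one_mul] at hk
    rwa [hGe]
  have hvol' : ∀ (x : V) (b : ℝ), 0 < b → ∃ D : ℝ≥0∞, D ≠ ⊤ ∧ ∀ᶠ k : ℕ in atTop,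
      ENNReal.ofReal (Real.exp (G (ρ ^ k))) ≤ D * vol Γ μ x (b * ρ ^ k) := by
    intro x b hb
    obtain ⟨D, hD, h⟩ := hVG.eventually_vol_le one_pos hb x₀ x
    refine ⟨D, hD, ?_⟩
    filter_upwards [hρt.eventually h] with k hk
    rw [one_mul] at hk
    rwa [hGe]
  have ha0 : Tendsto (fun k : ℕ => G (ρ ^ k) / k - a k) atTop (𝓝 0) := by simp [ha]
  -- Dividing the volume by `ρ^(kβ) = exp(k c)` shifts the exponential rate by `-c`.
  have hac : Tendsto (fun k : ℕ => (G (ρ ^ k) - k * c) / k - a k) atTop (𝓝 (-c)) := by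
    refine tendsto_const_nhds.congr' ?_
    filter_upwards [eventually_ge_atTop 1] with k hk
    have hk0 : (0 : ℝ) < k := by exact_mod_cast hk
    rw [ha]
    field_simp
    ring
  have hρβ : ∀ k : ℕ, (ρ ^ k) ^ β = Real.exp (k * c) := by
    intro k
    rw [Real.rpow_def_of_pos (by positivity), Real.log_pow, hc]
    ring_nf
  -- The constants depend on `w`, but the bounds on the rates do not.
  have hcous : ∀ w : RefinedTree π K r,
      liminf (fun k : ℕ => cousins k w ^ (1 / (k : ℝ))) atTop ≤ ENNReal.ofReal (Real.exp l) ∧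
      limsup (fun k : ℕ => cousins k w ^ (1 / (k : ℝ))) atTop ≤ ENNReal.ofReal (Real.exp L) := by
    intro w
    obtain ⟨D, x, b, hD, hb, h⟩ := exists_cousins_le htree hK hframe h₀le hm0 hm hfib w
    obtain ⟨D', hD', h'⟩ := hvol x b hb
    have h1 := rate_le (X := fun k => cousins k w) (C := D * D') (ENNReal.mul_ne_top hD hD') (by
      filter_upwards [h, h'] with k h1 h2
      rw [mul_assoc]
      exact h1.trans (by gcongr)) ha0
    rw [hl, hL] at h1
    simpa using h1
  have hcous' : ENNReal.ofReal (Real.exp l) ≤ liminf (fun k : ℕ =>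
        cousins k (RefinedTree.coarse w₀ hw₀ : RefinedTree π K r) ^ (1 / (k : ℝ))) atTop ∧
      ENNReal.ofReal (Real.exp L) ≤ limsup (fun k : ℕ =>
        cousins k (RefinedTree.coarse w₀ hw₀ : RefinedTree π K r) ^ (1 / (k : ℝ))) atTop := by
    obtain ⟨D, x, b, hD, hb, h⟩ :=
      exists_vol_le_cousins htree hK hframe h₀le hVG hM hcard hw₀ hw₀h.le
    obtain ⟨D', hD', h'⟩ := hvol' x b hb
    have h1 := le_rate (X := fun k => cousins k (RefinedTree.coarse w₀ hw₀ : RefinedTree π K r))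
      (C := D' * D) (ENNReal.mul_ne_top hD' hD) (by
        filter_upwards [h'] with k h2
        rw [mul_assoc]
        exact h2.trans (by gcongr; exact h k)) ha0
    rw [hl, hL] at h1
    simpa using h1
  intro N₁
  obtain ⟨N₂₀, hN₂₀⟩ := exists_energy_mul_le htree hconn hdeg hK hKconn hframe h₀le hμ_asymp hcard
    hfib hARL N₁
  refine ⟨N₂₀, fun N₂ hN₂ N hN => ?_⟩
  have hexp : ∀ k : ℕ, ENNReal.ofReal (Real.exp (G (ρ ^ k) - k * c)) =
      ENNReal.ofReal (Real.exp (G (ρ ^ k))) / ENNReal.ofReal ((ρ ^ k) ^ β) := fun k => by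
    rw [Real.exp_sub, ENNReal.ofReal_div_of_pos (Real.exp_pos _), hρβ]
  have hρβ0 : ∀ k : ℕ, ENNReal.ofReal ((ρ ^ k) ^ β) ≠ 0 := fun k =>
    (ENNReal.ofReal_pos.2 (Real.rpow_pos_of_pos (by positivity) _)).ne'
  -- With these values `log Nlow - log R = c > 0`, the constant that relates `log n` to `k` in the
  -- spectral dimensions.
  refine ⟨Real.exp l, Real.exp L, Real.exp (-c + l), Real.exp_pos _, Real.exp_pos _,
    Real.exp_pos _, ?_, ?_, ?_, ?_, ?_⟩
  · rw [Real.log_exp, Real.log_exp]; linarith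
  · exact le_antisymm (iSup_le fun w => (hcous w).1) (le_iSup_of_le _ hcous'.1)
  · exact le_antisymm (iSup_le fun w => (hcous w).2) (le_iSup_of_le _ hcous'.2)
  · refine le_antisymm (iSup_le fun w => ?_)
      (le_iSup_of_le (RefinedTree.coarse w₀ hw₀ : RefinedTree π K r) ?_)
    · obtain ⟨D, x, b, hD, hb, h⟩ := hN₂₀ N₂ hN₂ N w
      obtain ⟨D', hD', h'⟩ := hvol x b hb
      have h1 := (rate_le (C := D * D') (ENNReal.mul_ne_top hD hD')
        (X := fun k => RefinedTree.energy φ 2 k (RefinedTree.parent^[k] w) N₁ N₂ N) (by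
          filter_upwards [h, h'] with k h1 h2
          rw [hexp, ← mul_div_assoc, ENNReal.le_div_iff_mul_le (Or.inl (hρβ0 k))
            (Or.inl ENNReal.ofReal_ne_top), mul_assoc]
          exact h1.trans (by gcongr)) hac).1
      rwa [hl, ← EReal.coe_add, EReal.exp_coe] at h1
    · obtain ⟨D, x, b, hD, hb, h⟩ := exists_vol_le_energy_mul htree hconn hK hμ hframe h₀le hμ_asymp
        hm0 hm hcard hfib hBRU hw₀ hw₀h.le N₁ N₂ hN
      obtain ⟨D', hD', h'⟩ := hvol' x b hb
      have h1 := (le_rate (C := D' * D) (ENNReal.mul_ne_top hD' hD)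
        (X := fun k => RefinedTree.energy φ 2 k
          (RefinedTree.parent^[k] (RefinedTree.coarse w₀ hw₀ : RefinedTree π K r)) N₁ N₂ N) (by
          filter_upwards [h, h'] with k h1 h2
          rw [hexp]
          refine ENNReal.div_le_of_le_mul ?_
          rw [mul_assoc, mul_assoc]
          exact h2.trans (by gcongr)) hac).1
      rwa [hl, ← EReal.coe_add, EReal.exp_coe] at h1
  · intro x
    obtain ⟨D, hD⟩ := hDHK.exists_abs_log_transition_le hβ hVG hfin hpos
      (fun x => hm0.trans_le (hm x)) x x₀
    obtain ⟨h1, h2⟩ := liminf_limsup_eq_growth hρ hβ hGm hB hGA hD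
    have e : l - (-c + l) = c := by ring
    simp only [lowerSpectralDim, upperSpectralDim, Real.log_exp, e]
    rw [h1, h2]
    change 2 * (((c)⁻¹ : ℝ) * liminf (fun k => (a k : EReal)) atTop) = _ ∧
      2 * (((c)⁻¹ : ℝ) * limsup (fun k => (a k : EReal)) atTop) = _
    rw [hl, hL, div_eq_inv_mul, div_eq_inv_mul]
    simp only [EReal.coe_mul]
    exact ⟨rfl, rfl⟩
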